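/- **Model.** In the Broadcast CONGEST model, $n$ processors are the nodes $V$ of a connected undirected communication network $N=(V,L)$ of diameter $D$ (the maximum unweighted distance between two nodes of $N$). The nodes have distinct identifiers, which are numbers at most polynomial in $n$. Computation proceeds in synchronous rounds; in each round every node broadcasts one and the same message of $O(\log n)$ bits to all of its neighbours in $N$, receives the messages of its neighbours, flips finitely many private fair coins, and performs internal computation, which is free. The input is a directed graph $G=(V,E,w)$ with edge weights $w(e)\in\{0,1,\dots,W\}$ and a source $s\in V$, where $\{u,v\}\in L$ for every $(u,v)\in E$, and $2\le W\le n^{O(1)}$. Initially a node knows only its own identifier and those of its neighbours, whether it is $s$, and its incoming and outgoing edges in $G$ with their weights (in particular it is not told $n$, $D$ or $W$). Let $\operatorname{dist}_G(s,v)\in\mathbb N\cup\{\infty\}$ denote the weight of a shortest directed path from $s$ to $v$ in $G$ ($\infty$ if there is none). **Theorem.** In the Broadcast CONGEST model there is a Monte Carlo $(1+\varepsilon)$-approximate single-source shortest paths algorithm, for every $0<\varepsilon\le 1$, that always terminates within $\tilde O\big((\sqrt n\, D^{1/4}+D)\cdot\log W/\varepsilon\big)$ rounds and is correct with high probability. Precisely: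 for every $a\in\mathbb N$ there is $\beta\in\mathbb N$ such that for every $c\in\mathbb N$ there are $C\in\mathbb R$ and $k\in\mathbb N$ such that for every $\varepsilon\in(0,1]$ there is a randomized Broadcast CONGEST algorithm with the following property. For every network and every instance as above in which the identifiers are at most $n^a$ and all edge weights are at most $W$, where $2\le W\le n^a$: (i) in every execution each message has at most $\beta\lfloor\log_2 n\rfloor$ bits; (ii) in every execution all nodes have terminated after at most $$C(\log n)^k\cdot\frac{(\sqrt n\,D^{1/4}+D)\log W}{\varepsilon}$$ rounds; (iii) with probability at least $1-n^{-c}$, every node $v$ outputs a value $\tilde d(s,v)\in\mathbb N\cup\{\infty\}$ with $$\operatorname{dist}_G(s,v)\le\tilde d(s,v)\le(1+\varepsilon)\operatorname{dist}_G(s,v).$$ -/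

import Mathlib

open scoped ENNReal

universe u

namespace BroadcastCongest

/-- A communication network on the node set `V`: an undirected, connected graph of bidirectional
links, together with distinct numerical identifiers of the nodes. -/
structure Network (V : Type u) where
  links : SimpleGraph V
  connected : links.Connected
  ident : V → ℕ
  ident_injective : Function.Injective ident

/-- A single-source shortest path instance over a network: a directed graph with non-negative
integer edge weights, each of whose edges runs along a communication link, and a source node.
`weight u v = some x` says that `(u, v)` is an edge of weight `x`, and `weight u v = none` that
`(u, v)` is not an edge.  The two directions of a link are unrelated to one another. -/
structure SSSPInstance {V : Type u} (N : Network V) where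
  weight : V → V → Option ℕ
  link_of_edge : ∀ u v x, weight u v = some x → N.links.Adj u v
  source : V

/-- `HasWalk weight u v d`: there is a directed walk from `u` to `v` of total weight `d`. -/
inductive HasWalk {V : Type u} (weight : V → V → Option ℕ) : V → V → ℕ → Prop
  | nil (u : V) : HasWalk weight u u 0
  | cons {u x v : V} {a d : ℕ} (h : weight u x = some a) (p : HasWalk weight x v d) :
      HasWalk weight u v (a + d)

/-- The distance from `u` to `v`: the least weight of a directed walk, and `⊤` if there is none. -/
noncomputable def dist {V : Type u} (weight : V → V → Option ℕ) (u v : V) : ℕ∞ :=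
  sInf {e : ℕ∞ | ∃ d : ℕ, HasWalk weight u v d ∧ e = (d : ℕ∞)}

/-- `d` is an `α`-approximation (`α ≥ 1`) of the distance `δ`: `δ ≤ d ≤ α δ`. -/
def IsApprox (α : ℝ) (δ d : ℕ∞) : Prop :=
  δ ≤ d ∧ (d : ℝ≥0∞) ≤ ENNReal.ofReal α * (δ : ℝ≥0∞)

/-- What a node knows initially: its identifier, the identifiers of its neighbours, whether it is
the source, and its incoming and outgoing edges with their weights (indexed by the identifier of
the other endpoint).  In particular it knows neither the number of nodes, nor the diameter, nor
the largest edge weight. -/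
structure LocalInput where
  ident : ℕ
  neighbors : Set ℕ
  isSource : Prop
  inWeight : ℕ → Option ℕ
  outWeight : ℕ → Option ℕ

/-- A randomized algorithm for the Broadcast CONGEST model; all nodes run the same one.
Messages are natural numbers, whose size is the number of their binary digits (`Nat.size`); `0` is
the empty message.  In every round a node broadcasts the message `send σ` determined by its state
`σ`, receives the messages of its neighbours (indexed by the identifier of the sender), flips
`coins σ` private fair coins and moves to a new state.  Internal computation is free.  A node
terminates as soon as `output` has a value at its state, and this value is its output. -/
structure Algorithm where
  State : Type
  init : LocalInput → State
  send : State → ℕ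
  coins : State → ℕ
  step : (σ : State) → (inbox : ℕ → Option ℕ) → (Fin (coins σ) → Bool) → State
  output : State → Option ℕ∞

/-- The outcomes of all coins: `ω (v, t, j)` is the `j`-th coin of node `v` in round `t`. -/
abbrev Coins (V : Type u) : Type u := V × ℕ × ℕ → Bool

/-- All coins are fair and independent. -/
noncomputable def coinMeasure (V : Type u) : MeasureTheory.Measure (Coins V) :=
  MeasureTheory.Measure.infinitePi fun _ => (PMF.uniformOfFintype Bool).toMeasure

section Execution

variable {V : Type u} {N : Network V}

/-- The initial knowledge of the node `v`. -/
noncomputable def localInput (I : SSSPInstance N) (v : V) : LocalInput where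
  ident := N.ident v
  neighbors := N.ident '' N.links.neighborSet v
  isSource := v = I.source
  inWeight := Function.extend N.ident (fun u => I.weight u v) fun _ => none
  outWeight := Function.extend N.ident (fun u => I.weight v u) fun _ => none

/-- The message broadcast at a state; a terminated node stays silent. -/
def message (A : Algorithm) (σ : A.State) : ℕ :=
  if (A.output σ).isSome then 0 else A.send σ

/-- What `v` receives when each node `u` broadcasts `msg u`: for each neighbour `u` of `v`, the
message `msg u` labelled with the identifier of `u`, and nothing else. -/
noncomputable def inbox (N : Network V) (msg : V → ℕ) (v : V) : ℕ → Option ℕ :=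
  Function.extend (fun u : N.links.neighborSet v => N.ident u) (fun u => some (msg u))
    fun _ => none

/-- The states of all nodes after `t` synchronous rounds; the state of a terminated node does not
change any more. -/
noncomputable def state (A : Algorithm) (I : SSSPInstance N) (ω : Coins V) : ℕ → V → A.State
  | 0, v => A.init (localInput I v)
  | t + 1, v =>
    let σ := state A I ω t
    if (A.output (σ v)).isSome then σ v
    else A.step (σ v) (inbox N (fun u => message A (σ u)) v) fun j => ω (v, t, j)

/-- In every execution, each message consists of at most `B` bits. -/
def RespectsBandwidth (A : Algorithm) (I : SSSPInstance N) (B : ℕ) : Prop :=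
  ∀ (ω : Coins V) (t : ℕ) (v : V), (message A (state A I ω t v)).size ≤ B

/-- In every execution, all nodes have terminated after at most `R` rounds. -/
def TerminatesWithin (A : Algorithm) (I : SSSPInstance N) (R : ℝ) : Prop :=
  ∀ ω : Coins V, ∃ t : ℕ, (t : ℝ) ≤ R ∧ ∀ v, (A.output (state A I ω t v)).isSome

/-- The event that each node `v` outputs an `α`-approximation of its distance from the source. -/
def successEvent (A : Algorithm) (I : SSSPInstance N) (α : ℝ) : Set (Coins V) :=
  {ω | ∀ v, ∃ t d, A.output (state A I ω t v) = some d ∧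
    IsApprox α (dist I.weight I.source v) d}

end Execution

end BroadcastCongest

/-! Let e be the eccentricity of the source, so e ≤ D, and put G = √n · e^(1/4). The algorithm uses
e in place of D. For the analysis only, fix a tree of shortest paths with the fewest possible edges
(`PathTree`). Nodes are sampled at two nested levels S' ⊆ S, both containing the source. With high
probability every stretch of b ≈ G log n tree edges meets S, every stretch of H edges meets S', |S|
is about n/G, and |S'| is at most about √e, up to logarithms (`real_not_hits_le`,
`real_sampleBound_lt_le`).

Distances along few edges come from rounding (`HopWalk.scaled`). In units of 2^i/(qh), with 2^i ≤ d
< 2^(i+1), a walk of weight d with at most h edges has length O(qh), and rounding costs a factor of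
at most 1 + 1/q. One flooding for each of O(log n) scales therefore reduces the problem to detecting
short lengths from many sources at once.

That is done by pipelining (`flood_eq_leastKey`): an entry with key κ is announced in round κ +
(number of entries before it). Every least key arrives with a delay of at most the number of labels,
although each message carries one entry.

The first floodings run in the network from S with hop bound 2b. Their estimates are the edge
weights of an overlay graph on S. The second floodings run from S' in the overlay graph, where a
stretch of H tree edges becomes at most H/b + 1 overlay edges. One unit of overlay length lasts A =
2e + 1 rounds, enough for an entry to cross the network, so every node learns every overlay estimate
(`derivable_relay`, `derivable_overlay_of_walk`). A node then locally joins overlay estimates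
between successive members of S' along its tree path, one more to a nearby member of S, and its own
network estimate (`exists_final_walk`). At most two roundings affect each piece, giving (1 + 1/q)² ≤
1 + ε when q ≥ 3/ε.

The network floodings cost about qb + |S|, the overlay ones about e·q·H/b + |S|·|S'|. With 1/G and
max(√e/n, ...) style sampling rates, chosen as powers of two, all terms are at most about q(G + e).
Message size, termination and the lower bound on the output hold in every execution; only the upper
bound depends on the sample. -/

namespace BroadcastCongest

/-! ### Minima, sums and maxima over received messages -/

section Inbox

variable {V : Type u} {N : Network V}

theorem inbox_ident_of_adj (msg : V → ℕ) {v u : V} (h : N.links.Adj v u) :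
    inbox N msg v (N.ident u) = some (msg u) := by
  have hinj : Function.Injective (fun u : N.links.neighborSet v => N.ident u) :=
    fun x y hxy => Subtype.ext (N.ident_injective hxy)
  exact hinj.extend_apply (fun u : N.links.neighborSet v => some (msg u)) (fun _ => none) ⟨u, h⟩

theorem inbox_eq_some_iff (msg : V → ℕ) {v : V} {i m : ℕ} :
    inbox N msg v i = some m ↔ ∃ u, N.links.Adj v u ∧ N.ident u = i ∧ msg u = m := by
  constructor
  · intro h
    by_cases hi : ∃ u : N.links.neighborSet v, N.ident u = i
    · obtain ⟨⟨u, hu⟩, rfl⟩ := hi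
      rw [inbox_ident_of_adj msg hu] at h
      exact ⟨u, hu, rfl, by simpa using h⟩
    · rw [inbox, Function.extend_apply' _ _ _ hi] at h
      simp at h
  · rintro ⟨u, hu, rfl, rfl⟩
    exact inbox_ident_of_adj msg hu

theorem iInf_inbox_elim (msg : V → ℕ) (v : V) (g : ℕ → ℕ → ℕ∞) :
    ⨅ i, (inbox N msg v i).elim ⊤ (g i) =
      ⨅ u, ⨅ _ : N.links.Adj v u, g (N.ident u) (msg u) := by
  apply le_antisymm
  · refine le_iInf fun u => le_iInf fun hu => ?_
    exact (iInf_le _ (N.ident u)).trans (by rw [inbox_ident_of_adj msg hu]; exact le_rfl)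
  · refine le_iInf fun i => ?_
    cases h : inbox N msg v i with
    | none => simp
    | some m =>
      obtain ⟨u, hu, rfl, rfl⟩ := (inbox_eq_some_iff msg).1 h
      exact iInf₂_le u hu

theorem finsum_inbox_elim [Fintype V] [DecidableRel N.links.Adj] (msg : V → ℕ) (v : V)
    (g : ℕ → ℕ) :
    ∑ᶠ i, (inbox N msg v i).elim 0 g = ∑ u with N.links.Adj v u, g (msg u) := by
  classical
  rw [finsum_eq_sum_of_support_subset (s := (Finset.univ.filter (N.links.Adj v)).image N.ident),
    Finset.sum_image (fun x _ y _ h => N.ident_injective h)]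
  · refine Finset.sum_congr rfl fun u hu => ?_
    rw [inbox_ident_of_adj msg (by simpa using hu)]
    rfl
  · intro i hi
    cases h : inbox N msg v i with
    | none => simp [h] at hi
    | some m =>
      obtain ⟨u, hu, rfl, rfl⟩ := (inbox_eq_some_iff msg).1 h
      simp only [Finset.coe_image, Finset.coe_filter, Finset.mem_univ, true_and]
      exact ⟨u, hu, rfl⟩

/-- The largest value of `g` on the received messages (`0` if there are none). -/
noncomputable def inboxSup (b : ℕ → Option ℕ) (g : ℕ → ℕ) : ℕ :=
  sSup {k | ∃ i m, b i = some m ∧ g m = k}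

theorem inboxSup_inbox_le {msg : V → ℕ} {v : V} {g : ℕ → ℕ} {k : ℕ}
    (h : ∀ u, N.links.Adj v u → g (msg u) ≤ k) : inboxSup (inbox N msg v) g ≤ k := by
  refine csSup_le' ?_
  rintro _ ⟨i, m, hm, rfl⟩
  obtain ⟨u, hu, -, rfl⟩ := (inbox_eq_some_iff msg).1 hm
  exact h u hu

theorem le_inboxSup_inbox [Finite V] {msg : V → ℕ} {v u : V} (g : ℕ → ℕ)
    (h : N.links.Adj v u) : g (msg u) ≤ inboxSup (inbox N msg v) g := by
  refine le_csSup ?_ ⟨N.ident u, msg u, inbox_ident_of_adj msg h, rfl⟩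
  refine (Set.Finite.subset (Set.finite_range fun u => g (msg u)) ?_).bddAbove
  rintro _ ⟨i, m, hm, rfl⟩
  obtain ⟨u, hu, -, rfl⟩ := (inbox_eq_some_iff msg).1 hm
  exact ⟨u, rfl⟩

end Inbox

/-! ### Protocols with simultaneous termination and their composition -/

/-- A distributed procedure that turns an input `X` of each node into an output `Y`; each node
flips one coin per round. -/
structure Protocol (X Y : Type) where
  State : Type
  init : X → State
  send : State → ℕ
  step : State → (ℕ → Option ℕ) → Bool → State
  output : State → Option Y

namespace Protocol

variable {V : Type u} {X Y Z : Type}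

/-- The states of all nodes after `t` rounds. -/
noncomputable def run (P : Protocol X Y) (N : Network V) (x : V → X) (ω : ℕ → V → Bool) :
    ℕ → V → P.State
  | 0, v => P.init (x v)
  | t + 1, v => P.step (run P N x ω t v) (inbox N (fun u => P.send (run P N x ω t u)) v) (ω t v)

/-- On inputs `x` and coins `ω`, all nodes finish simultaneously after `T` rounds with outputs
`y`, and all messages have at most `B` bits. -/
structure Computes (P : Protocol X Y) (N : Network V) (x : V → X) (ω : ℕ → V → Bool) (B T : ℕ)
    (y : V → Y) : Prop where
  output_eq : ∀ v, P.output (P.run N x ω T v) = some (y v)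
  output_none : ∀ t < T, ∀ v, P.output (P.run N x ω t v) = none
  size_send_le : ∀ t < T, ∀ v, (P.send (P.run N x ω t v)).size ≤ B

/-- The state of a sequential composition whose first part is in state `σ`. -/
def enter (P : Protocol X Y) (Q : Protocol Y Z) (σ : P.State) : P.State ⊕ Q.State :=
  (P.output σ).elim (.inl σ) fun y => .inr (Q.init y)

/-- Run `P` and then `Q` on the outputs of `P`. -/
def seq (P : Protocol X Y) (Q : Protocol Y Z) : Protocol X Z where
  State := P.State ⊕ Q.State
  init x := P.enter Q (P.init x)
  send := Sum.elim P.send Q.send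
  step
    | .inl σ, b, c => P.enter Q (P.step σ b c)
    | .inr σ, b, c => .inr (Q.step σ b c)
  output := Sum.elim (fun _ => none) Q.output

/-- Simultaneous termination is what makes composition possible without further synchronization: all
nodes enter `Q` in round `T₁`. The change of state happens inside the last step of `P` (`enter`), so
no round is lost. -/
theorem Computes.seq {P : Protocol X Y} {Q : Protocol Y Z} {N : Network V} {x : V → X}
    {y : V → Y} {z : V → Z} {ω : ℕ → V → Bool} {B T₁ T₂ : ℕ} (hP : P.Computes N x ω B T₁ y)
    (hQ : Q.Computes N y (fun t => ω (T₁ + t)) B T₂ z) :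
    (P.seq Q).Computes N x ω B (T₁ + T₂) z := by
  have h₁ : ∀ t ≤ T₁, ∀ v, (P.seq Q).run N x ω t v = P.enter Q (P.run N x ω t v) := by
    intro t
    induction t with
    | zero => exact fun _ _ => rfl
    | succ t ih =>
      intro ht v
      have h : ∀ v, (P.seq Q).run N x ω t v = .inl (P.run N x ω t v) := fun v => by
        rw [ih (by omega) v, enter, hP.output_none t (by omega) v]; rfl
      rw [run, h v]
      simp only [h, run]
      rfl
  have h₁' : ∀ t < T₁, ∀ v, (P.seq Q).run N x ω t v = .inl (P.run N x ω t v) := fun t ht v => by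
    rw [h₁ t ht.le v, enter, hP.output_none t ht v]; rfl
  have h₂ : ∀ t v, (P.seq Q).run N x ω (T₁ + t) v =
      .inr (Q.run N y (fun t => ω (T₁ + t)) t v) := by
    intro t
    induction t with
    | zero => intro v; rw [Nat.add_zero, h₁ T₁ le_rfl v, enter, hP.output_eq v]; rfl
    | succ t ih =>
      intro v
      rw [← Nat.add_assoc, run, ih v]
      simp only [ih, run]
      rfl
  refine ⟨fun v => ?_, fun t ht v => ?_, fun t ht v => ?_⟩
  · rw [h₂]; exact hQ.output_eq v
  · rcases lt_or_ge t T₁ with h | h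
    · rw [h₁' t h]; rfl
    · obtain ⟨t, rfl⟩ := Nat.exists_eq_add_of_le h
      rw [h₂]; exact hQ.output_none t (by omega) v
  · rcases lt_or_ge t T₁ with h | h
    · rw [h₁' t h]; exact hP.size_send_le t h v
    · obtain ⟨t, rfl⟩ := Nat.exists_eq_add_of_le h
      rw [h₂]; exact hQ.size_send_le t (by omega) v

/-- Flip `k x` coins in as many silent rounds. -/
def flipCoins (k : X → ℕ) : Protocol X (X × (ℕ → Bool)) where
  State := X × ℕ × (ℕ → Bool)
  init x := (x, 0, fun _ => false)
  send _ := 0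
  step σ _ c := (σ.1, σ.2.1 + 1, Function.update σ.2.2 σ.2.1 c)
  output σ := if k σ.1 ≤ σ.2.1 then some (σ.1, σ.2.2) else none

theorem flipCoins_computes (k : X → ℕ) (N : Network V) (x : V → X) (ω : ℕ → V → Bool) (B J : ℕ)
    (hk : ∀ v, k (x v) = J) :
    (flipCoins k).Computes N x ω B J
      fun v => (x v, fun i => if i < J then ω i v else false) := by
  have h : ∀ t v, (flipCoins k).run N x ω t v =
      (x v, t, fun i => if i < t then ω i v else false) := by
    intro t
    induction t with
    | zero => intro v; simp [run, flipCoins]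
    | succ t ih =>
      intro v
      rw [run, ih v]
      simp only [flipCoins, Prod.mk.injEq, true_and]
      funext i
      rcases lt_trichotomy i t with hi | rfl | hi
      · rw [Function.update_of_ne hi.ne]; simp [hi, hi.trans (Nat.lt_succ_self t)]
      · simp
      · rw [Function.update_of_ne hi.ne']; simp [hi.not_gt, (show ¬ i < t + 1 by omega)]
  refine ⟨fun v => ?_, fun t ht v => ?_, fun t ht v => ?_⟩
  · rw [h]; simp [flipCoins, hk]
  · rw [h]; simp [flipCoins, hk, ht]
  · simp [flipCoins]

/-- A protocol that starts from the initial knowledge of the nodes is an algorithm. -/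
def toAlgorithm (P : Protocol LocalInput ℕ∞) : Algorithm where
  State := P.State
  init := P.init
  send := P.send
  coins _ := 1
  step σ b c := P.step σ b (c 0)
  output := P.output

section toAlgorithm

variable {P : Protocol LocalInput ℕ∞} {N : Network V} {I : SSSPInstance N} {ω : Coins V}
  {B T : ℕ} {y : V → ℕ∞}

/-- The model freezes and silences terminated nodes, whereas `run` does not. Before round `T` no
node has terminated, so the difference has no effect up to then. -/
theorem Computes.state_eq
    (h : P.Computes N (localInput I) (fun t v => ω (v, t, 0)) B T y) :
    ∀ t ≤ T, state P.toAlgorithm I ω t = P.run N (localInput I) (fun t v => ω (v, t, 0)) t := by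
  intro t
  induction t with
  | zero => exact fun _ => rfl
  | succ t ih =>
    intro ht
    have hs := ih (by omega)
    have ho := h.output_none t (by omega)
    funext v
    have ho' : ∀ v, (P.toAlgorithm.output (state P.toAlgorithm I ω t v)).isSome = false :=
      fun v => by rw [hs]; simp [toAlgorithm, ho]
    have hm : ∀ v, message P.toAlgorithm (state P.toAlgorithm I ω t v) =
        P.send (P.run N (localInput I) (fun t v => ω (v, t, 0)) t v) := fun v => by
      rw [message, ho', hs]; rfl
    rw [state, run]
    simp only [hm, ho' v]
    rw [hs]
    rfl

theorem Computes.state_eq_of_le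
    (h : P.Computes N (localInput I) (fun t v => ω (v, t, 0)) B T y) :
    ∀ t, state P.toAlgorithm I ω (T + t) =
      P.run N (localInput I) (fun t v => ω (v, t, 0)) T := by
  intro t
  induction t with
  | zero => exact h.state_eq T le_rfl
  | succ t ih =>
    funext v
    rw [← Nat.add_assoc, state, ih]
    have : (P.toAlgorithm.output (P.run N (localInput I) (fun t v => ω (v, t, 0)) T v)).isSome := by
      simp [toAlgorithm, h.output_eq v]
    exact if_pos this

theorem Computes.output_state
    (h : P.Computes N (localInput I) (fun t v => ω (v, t, 0)) B T y) (v : V) :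
    P.toAlgorithm.output (state P.toAlgorithm I ω T v) = some (y v) := by
  rw [h.state_eq T le_rfl]; exact h.output_eq v

theorem Computes.size_message_le
    (h : P.Computes N (localInput I) (fun t v => ω (v, t, 0)) B T y) (t : ℕ) (v : V) :
    (message P.toAlgorithm (state P.toAlgorithm I ω t v)).size ≤ B := by
  unfold message
  split_ifs with ho
  · simp
  · rcases lt_or_ge t T with ht | ht
    · rw [h.state_eq t ht.le]; exact h.size_send_le t ht v
    · obtain ⟨t, rfl⟩ := Nat.exists_eq_add_of_le ht
      rw [h.state_eq_of_le] at ho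
      exact absurd (by simp [toAlgorithm, h.output_eq v]) ho

end toAlgorithm

end Protocol

/-! ### Pipelined flooding of tables of keys -/

section Flooding

/-- The order in which the entries of a table of keys are announced: by key, then by label. -/
def Before (K : ℕ → ℕ∞) (m l : ℕ) : Prop := K m < K l ∨ K m = K l ∧ m < l

/-- The number of entries that come before the entry with label `l`. -/
noncomputable def position (K : ℕ → ℕ∞) (l : ℕ) : ℕ := {m | Before K m l}.ncard

open Classical in
/-- The message sent in round `t`: the entry whose key and position add up to `t`. -/
noncomputable def announce (K : ℕ → ℕ∞) (t : ℕ) : ℕ :=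
  if h : ∃ p : ℕ × ℕ, K p.2 = p.1 ∧ p.1 + position K p.2 = t then
    Nat.pair h.choose.1 h.choose.2 + 1 else 0

/-- The key of the label `l` that a message `m` gives rise to by the rule `r`, which turns a key
and its label into keys of the other labels. -/
def derived (r : ℕ → ℕ → ℕ → ℕ∞) (m l : ℕ) : ℕ∞ :=
  if m = 0 then ⊤ else r (m - 1).unpair.1 (m - 1).unpair.2 l

variable {V : Type u} (G : SimpleGraph V) (ini : V → ℕ → ℕ∞) (R : V → V → ℕ → ℕ → ℕ → ℕ∞)

/-- The tables of keys after `t` rounds of flooding: `ini v` is the initial table of `v`, and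
`R v u` the rule by which `v` makes use of an entry of `u`. -/
noncomputable def flood : ℕ → V → ℕ → ℕ∞
  | 0 => ini
  | t + 1 => fun v l =>
    flood t v l ⊓ ⨅ u, ⨅ _ : G.Adj v u, derived (R v u) (announce (flood t u) t) l

/-- `Derivable v l κ`: the key `κ` of the label `l` at `v` follows from the rules. -/
inductive Derivable : V → ℕ → ℕ → Prop
  | base {v : V} {l κ : ℕ} (h : ini v l = κ) : Derivable v l κ
  | step {v u : V} {l l' κ κ' : ℕ} (ha : G.Adj v u) (h : Derivable u l κ)
      (hR : R v u κ l l' = κ') : Derivable v l' κ'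

/-- The least derivable key. -/
noncomputable def leastKey (v : V) (l : ℕ) : ℕ∞ := ⨅ κ : ℕ, ⨅ _ : Derivable G ini R v l κ, (κ : ℕ∞)

variable {G ini R}

theorem leastKey_le {v : V} {l κ : ℕ} (h : Derivable G ini R v l κ) :
    leastKey G ini R v l ≤ κ := iInf₂_le κ h

theorem exists_derivable {v : V} {l : ℕ} (h : leastKey G ini R v l ≠ ⊤) :
    ∃ κ : ℕ, leastKey G ini R v l = κ ∧ Derivable G ini R v l κ := by
  have hex : ∃ κ : ℕ, Derivable G ini R v l κ := by
    by_contra! hc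
    exact h (by simp [leastKey, hc])
  classical
  refine ⟨Nat.find hex, le_antisymm (leastKey_le (Nat.find_spec hex)) ?_, Nat.find_spec hex⟩
  exact le_iInf₂ fun κ hκ => by exact_mod_cast Nat.find_min' hex hκ

theorem announce_spec {K : ℕ → ℕ∞} {t : ℕ} (h : announce K t ≠ 0) :
    ∃ κ l : ℕ, announce K t = Nat.pair κ l + 1 ∧ K l = κ ∧ κ + position K l = t := by
  unfold announce at h ⊢
  split_ifs with hex
  · exact ⟨_, _, rfl, hex.choose_spec⟩
  · simp [hex] at h

theorem Before.trans {K : ℕ → ℕ∞} {a b c : ℕ} (h : Before K a b) (h' : Before K b c) :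
    Before K a c := by
  rcases h with h | ⟨h, hl⟩ <;> rcases h' with h' | ⟨h', hl'⟩
  · exact .inl (h.trans h')
  · exact .inl (h' ▸ h)
  · exact .inl (h ▸ h')
  · exact .inr ⟨h.trans h', hl.trans hl'⟩

theorem not_before_self (K : ℕ → ℕ∞) (a : ℕ) : ¬ Before K a a := by
  rintro (h | ⟨-, h⟩) <;> exact lt_irrefl _ h

theorem before_or_eq_or_before (K : ℕ → ℕ∞) (a b : ℕ) : Before K a b ∨ a = b ∨ Before K b a := by
  unfold Before
  rcases lt_trichotomy (K a) (K b) with h | h | h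
  · exact .inl (.inl h)
  · rcases lt_trichotomy a b with h' | h' | h'
    · exact .inl (.inr ⟨h, h'⟩)
    · exact .inr (.inl h')
    · exact .inr (.inr (.inr ⟨h.symm, h'⟩))
  · exact .inr (.inr (.inl h))

theorem Before.ne_top {K : ℕ → ℕ∞} {a b : ℕ} (h : Before K a b) (hb : K b ≠ ⊤) : K a ≠ ⊤ := by
  rcases h with h | ⟨h, -⟩
  · exact h.ne_top
  · rwa [h]

/-- Key plus position increases strictly along `Before`, so no two entries are scheduled for the
same round and the choice in `announce` is forced. Finiteness is needed because `ncard` of an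
infinite set is `0`. -/
theorem announce_eq {K : ℕ → ℕ∞} {κ l : ℕ} (hfin : {m | K m ≠ ⊤}.Finite) (hl : K l = κ) :
    announce K (κ + position K l) = Nat.pair κ l + 1 := by
  have hex : ∃ p : ℕ × ℕ, K p.2 = p.1 ∧ p.1 + position K p.2 = κ + position K l :=
    ⟨(κ, l), hl, rfl⟩
  have key : ∀ {κ l κ' l' : ℕ}, K l = κ → K l' = κ' → Before K l l' →
      κ + position K l < κ' + position K l' := by
    intro κ l κ' l' h h' hb
    have hκ : κ ≤ κ' := by
      have : (κ : ℕ∞) ≤ κ' := by rw [← h, ← h']; rcases hb with hb | hb; exacts [hb.le, hb.1.le]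
      exact_mod_cast this
    have : position K l < position K l' := by
      refine Set.ncard_lt_ncard ⟨fun m hm => Before.trans hm hb, fun hs => ?_⟩
        (hfin.subset fun m hm => Before.ne_top hm (by simp [h']))
      exact not_before_self K l (hs hb)
    omega
  unfold announce
  rw [dif_pos hex]
  obtain ⟨h₁, h₂⟩ := hex.choose_spec
  have hl' : hex.choose.2 = l := by
    rcases before_or_eq_or_before K hex.choose.2 l with h | h | h
    · exact absurd h₂ (key h₁ hl h).ne
    · exact h
    · exact absurd h₂ (key hl h₁ h).ne'
  have : (hex.choose.1 : ℕ∞) = κ := by rw [← h₁, hl', hl]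
  rw [hl', ENat.natCast_inj.1 this]

theorem exists_lt_top_of_iInf_lt_top {ι : Sort*} {f : ι → ℕ∞} (h : ⨅ i, f i ≠ ⊤) :
    ∃ i, f i = ⨅ j, f j := by
  have : Nonempty ι := by
    by_contra hc
    rw [not_nonempty_iff] at hc
    simp at h
  exact ciInf_mem f

theorem flood_derivable {t : ℕ} {v : V} {l κ : ℕ} (h : flood G ini R t v l = κ) :
    Derivable G ini R v l κ := by
  induction t generalizing v l κ with
  | zero => exact .base h
  | succ t ih =>
    rw [flood] at h
    rcases min_choice (flood G ini R t v l)
      (⨅ u, ⨅ _ : G.Adj v u, derived (R v u) (announce (flood G ini R t u) t) l) with hc | hc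
    · exact ih (hc.symm.trans h)
    · have h := hc.symm.trans h
      obtain ⟨u, hu⟩ := exists_lt_top_of_iInf_lt_top (h.trans_ne (ENat.natCast_ne_top κ))
      rw [h] at hu
      obtain ⟨ha, hu'⟩ := exists_lt_top_of_iInf_lt_top (hu.trans_ne (ENat.natCast_ne_top κ))
      rw [hu] at hu'
      unfold derived at hu'
      split_ifs at hu' with h0
      · simp at hu'
      · obtain ⟨κ₀, l₀, hm, hK, -⟩ := announce_spec h0
        rw [hm, Nat.add_sub_cancel, Nat.unpair_pair] at hu'
        exact .step ha (ih hK) hu'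

theorem leastKey_le_flood (t : ℕ) (v : V) (l : ℕ) :
    leastKey G ini R v l ≤ flood G ini R t v l := by
  cases h : flood G ini R t v l with
  | top => exact le_top
  | coe κ => exact leastKey_le (flood_derivable h)

theorem flood_antitone (v : V) (l : ℕ) : Antitone fun t => flood G ini R t v l :=
  antitone_nat_of_succ_le fun _ => inf_le_left

/-- Rules under which flooding is not delayed by more than the number of labels. -/
structure Regular (R : V → V → ℕ → ℕ → ℕ → ℕ∞) : Prop where
  mono : ∀ v u κ κ' l l', κ ≤ κ' → R v u κ l l' ≤ R v u κ' l l'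
  lt : ∀ (v u : V) (κ l l' : ℕ), (κ : ℕ∞) < R v u κ l l'
  relay : ∀ v u κ l l' κ' k m, R v u κ l l' = (κ' : ℕ) → (k < κ ∨ k = κ ∧ m < l) →
    R v u k m m < κ' ∨ R v u k m m = κ' ∧ m < l'

/-- Strong induction on the deadline, key plus final position. A least key at `v` comes from a least
key at a neighbour `u`. Strict growth of keys and `relay` make the deadline at `u` earlier, and at
that deadline `u` announces precisely this entry, because everything ahead of it in its table is
already final. -/
theorem flood_eq_leastKey (hR : Regular R) {Λ : Finset ℕ}
    (hΛ : ∀ v l κ, Derivable G ini R v l κ → l ∈ Λ) {v : V} {l κ : ℕ}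
    (h : leastKey G ini R v l = κ) {t : ℕ} (ht : κ + position (leastKey G ini R v) l ≤ t) :
    flood G ini R t v l = κ := by
  set F := leastKey G ini R with hF
  have hfinF : ∀ v, {m | F v m ≠ ⊤}.Finite := fun v => Λ.finite_toSet.subset fun m hm => by
    obtain ⟨κ, -, hd⟩ := exists_derivable hm
    exact hΛ _ _ _ hd
  have hfin : ∀ t v, {m | flood G ini R t v m ≠ ⊤}.Finite := fun t v => (hfinF v).subset
    fun m hm => ((leastKey_le_flood t v m).trans_lt (lt_top_iff_ne_top.2 hm)).ne
  induction hn : κ + position (F v) l using Nat.strong_induction_on generalizing v l κ t with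
  | _ n ih =>
    refine le_antisymm ((flood_antitone v l ht).trans ?_) (h ▸ leastKey_le_flood t v l)
    obtain ⟨κ₁, h₁, hd⟩ := exists_derivable (h.trans_ne (ENat.natCast_ne_top κ))
    obtain rfl : κ₁ = κ := by rw [← hF, h] at h₁; exact_mod_cast h₁.symm
    cases hd with
    | base hb => exact (flood_antitone v l (Nat.zero_le _)).trans (by rw [← hb]; exact le_rfl)
    | @step _ u l₀ _ κ₀ _ ha hd₀ hRe =>
      -- the derivation may be taken from the least key of the neighbour
      obtain ⟨κu, hκu, -⟩ := exists_derivable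
        (((leastKey_le hd₀).trans_lt (ENat.natCast_lt_top _)).ne)
      have hle : κu ≤ κ₀ := by have := leastKey_le hd₀; rw [hκu] at this; exact_mod_cast this
      have hRu : R v u κu l₀ l = κ₁ := by
        refine le_antisymm (hRe ▸ hR.mono _ _ _ _ _ _ hle) ?_
        have hlt := lt_top_iff_ne_top.2 (((hR.mono v u _ _ l₀ l hle).trans_lt
          (hRe ▸ ENat.natCast_lt_top κ₁)).ne)
        obtain ⟨κ₂, hκ₂⟩ := ENat.ne_top_iff_exists.1 hlt.ne
        obtain ⟨κ₃, h₃, hd₃⟩ := exists_derivable (hκu.trans_ne (ENat.natCast_ne_top κu))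
        obtain rfl : κ₃ = κu := by rw [hκu] at h₃; exact_mod_cast h₃.symm
        rw [← hκ₂, ← h]
        exact leastKey_le (.step ha hd₃ hκ₂.symm)
      have hlt : κu < κ₁ := by have := hR.lt v u κu l₀ l; rw [hRu] at this; exact_mod_cast this
      -- By `relay`, a label ahead of `l₀` at `u` is also ahead of `l` at `v`: waiting at `u` is
      -- already paid for by the position at `v`.
      have hpos : position (F u) l₀ ≤ position (F v) l := by
        refine Set.ncard_le_ncard (fun m hm => ?_)
          ((hfinF v).subset fun m hm => Before.ne_top hm (by simp [h]))
        obtain ⟨k, hk, hdk⟩ := exists_derivable (G := G) (ini := ini) (R := R) (Before.ne_top hm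
          (by rw [hκu]; exact ENat.natCast_ne_top _))
        have hkm : k < κu ∨ k = κu ∧ m < l₀ := by
          have := hm
          simp only [Set.mem_ofPred_eq, Before, hF, hk, hκu] at this
          exact_mod_cast this
        have hle' : F v m ≤ R v u k m m := by
          cases hr : R v u k m m with
          | top => exact le_top
          | coe r => exact leastKey_le (.step ha hdk hr)
        simp only [Set.mem_ofPred_eq, Before, h]
        rcases hR.relay v u κu l₀ l κ₁ k m hRu hkm with hr | ⟨hr, hml⟩
        · exact .inl (hle'.trans_lt hr)
        · rcases (hr ▸ hle').lt_or_eq with h' | h'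
          · exact .inl h'
          · exact .inr ⟨h', hml⟩
      set τ := κu + position (F u) l₀ with hτ
      have hτn : τ < n := by omega
      have hu : flood G ini R τ u l₀ = κu := ih τ hτn hκu le_rfl rfl
      -- Entries finally ahead of `l₀` have earlier deadlines and are settled by induction. No other
      -- entry can be ahead in the meantime, since current keys are never below the least ones. So
      -- the current position of `l₀` is its final one.
      have hbef : ∀ m, Before (flood G ini R τ u) m l₀ ↔ Before (F u) m l₀ := by
        intro m
        constructor
        · intro hb
          have hle := leastKey_le_flood (G := G) (ini := ini) (R := R) τ u m
          simp only [Before, hu] at hb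
          simp only [Before, hF, hκu]
          rcases hb with hb | ⟨hb, hb'⟩
          · exact .inl (hle.trans_lt hb)
          · rcases (hb ▸ hle).lt_or_eq with h' | h'
            · exact .inl h'
            · exact .inr ⟨h', hb'⟩
        · intro hb
          obtain ⟨k, hk, hdk⟩ := exists_derivable (G := G) (ini := ini) (R := R) (Before.ne_top hb
            (by rw [hκu]; exact ENat.natCast_ne_top _))
          have hkle : k ≤ κu := by
            have := hb
            simp only [Before, hF, hk, hκu] at this
            rcases this with h' | h'
            · exact le_of_lt (by exact_mod_cast h')
            · exact le_of_eq (by exact_mod_cast h'.1)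
          have hplt : position (F u) m < position (F u) l₀ :=
            Set.ncard_lt_ncard ⟨fun x hx => Before.trans hx hb, fun hs =>
              not_before_self _ m (hs hb)⟩
              ((hfinF u).subset fun x hx => Before.ne_top hx (by simp [hF, hκu]))
          have hm : flood G ini R τ u m = k := ih (k + position (F u) m) (by omega) hk
            (by omega) rfl
          have := hb
          simp only [Before, hF, hk, hκu] at this
          simpa only [Before, hm, hu] using this
      have hann : announce (flood G ini R τ u) τ = Nat.pair κu l₀ + 1 := by
        have hp : position (flood G ini R τ u) l₀ = position (F u) l₀ := by
          simp only [position, hbef]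
        rw [← announce_eq (hfin τ u) hu, hp]
      calc flood G ini R (κ₁ + position (F v) l) v l
          ≤ flood G ini R (τ + 1) v l := flood_antitone v l (by omega)
        _ ≤ derived (R v u) (announce (flood G ini R τ u) τ) l :=
            inf_le_right.trans (iInf₂_le u ha)
        _ = κ₁ := by simp [hann, derived, hRu]

/-- Flooding finds every key after as many additional rounds as there are labels. -/
theorem flood_le (hR : Regular R) {Λ : Finset ℕ}
    (hΛ : ∀ v l κ, Derivable G ini R v l κ → l ∈ Λ) {v : V} {l κ t : ℕ}
    (h : Derivable G ini R v l κ) (ht : κ + Λ.card ≤ t) : flood G ini R t v l ≤ κ := by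
  have hle := leastKey_le h
  obtain ⟨κ', h', hd⟩ := exists_derivable (hle.trans_lt (ENat.natCast_lt_top _)).ne
  have hκ : κ' ≤ κ := by rw [h'] at hle; exact_mod_cast hle
  have hp : position (leastKey G ini R v) l ≤ Λ.card := by
    rw [← Set.ncard_coe_finset]
    refine Set.ncard_le_ncard (fun m hm => ?_)
    obtain ⟨k, -, hk⟩ := exists_derivable (Before.ne_top hm (by simp [h']))
    exact hΛ _ _ _ hk
  rw [flood_eq_leastKey hR hΛ h' (by omega)]
  exact_mod_cast hκ

/-- This bounds messages: positions are nonnegative, so an announced key is at most the round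
number. -/
theorem announce_flood_spec {t t' : ℕ} {v : V} (h : announce (flood G ini R t v) t' ≠ 0) :
    ∃ κ l, announce (flood G ini R t v) t' = Nat.pair κ l + 1 ∧ κ ≤ t' ∧
      Derivable G ini R v l κ := by
  obtain ⟨κ, l, h₁, h₂, h₃⟩ := announce_spec h
  exact ⟨κ, l, h₁, by omega, flood_derivable h₂⟩

end Flooding

/-! ### Several floodings in succession as one protocol -/

/-- What a node has to know to take part in several successive floodings. -/
structure FloodInput where
  rounds : ℕ
  instances : ℕ
  init : ℕ → ℕ → ℕ∞
  rule : ℕ → ℕ → ℕ → ℕ → ℕ → ℕ∞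

namespace Protocol

variable {V : Type u} {X : Type}

open Classical in
/-- Successive floodings; instance `i` starts after `i * rounds` rounds. -/
noncomputable def floods (f : X → FloodInput) : Protocol X (X × (ℕ → ℕ → ℕ∞)) where
  State := X × ℕ × (ℕ → ℕ → ℕ∞)
  init x := (x, 0, (f x).init)
  send σ := announce (σ.2.2 (σ.2.1 / (f σ.1).rounds)) (σ.2.1 % (f σ.1).rounds)
  step σ b _ := (σ.1, σ.2.1 + 1, Function.update σ.2.2 (σ.2.1 / (f σ.1).rounds) fun l =>
    σ.2.2 (σ.2.1 / (f σ.1).rounds) l ⊓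
      ⨅ i, (b i).elim ⊤ fun m => derived ((f σ.1).rule (σ.2.1 / (f σ.1).rounds) i) m l)
  output σ := if (f σ.1).instances * (f σ.1).rounds ≤ σ.2.1 then some (σ.1, σ.2.2) else none

theorem floods_computes (f : X → FloodInput) (N : Network V) (x : V → X) (ω : ℕ → V → Bool)
    {B T k : ℕ} (hT : 0 < T) (hr : ∀ v, (f (x v)).rounds = T) (hk : ∀ v, (f (x v)).instances = k)
    (hB : ∀ i < k, ∀ t < T, ∀ v, (announce (flood N.links (fun v => (f (x v)).init i)
      (fun v u => (f (x v)).rule i (N.ident u)) t v) t).size ≤ B) :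
    ∃ K : V → ℕ → ℕ → ℕ∞, (floods f).Computes N x ω B (k * T) (fun v => (x v, K v)) ∧
      ∀ i < k, ∀ v, K v i = flood N.links (fun v => (f (x v)).init i)
        (fun v u => (f (x v)).rule i (N.ident u)) T v := by
  set F : ℕ → ℕ → V → ℕ → ℕ∞ := fun i => flood N.links (fun v => (f (x v)).init i)
        (fun v u => (f (x v)).rule i (N.ident u)) with hF
  -- Truncated subtraction and `min` express all phases at once: instance `i` has run 0 rounds
  -- before its slot, `t - i * T` rounds within it and `T` rounds after it.
  have h : ∀ t v, (floods f).run N x ω t v = (x v, t, fun i => F i (min T (t - i * T)) v) := by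
    intro t
    induction t with
    | zero => intro v; simp [run, floods, hF, flood]
    | succ t ih =>
      intro v
      have hdm := Nat.div_add_mod' t T
      have hml := Nat.mod_lt t hT
      have hcur : min T (t - t / T * T) = t % T := by rw [min_eq_right (by omega)]; omega
      have hs : ∀ u, (floods f).send ((floods f).run N x ω t u) =
          announce (F (t / T) (t % T) u) (t % T) := fun u => by
        rw [ih u]; simp only [floods, hr, hcur]
      rw [run, ih v]
      simp only [hs]
      simp only [floods, Prod.mk.injEq, true_and, hr]
      funext i
      rcases lt_trichotomy i (t / T) with hi | rfl | hi
      · rw [Function.update_of_ne hi.ne]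
        have : i * T + T ≤ t / T * T := by
          rw [← Nat.succ_mul]; exact Nat.mul_le_mul_right T hi
        rw [min_eq_left (by omega), min_eq_left (by omega)]
      · rw [Function.update_self, hcur]
        have hnext : min T (t + 1 - t / T * T) = t % T + 1 := by
          rw [min_eq_right (by omega)]; omega
        funext l
        rw [hnext, iInf_inbox_elim (fun u => announce (F (t / T) (t % T) u) (t % T)) v
          (fun i m => derived ((f (x v)).rule (t / T) i) m l)]
        rfl
      · rw [Function.update_of_ne hi.ne']
        have : t / T * T + T ≤ i * T := by
          rw [← Nat.succ_mul]; exact Nat.mul_le_mul_right T hi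
        rw [show t - i * T = 0 by omega, show t + 1 - i * T = 0 by omega]
  refine ⟨fun v i => F i (min T (k * T - i * T)) v, ⟨fun v => ?_, fun t ht v => ?_,
    fun t ht v => ?_⟩, fun i hi v => ?_⟩
  · rw [h]; simp [floods, hr, hk]
  · rw [h]; simp [floods, hr, hk, ht]
  · rw [h]
    have hdm := Nat.div_add_mod' t T
    have hml := Nat.mod_lt t hT
    simp only [floods, hr]
    rw [min_eq_right (by omega), show t - t / T * T = t % T by omega]
    exact hB _ (Nat.div_lt_of_lt_mul (by rwa [mul_comm])) _ hml v
  · have : i * T + T ≤ k * T := by rw [← Nat.succ_mul]; exact Nat.mul_le_mul_right T hi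
    simp only
    rw [min_eq_left (by omega)]

end Protocol

/-! ### Hop distances in a connected graph -/

theorem exists_adj_dist_add_one {V : Type u} {G : SimpleGraph V} (hG : G.Connected) {s v : V}
    (h : v ≠ s) : ∃ u, G.Adj v u ∧ G.dist s u + 1 = G.dist s v := by
  obtain ⟨p, hp⟩ := hG.exists_walk_length_eq_dist v s
  cases p with
  | nil => exact absurd rfl h
  | @cons _ u _ ha p =>
    refine ⟨u, ha, le_antisymm ?_ ?_⟩
    · rw [G.dist_comm (u := s) (v := v), ← hp, SimpleGraph.Walk.length_cons, G.dist_comm]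
      exact Nat.add_le_add_right (SimpleGraph.dist_le p) 1
    · have := hG.dist_triangle (u := s) (v := u) (w := v)
      rwa [SimpleGraph.dist_eq_one_iff_adj.2 ha.symm] at this

theorem dist_le_dist_add_one {V : Type u} {G : SimpleGraph V} (hG : G.Connected) {s u v : V}
    (h : G.Adj u v) : G.dist s v ≤ G.dist s u + 1 := by
  have := hG.dist_triangle (u := s) (v := u) (w := v)
  rwa [SimpleGraph.dist_eq_one_iff_adj.2 h] at this

theorem exists_dist_eq {V : Type u} {G : SimpleGraph V} (hG : G.Connected) {s v : V} {k : ℕ}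
    (h : k ≤ G.dist s v) : ∃ x, G.dist s x = k := by
  induction hn : G.dist s v generalizing v with
  | zero => exact ⟨v, by omega⟩
  | succ n ih =>
    rcases h.eq_or_lt with h | h
    · exact ⟨v, h.symm⟩
    · obtain ⟨u, -, hu⟩ := exists_adj_dist_add_one hG (s := s) (v := v)
        (by rintro rfl; simp at hn)
      exact ih (v := u) (by omega) (by omega)

theorem dist_lt_card {V : Type u} [Fintype V] {G : SimpleGraph V} (hG : G.Connected) (s v : V) :
    G.dist s v < Fintype.card V := by
  obtain ⟨p, hp, hl⟩ := hG.exists_path_of_dist s v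
  exact hl ▸ hp.length_lt

theorem pair_lt_sq {a b X : ℕ} (ha : a < X) (hb : b < X) : Nat.pair a b < X ^ 2 :=
  (Nat.pair_lt_max_add_one_sq a b).trans_le (Nat.pow_le_pow_left (by omega) 2)

/-! ### Survey: breadth-first tree, eccentricity of the source and number of nodes -/

/-- The state of a node while the nodes determine the eccentricity of the source and the number
of nodes. `mark` is `0` until the wave started by the source arrives, then `1` at the source and
otherwise two more than the identifier of the parent; `late` is the latest round known to have
left a node unmarked; `count` counts descendants, and `total` is the largest count known. -/
structure SurveyState where
  input : LocalInput
  time : ℕ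
  mark : ℕ
  late : ℕ
  count : ℕ
  total : ℕ

namespace SurveyState

/-- The message of a node. -/
def encode (σ : SurveyState) : ℕ :=
  Nat.pair (Nat.pair σ.mark σ.late) (Nat.pair σ.count σ.total)

/-- The mark in a message. -/
def markOf (m : ℕ) : ℕ := m.unpair.1.unpair.1
/-- The latest round with an unmarked node in a message. -/
def lateOf (m : ℕ) : ℕ := m.unpair.1.unpair.2
/-- The count in a message. -/
def countOf (m : ℕ) : ℕ := m.unpair.2.unpair.1
/-- The largest count in a message. -/
def totalOf (m : ℕ) : ℕ := m.unpair.2.unpair.2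

@[simp] theorem markOf_encode (σ : SurveyState) : markOf σ.encode = σ.mark := by
  simp [markOf, encode]
@[simp] theorem lateOf_encode (σ : SurveyState) : lateOf σ.encode = σ.late := by
  simp [lateOf, encode]
@[simp] theorem countOf_encode (σ : SurveyState) : countOf σ.encode = σ.count := by
  simp [countOf, encode]
@[simp] theorem totalOf_encode (σ : SurveyState) : totalOf σ.encode = σ.total := by
  simp [totalOf, encode]

open Classical in
/-- The new mark. -/
noncomputable def nextMark (σ : SurveyState) (b : ℕ → Option ℕ) : ℕ :=
  if σ.mark ≠ 0 then σ.mark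
  else if ∃ i m, b i = some m ∧ markOf m ≠ 0 then
    sInf {i | ∃ m, b i = some m ∧ markOf m ≠ 0} + 2
  else 0

/-- The new count. -/
noncomputable def nextCount (σ : SurveyState) (b : ℕ → Option ℕ) : ℕ :=
  1 + ∑ᶠ i, (b i).elim 0 fun m => if markOf m = σ.input.ident + 2 then countOf m else 0

end SurveyState

open SurveyState Classical in
/-- All nodes simultaneously learn the eccentricity of the source and the number of nodes. -/
noncomputable def survey : Protocol LocalInput (LocalInput × ℕ × ℕ) where
  State := SurveyState
  init x := ⟨x, 0, if x.isSource then 1 else 0, 0, 1, 1⟩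
  send := encode
  step σ b _ :=
    ⟨σ.input, σ.time + 1, σ.nextMark b,
      if σ.nextMark b = 0 then σ.time + 1 else max σ.late (inboxSup b lateOf),
      σ.nextCount b, max (max σ.total (σ.nextCount b)) (inboxSup b totalOf)⟩
  output σ := if 4 * σ.late + 8 ≤ σ.time then some (σ.input, σ.time / 4 - 1, σ.total) else none

namespace Survey

open SurveyState

variable {V : Type u} {N : Network V} (I : SSSPInstance N) (ω : ℕ → V → Bool)

/-- The states of the survey. -/
noncomputable def st (t : ℕ) (v : V) : SurveyState := survey.run N (localInput I) ω t v

/-- The hop distance from the source. -/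
noncomputable def lv (v : V) : ℕ := N.links.dist I.source v

theorem st_succ (t : ℕ) (v : V) : st I ω (t + 1) v =
    survey.step (st I ω t v) (inbox N (fun u => (st I ω t u).encode) v) (ω t v) := rfl

theorem lv_eq_zero {v : V} : lv I v = 0 ↔ v = I.source := by
  rw [lv, N.connected.dist_eq_zero_iff, eq_comm]

theorem input_st (t : ℕ) (v : V) : (st I ω t v).input = localInput I v := by
  induction t with
  | zero => rfl
  | succ t ih => rw [st_succ]; exact ih

theorem time_st (t : ℕ) (v : V) : (st I ω t v).time = t := by
  induction t with
  | zero => rfl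
  | succ t ih => rw [st_succ]; exact congrArg (· + 1) ih

theorem mark_succ_of_ne {t : ℕ} {v : V} (h : (st I ω t v).mark ≠ 0) :
    (st I ω (t + 1) v).mark = (st I ω t v).mark := by
  rw [st_succ]; exact if_pos h

theorem mark_of_le {t t' : ℕ} {v : V} (h : (st I ω t v).mark ≠ 0) (ht : t ≤ t') :
    (st I ω t' v).mark = (st I ω t v).mark := by
  induction t', ht using Nat.le_induction with
  | base => rfl
  | succ t' _ ih => rw [mark_succ_of_ne I ω (by rwa [ih]), ih]

theorem mark_succ_of_eq {t : ℕ} {v : V} (h : (st I ω t v).mark = 0) :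
    (st I ω (t + 1) v).mark = 0 ∧ (∀ u, N.links.Adj v u → (st I ω t u).mark = 0) ∨
      ∃ u, N.links.Adj v u ∧ (st I ω t u).mark ≠ 0 ∧
        (st I ω (t + 1) v).mark = N.ident u + 2 := by
  set b := inbox N (fun u => (st I ω t u).encode) v with hb
  have hm : (st I ω (t + 1) v).mark = (st I ω t v).nextMark b := by rw [st_succ]; rfl
  rw [hm, nextMark, if_neg (not_not.2 h)]
  by_cases hex : ∃ i m, b i = some m ∧ markOf m ≠ 0
  · rw [if_pos hex]
    obtain ⟨m, hm, hne⟩ : sInf {i | ∃ m, b i = some m ∧ markOf m ≠ 0} ∈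
        {i | ∃ m, b i = some m ∧ markOf m ≠ 0} := Nat.sInf_mem hex
    obtain ⟨u, hu, hi, rfl⟩ := (inbox_eq_some_iff _).1 hm
    exact .inr ⟨u, hu, by simpa using hne, by rw [hi]⟩
  · rw [if_neg hex]
    refine .inl ⟨rfl, fun u hu => ?_⟩
    by_contra hne
    exact hex ⟨N.ident u, _, inbox_ident_of_adj _ hu, by simpa using hne⟩

theorem mark_ne_zero_iff (t : ℕ) (v : V) : (st I ω t v).mark ≠ 0 ↔ lv I v ≤ t := by
  induction t generalizing v with
  | zero =>
    rw [Nat.le_zero, lv_eq_zero]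
    simp [st, Protocol.run, survey, localInput]
  | succ t ih =>
    by_cases h : (st I ω t v).mark = 0
    · have hlt : ¬ lv I v ≤ t := by rw [← ih]; simpa using h
      rcases mark_succ_of_eq I ω h with ⟨h0, hu⟩ | ⟨u, hu, hne, hm⟩
      · refine ⟨fun hc => absurd h0 hc, fun hle => ?_⟩
        have hvs : v ≠ I.source := fun hv => hlt (by rw [(lv_eq_zero I).2 hv]; exact Nat.zero_le _)
        obtain ⟨u, hu', hd⟩ := exists_adj_dist_add_one N.connected hvs
        exact absurd (hu u hu') ((ih u).2 (by unfold lv at *; omega))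
      · rw [hm]
        have := (ih u).1 hne
        have := dist_le_dist_add_one N.connected (s := I.source) hu.symm
        unfold lv at *
        exact ⟨fun _ => by omega, fun _ => by omega⟩
    · rw [mark_succ_of_ne I ω h]
      have := (ih v).1 h
      exact ⟨fun _ => by omega, fun _ => h⟩

theorem mark_source (t : ℕ) : (st I ω t I.source).mark = 1 := by
  have h0 : (st I ω 0 I.source).mark = 1 := if_pos rfl
  rw [← h0]
  exact mark_of_le I ω (by rw [h0]; simp) (Nat.zero_le t)

/-- The wave reaches `v` exactly in round `lv I v`, so the neighbour it came from was marked one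
round earlier and lies one level higher. Marks never change afterwards. -/
theorem exists_parent {v : V} (hv : v ≠ I.source) : ∃ u, N.links.Adj v u ∧
    lv I u + 1 = lv I v ∧ ∀ t, lv I v ≤ t → (st I ω t v).mark = N.ident u + 2 := by
  obtain ⟨k, hk⟩ : ∃ k, lv I v = k + 1 := Nat.exists_eq_succ_of_ne_zero
    fun h => hv ((lv_eq_zero I).1 h)
  have h0 : (st I ω k v).mark = 0 := by
    by_contra h; have := (mark_ne_zero_iff I ω k v).1 h; omega
  have h1 : (st I ω (k + 1) v).mark ≠ 0 := (mark_ne_zero_iff I ω _ v).2 hk.le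
  rcases mark_succ_of_eq I ω h0 with ⟨h, -⟩ | ⟨u, hu, hne, hm⟩
  · exact absurd h h1
  · refine ⟨u, hu, ?_, fun t ht => by rw [mark_of_le I ω h1 (hk ▸ ht), hm]⟩
    have := (mark_ne_zero_iff I ω k u).1 hne
    have := dist_le_dist_add_one N.connected (s := I.source) hu.symm
    unfold lv at *
    omega

theorem total_succ (t : ℕ) (v : V) : (st I ω (t + 1) v).total =
    max (max (st I ω t v).total (st I ω (t + 1) v).count)
      (inboxSup (inbox N (fun u => (st I ω t u).encode) v) totalOf) := rfl

theorem one_le_count (t : ℕ) (v : V) : 1 ≤ (st I ω t v).count := by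
  cases t with
  | zero => exact le_rfl
  | succ t => rw [st_succ]; exact Nat.le_add_right _ _

theorem late_succ_of_mark_eq {t : ℕ} {v : V} (h : (st I ω (t + 1) v).mark = 0) :
    (st I ω (t + 1) v).late = t + 1 := by
  rw [st_succ] at h ⊢
  exact (if_pos h).trans (congrArg (· + 1) (time_st I ω t v))

theorem late_succ_of_mark_ne {t : ℕ} {v : V} (h : (st I ω (t + 1) v).mark ≠ 0) :
    (st I ω (t + 1) v).late = max (st I ω t v).late
      (inboxSup (inbox N (fun u => (st I ω t u).encode) v) lateOf) := by
  rw [st_succ] at h ⊢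
  exact if_neg h

theorem late_le_time (t : ℕ) (v : V) : (st I ω t v).late ≤ t := by
  induction t generalizing v with
  | zero => exact Nat.zero_le _
  | succ t ih =>
    by_cases h : (st I ω (t + 1) v).mark = 0
    · rw [late_succ_of_mark_eq I ω h]
    · rw [late_succ_of_mark_ne I ω h]
      exact max_le ((ih v).trans (Nat.le_succ t))
        (inboxSup_inbox_le fun u _ => by rw [lateOf_encode]; exact (ih u).trans (Nat.le_succ t))

theorem late_mono (v : V) : Monotone fun t => (st I ω t v).late := by
  refine monotone_nat_of_le_succ fun t => ?_
  by_cases h : (st I ω (t + 1) v).mark = 0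
  · rw [late_succ_of_mark_eq I ω h]
    exact (late_le_time I ω t v).trans (Nat.le_succ t)
  · rw [late_succ_of_mark_ne I ω h]
    exact le_max_left _ _

variable [Fintype V]

/-- The eccentricity of the source. -/
noncomputable def ecc : ℕ := Finset.univ.sup (lv I)

theorem lv_le_ecc (v : V) : lv I v ≤ ecc I := Finset.le_sup (Finset.mem_univ v)

-- Each non-source node has a unique parent, on the level above, and is counted there as soon as it
-- is marked. Summing over a level exchanges the sum over parents for a sum over children, so
-- individual subtree sizes are never needed.
open Classical in
theorem sum_count_succ (t l : ℕ) :
    ∑ v with lv I v = l, (st I ω (t + 1) v).count =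
      (Finset.univ.filter fun v => lv I v = l).card +
        ∑ u with lv I u = l + 1 ∧ lv I u ≤ t, (st I ω t u).count := by
  have hcount : ∀ v, (st I ω (t + 1) v).count = 1 + ∑ u,
      if (st I ω t u).mark = N.ident v + 2 ∧ N.links.Adj v u then (st I ω t u).count else 0 := by
    intro v
    rw [st_succ]
    show SurveyState.nextCount _ _ = _
    rw [SurveyState.nextCount, input_st, finsum_inbox_elim, Finset.sum_filter]
    congr 1
    refine Finset.sum_congr rfl fun u _ => ?_
    by_cases ha : N.links.Adj v u <;> simp [ha, localInput]
  simp only [hcount, Finset.sum_add_distrib, Finset.sum_const, smul_eq_mul, mul_one]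
  congr 1
  rw [Finset.sum_comm, Finset.sum_filter]
  refine Finset.sum_congr rfl fun u _ => ?_
  by_cases hus : u = I.source
  · subst hus
    rw [if_neg, Finset.sum_eq_zero]
    · intro v _
      rw [mark_source, if_neg]
      omega
    · rw [(lv_eq_zero I).2 rfl]; omega
  by_cases hut : lv I u ≤ t
  · obtain ⟨w, hw, hlw, hm⟩ := exists_parent I ω hus
    rw [hm t hut]
    have : ∀ v, (N.ident w + 2 = N.ident v + 2 ∧ N.links.Adj v u) ↔ v = w := by
      intro v
      constructor
      · rintro ⟨h, -⟩; exact N.ident_injective (by omega)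
      · rintro rfl; exact ⟨rfl, hw.symm⟩
    simp only [this, Finset.sum_ite_eq', Finset.mem_filter, Finset.mem_univ, true_and]
    refine if_congr ?_ rfl rfl
    omega
  · have h0 : (st I ω t u).mark = 0 := by
      by_contra h; exact hut ((mark_ne_zero_iff I ω t u).1 h)
    rw [if_neg (fun h => hut h.2), Finset.sum_eq_zero]
    intro v _
    rw [h0, if_neg]
    omega

open Classical in
theorem card_lv_split (l : ℕ) : (Finset.univ.filter fun v => l ≤ lv I v).card =
    (Finset.univ.filter fun v => lv I v = l).card +
      (Finset.univ.filter fun v => l + 1 ≤ lv I v).card := by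
  rw [← Finset.card_union_of_disjoint]
  · congr 1; ext v; simp only [Finset.mem_filter, Finset.mem_union, Finset.mem_univ, true_and]
    omega
  · rw [Finset.disjoint_filter]; intro v _ h; omega

open Classical in
theorem sum_count_le (t l : ℕ) : ∑ v with lv I v = l, (st I ω t v).count ≤
    (Finset.univ.filter fun v => l ≤ lv I v).card := by
  induction t generalizing l with
  | zero =>
    have : ∀ v, (st I ω 0 v).count = 1 := fun _ => rfl
    simp only [this, Finset.sum_const, smul_eq_mul, mul_one]
    rw [card_lv_split]
    exact Nat.le_add_right _ _
  | succ t ih =>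
    rw [sum_count_succ, card_lv_split]
    refine Nat.add_le_add_left (le_trans ?_ (ih (l + 1))) _
    exact Finset.sum_le_sum_of_subset fun v => by
      simp only [Finset.mem_filter, Finset.mem_univ, true_and]; exact fun h => h.1

-- Each level settles one round after the next deeper one, starting from round `ecc I` at the
-- deepest level. The condition also ensures that every child being counted is already marked.
open Classical in
theorem le_sum_count {t l : ℕ} (h : 2 * ecc I ≤ t + l) (hl : l ≤ ecc I) :
    (Finset.univ.filter fun v => l ≤ lv I v).card ≤
      ∑ v with lv I v = l, (st I ω t v).count := by
  obtain ⟨k, hk⟩ := Nat.exists_eq_add_of_le hl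
  induction k generalizing t l with
  | zero =>
    rw [Finset.card_eq_sum_ones]
    refine (Finset.sum_le_sum fun v _ => one_le_count I ω t v).trans
      (Finset.sum_le_sum_of_subset fun v => ?_)
    simp only [Finset.mem_filter, Finset.mem_univ, true_and]
    have := lv_le_ecc I v
    omega
  | succ k ih =>
    obtain ⟨t, rfl⟩ : ∃ t', t = t' + 1 := ⟨t - 1, by omega⟩
    rw [sum_count_succ, card_lv_split]
    refine Nat.add_le_add_left ((ih (t := t) (l := l + 1) (by omega) (by omega)
      (by omega)).trans (le_of_eq ?_)) _
    congr 1
    ext v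
    simp only [Finset.mem_filter, Finset.mem_univ, true_and]
    omega

theorem count_le_card (t : ℕ) (v : V) : (st I ω t v).count ≤ Fintype.card V := by
  classical
  refine le_trans ?_ ((sum_count_le I ω t (lv I v)).trans (Finset.card_le_univ _))
  exact Finset.single_le_sum (f := fun v => (st I ω t v).count) (fun _ _ => Nat.zero_le _)
    (by simp)

theorem card_le_count {t : ℕ} (h : 2 * ecc I ≤ t) :
    Fintype.card V ≤ (st I ω t I.source).count := by
  classical
  have := le_sum_count I ω (t := t) (l := 0) h (Nat.zero_le _)
  simpa [lv_eq_zero, Finset.sum_filter] using this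

theorem total_le_card (t : ℕ) (v : V) : (st I ω t v).total ≤ Fintype.card V := by
  induction t generalizing v with
  | zero => exact Fintype.card_pos_iff.2 ⟨v⟩
  | succ t ih =>
    rw [total_succ]
    exact max_le (max_le (ih v) (count_le_card I ω _ v))
      (inboxSup_inbox_le fun u _ => by rw [totalOf_encode]; exact ih u)

/-- The root knows the full count after `2 * ecc I` rounds, and the maximum then descends one level
per round. -/
theorem card_le_total {t : ℕ} {v : V} (h : 2 * ecc I + lv I v ≤ t) (ht : 0 < t) :
    Fintype.card V ≤ (st I ω t v).total := by
  obtain ⟨t, rfl⟩ : ∃ t', t = t' + 1 := ⟨t - 1, by omega⟩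
  rw [total_succ]
  by_cases hv : v = I.source
  · subst hv
    exact (card_le_count I ω (by omega)).trans ((le_max_right _ _).trans (le_max_left _ _))
  · obtain ⟨k, hk⟩ : ∃ k, lv I v = k := ⟨_, rfl⟩
    induction k generalizing t v with
    | zero => exact absurd ((lv_eq_zero I).1 hk) hv
    | succ k ih =>
      obtain ⟨u, hu, hd⟩ := exists_adj_dist_add_one N.connected hv
      refine le_trans ?_ (le_max_right _ _)
      refine le_trans ?_ (le_inboxSup_inbox totalOf hu)
      rw [totalOf_encode]
      change lv I u + 1 = lv I v at hd
      obtain ⟨t, rfl⟩ : ∃ t', t = t' + 1 := ⟨t - 1, by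
        have := lv_le_ecc I v; omega⟩
      rw [total_succ]
      by_cases hus : u = I.source
      · subst hus
        exact (card_le_count I ω (by omega)).trans ((le_max_right _ _).trans (le_max_left _ _))
      · exact ih t (by omega) (by omega) hus (by omega)

theorem late_le (t : ℕ) (v : V) : (st I ω t v).late ≤ ecc I - 1 := by
  induction t generalizing v with
  | zero => exact Nat.zero_le _
  | succ t ih =>
    by_cases h : (st I ω (t + 1) v).mark = 0
    · rw [late_succ_of_mark_eq I ω h]
      have h' : ¬ lv I v ≤ t + 1 := by rw [← mark_ne_zero_iff I ω]; simpa using h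
      have := lv_le_ecc I v
      omega
    · rw [late_succ_of_mark_ne I ω h]
      exact max_le (ih v) (inboxSup_inbox_le fun u _ => by rw [lateOf_encode]; exact ih u)

/-- A node still unmarked in round `k` records `k`, and the record spreads by one hop per round. A
node not yet reached by the wave needs no news: its own record is the current round. -/
theorem le_late {k t : ℕ} {x v : V} (hk : k < lv I x) (h : k + N.links.dist v x ≤ t) :
    k ≤ (st I ω t v).late := by
  obtain ⟨d, hd⟩ : ∃ d, N.links.dist v x = d := ⟨_, rfl⟩
  induction d generalizing v t with
  | zero =>
    obtain rfl := N.connected.dist_eq_zero_iff.1 hd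
    cases k with
    | zero => exact Nat.zero_le _
    | succ k =>
      have h0 : (st I ω (k + 1) v).mark = 0 := by
        by_contra hc; have := (mark_ne_zero_iff I ω _ v).1 hc; omega
      exact (late_succ_of_mark_eq I ω h0).ge.trans (late_mono I ω v (by omega))
  | succ d ih =>
    obtain ⟨t, rfl⟩ : ∃ t', t = t' + 1 := ⟨t - 1, by omega⟩
    have hvx : v ≠ x := by rintro rfl; simp at hd
    obtain ⟨u, hu, hud⟩ := exists_adj_dist_add_one N.connected hvx
    rw [N.links.dist_comm, N.links.dist_comm (u := x) (v := v)] at hud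
    by_cases h0 : (st I ω (t + 1) v).mark = 0
    · rw [late_succ_of_mark_eq I ω h0]; omega
    · rw [late_succ_of_mark_ne I ω h0]
      refine le_trans ?_ (le_max_right _ _)
      refine le_trans ?_ (le_inboxSup_inbox lateOf hu)
      rw [lateOf_encode]
      exact ih (by omega) (by omega)

/-- No node stops too early. While `t / 4 ≤ ecc I`, some node of level `t / 4` was unmarked in round
`t / 4 - 1`. Either `v` itself was unmarked then, or the news comes through the source over fewer
than `2 * (t / 4)` links, hence in time. -/
theorem lt_of_lt_ecc {t : ℕ} (ht : t < 4 * ecc I + 4) (v : V) :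
    t < 4 * (st I ω t v).late + 8 := by
  rcases lt_or_ge t 8 with h8 | h8
  · omega
  suffices h : t / 4 - 1 ≤ (st I ω t v).late by omega
  by_cases hv : t / 4 - 1 < lv I v
  · exact le_late I ω hv (by simp; omega)
  · obtain ⟨w, -, hw⟩ := Finset.exists_mem_eq_sup Finset.univ ⟨v, Finset.mem_univ v⟩ (lv I)
    obtain ⟨x, hx⟩ := exists_dist_eq N.connected (s := I.source) (v := w) (k := t / 4)
      (show t / 4 ≤ lv I w by rw [← hw]; show t / 4 ≤ ecc I; omega)
    refine le_late I ω (x := x) (by unfold lv; omega) ?_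
    have := N.connected.dist_triangle (u := v) (v := I.source) (w := x)
    rw [N.links.dist_comm (u := v) (v := I.source)] at this
    unfold lv at hv
    omega

theorem encode_lt {X : ℕ} (hid : ∀ v, N.ident v + 2 < X) (hX : Fintype.card V < X) (t : ℕ)
    (v : V) : (st I ω t v).encode < X ^ 4 := by
  have hm : (st I ω t v).mark < X := by
    by_cases hv : v = I.source
    · subst hv; rw [mark_source]; have := hid I.source; omega
    by_cases h : lv I v ≤ t
    · obtain ⟨u, -, -, hu⟩ := exists_parent I ω hv
      rw [hu t h]; exact hid u
    · have : (st I ω t v).mark = 0 := by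
        by_contra hc; exact h ((mark_ne_zero_iff I ω t v).1 hc)
      omega
  have hecc : ecc I ≤ Fintype.card V := Finset.sup_le fun v _ =>
    (dist_lt_card N.connected _ _).le
  rw [show X ^ 4 = (X ^ 2) ^ 2 by ring]
  exact pair_lt_sq (pair_lt_sq hm ((late_le I ω t v).trans_lt (by omega)))
    (pair_lt_sq ((count_le_card I ω t v).trans_lt hX) ((total_le_card I ω t v).trans_lt hX))

end Survey

/-- Each node tests only its own `late`, yet all stop together. Since `late` never exceeds `ecc I -
1`, the test succeeds in round 4(ecc − 1) + 8 = 4 ecc + 4, and `lt_of_lt_ecc` excludes earlier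
rounds. The eccentricity is read off the clock. A value of at least 1 is needed because the
subtraction truncates. -/
theorem survey_computes {V : Type u} [Fintype V] {N : Network V} (I : SSSPInstance N)
    (ω : ℕ → V → Bool) {B X : ℕ} (he : 1 ≤ Survey.ecc I) (hid : ∀ v, N.ident v + 2 < X)
    (hX : Fintype.card V < X) (hB : ∀ m < X ^ 4, m.size ≤ B) :
    survey.Computes N (localInput I) ω B (4 * Survey.ecc I + 4)
      fun v => (localInput I v, Survey.ecc I, Fintype.card V) := by
  refine ⟨fun v => ?_, fun t ht v => ?_, fun t _ v => hB _ (Survey.encode_lt I ω hid hX t v)⟩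
  · have h₁ := Survey.late_le I ω (4 * Survey.ecc I + 4) v
    have h₂ := Survey.total_le_card I ω (4 * Survey.ecc I + 4) v
    have h₃ := Survey.card_le_total I ω (t := 4 * Survey.ecc I + 4) (v := v)
      (by have := Survey.lv_le_ecc I v; omega) (by omega)
    show (if 4 * (Survey.st I ω (4 * Survey.ecc I + 4) v).late + 8 ≤
      (Survey.st I ω (4 * Survey.ecc I + 4) v).time then _ else _) = _
    rw [Survey.time_st, if_pos (by omega)]
    show some ((Survey.st I ω (4 * Survey.ecc I + 4) v).input,
      (Survey.st I ω (4 * Survey.ecc I + 4) v).time / 4 - 1,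
      (Survey.st I ω (4 * Survey.ecc I + 4) v).total) = _
    rw [Survey.time_st, Survey.input_st, le_antisymm h₂ h₃,
      show (4 * Survey.ecc I + 4) / 4 - 1 = Survey.ecc I by omega]
  · have := Survey.lt_of_lt_ecc I ω ht v
    show (if 4 * (Survey.st I ω t v).late + 8 ≤ (Survey.st I ω t v).time then _ else _) = _
    rw [Survey.time_st, if_neg (by omega)]

/-! ### Rounding weights in geometric scales -/

section Scaling

variable {X : Type*}

/-- `HopWalk w k u v d`: there is a walk of `k` edges and total weight `d` from `u` to `v`; a pair
of weight `⊤` is not an edge. -/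
inductive HopWalk (w : X → X → ℕ∞) : ℕ → X → X → ℕ → Prop
  | nil (u : X) : HopWalk w 0 u u 0
  | snoc {k d a : ℕ} {u x v : X} (p : HopWalk w k u x d) (h : w x v = a) :
      HopWalk w (k + 1) u v (d + a)

theorem HopWalk.trans {w : X → X → ℕ∞} {k k' d d' : ℕ} {u x v : X} (p : HopWalk w k u x d)
    (p' : HopWalk w k' x v d') : HopWalk w (k + k') u v (d + d') := by
  induction p' with
  | nil => exact p
  | snoc _ h ih => rw [← Nat.add_assoc, ← Nat.add_assoc]; exact (ih p).snoc h

/-- The length of an edge of weight `x` in the scale `σ`. Scale `0` has only edges of weight `0`;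
scale `i + 1` measures weights in units of `2 ^ i / M`. -/
noncomputable def scaledLength (M : ℕ) : ℕ → ℕ∞ → ℕ∞
  | 0, x => if x = 0 then 1 else ⊤
  | i + 1, x => if x = ⊤ then ⊤ else (x.toNat * M / 2 ^ i + 1 : ℕ)

/-- The weight that corresponds to the length `L` in the scale `σ`. -/
def unscaled (M : ℕ) : ℕ → ℕ → ℕ
  | 0, _ => 0
  | i + 1, L => L * 2 ^ i / M

theorem unscaled_mono (M σ : ℕ) : Monotone (unscaled M σ) := by
  cases σ with
  | zero => exact fun _ _ _ => le_rfl
  | succ i => exact fun _ _ h => Nat.div_le_div_right (Nat.mul_le_mul_right _ h)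

theorem one_le_scaledLength (M σ : ℕ) (x : ℕ∞) : 1 ≤ scaledLength M σ x := by
  cases σ <;> simp only [scaledLength] <;> split_ifs <;> simp

theorem scaledLength_ne_top {M σ : ℕ} {x : ℕ∞} (h : scaledLength M σ x ≠ ⊤) : x ≠ ⊤ := by
  rintro rfl
  cases σ <;> simp [scaledLength] at h

/-- Lengths are rounded up, so converting back never underestimates the weight, in any scale. -/
theorem HopWalk.of_scaled {w : X → X → ℕ∞} {M σ k L : ℕ} {u v : X} (hM : 0 < M)
    (p : HopWalk (fun x y => scaledLength M σ (w x y)) k u v L) :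
    ∃ d, HopWalk w k u v d ∧ d ≤ unscaled M σ L := by
  cases σ with
  | zero =>
    refine ⟨0, ?_, le_rfl⟩
    induction p with
    | nil => exact .nil _
    | @snoc _ _ _ _ x v _ h ih =>
      refine ih.snoc (a := 0) ?_
      simp only [scaledLength] at h
      split_ifs at h with h0
      · exact h0
      · simp at h
  | succ i =>
    suffices h : ∃ d, HopWalk w k u v d ∧ d * M ≤ L * 2 ^ i by
      obtain ⟨d, hd, hle⟩ := h
      exact ⟨d, hd, (Nat.le_div_iff_mul_le hM).2 hle⟩
    induction p with
    | nil => exact ⟨0, .nil _, by simp⟩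
    | @snoc _ _ a _ x v _ h ih =>
      obtain ⟨d, hd, hle⟩ := ih
      simp only [scaledLength] at h
      split_ifs at h with h0
      · simp at h
      · refine ⟨d + (w x v).toNat, hd.snoc (ENat.natCast_toNat h0).symm, ?_⟩
        have ha : (w x v).toNat * M / 2 ^ i + 1 = a := by exact_mod_cast h
        have := Nat.lt_mul_div_succ ((w x v).toNat * M) (show 0 < 2 ^ i by positivity)
        rw [ha, mul_comm (2 ^ i)] at this
        rw [add_mul, add_mul]
        exact Nat.add_le_add hle this.le

/-- In the scale with 2^i ≤ d < 2^(i+1) the unit is 2^i/(qh). Each edge is overestimated by at most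
one unit, so h edges cost at most 2^i/q ≤ d/q, and the length is at most 2qh + h. Weight 0 has no
such scale, which is why scale `0` exists. -/
theorem HopWalk.scaled {w : X → X → ℕ∞} {q h k d J : ℕ} {u v : X} (hq : 0 < q) (hh : 0 < h)
    (p : HopWalk w k u v d) (hk : k ≤ h) (hd : d < 2 ^ J) :
    ∃ σ ≤ J, ∃ L ≤ (2 * q + 1) * h,
      HopWalk (fun x y => scaledLength (q * h) σ (w x y)) k u v L ∧
        q * unscaled (q * h) σ L ≤ (q + 1) * d := by
  rcases Nat.eq_zero_or_pos d with rfl | hd0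
  · refine ⟨0, Nat.zero_le _, k, hk.trans (Nat.le_mul_of_pos_left h (by omega : 0 < 2 * q + 1)), ?_, by
      simp [unscaled]⟩
    clear hk hd
    generalize hd : 0 = d at p
    induction p with
    | nil => exact .nil _
    | @snoc _ d a _ _ _ _ h ih =>
      obtain ⟨rfl, rfl⟩ : d = 0 ∧ a = 0 := by omega
      exact (ih rfl).snoc (by simp [scaledLength, h])
  · set i := Nat.log 2 d with hi
    have hlow : 2 ^ i ≤ d := Nat.pow_log_le_self 2 hd0.ne'
    have hhigh : d < 2 ^ (i + 1) := Nat.lt_pow_succ_log_self (by norm_num) d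
    have hiJ : i + 1 ≤ J := (Nat.pow_lt_pow_iff_right (by norm_num : 1 < 2)).1
      (hlow.trans_lt hd)
    obtain ⟨L, hL, hle⟩ : ∃ L, HopWalk (fun x y => scaledLength (q * h) (i + 1) (w x y)) k u v L ∧
        L * 2 ^ i ≤ d * (q * h) + k * 2 ^ i := by
      clear hk hd hd0 hlow hhigh hiJ hi
      clear_value i
      induction p with
      | nil => exact ⟨0, .nil _, by simp⟩
      | @snoc _ _ a _ x v _ hw ih =>
        obtain ⟨L, hL, hle⟩ := ih
        refine ⟨_, hL.snoc (a := a * (q * h) / 2 ^ i + 1) (by simp [scaledLength, hw]), ?_⟩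
        have := Nat.div_mul_le_self (a * (q * h)) (2 ^ i)
        linarith
    refine ⟨i + 1, hiJ, L, ?_, hL, ?_⟩
    · have h1 : L * 2 ^ i ≤ (2 * q + 1) * h * 2 ^ i := by
        have h2 : d * (q * h) ≤ 2 ^ (i + 1) * (q * h) := Nat.mul_le_mul_right _ hhigh.le
        have h3 : k * 2 ^ i ≤ h * 2 ^ i := Nat.mul_le_mul_right _ hk
        rw [pow_succ] at h2
        linarith
      exact Nat.le_of_mul_le_mul_right h1 (by positivity)
    · have h1 : L * 2 ^ i / (q * h) * (q * h) ≤ L * 2 ^ i := Nat.div_mul_le_self _ _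
      have h2 : k * 2 ^ i ≤ h * d := Nat.mul_le_mul hk hlow
      have h3 : (q * unscaled (q * h) (i + 1) L) * h ≤ ((q + 1) * d) * h := by
        simp only [unscaled]; linarith
      exact Nat.le_of_mul_le_mul_right h3 hh

/-- The distance estimate that results from the keys `K σ l` in the scales `σ ≤ J`, when keys are
`A` times as large as lengths. -/
noncomputable def estimate (M J A : ℕ) (K : ℕ → ℕ → ℕ∞) (l : ℕ) : ℕ∞ :=
  ⨅ σ, ⨅ _ : σ ≤ J, if K σ l = ⊤ then ⊤ else (unscaled M σ ((K σ l).toNat / A) : ℕ)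

theorem estimate_eq_coe {M J A : ℕ} {K : ℕ → ℕ → ℕ∞} {l x : ℕ} (h : estimate M J A K l = x) :
    ∃ σ ≤ J, ∃ κ : ℕ, K σ l = κ ∧ unscaled M σ (κ / A) = x := by
  obtain ⟨σ, hσ⟩ := exists_lt_top_of_iInf_lt_top (h.trans_ne (ENat.natCast_ne_top x))
  obtain ⟨hJ, hσ'⟩ := exists_lt_top_of_iInf_lt_top
    ((hσ.trans h).trans_ne (ENat.natCast_ne_top x))
  rw [hσ, ← estimate, h] at hσ'
  split_ifs at hσ' with h0
  · simp at hσ'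
  · exact ⟨σ, hJ, _, (ENat.natCast_toNat h0).symm, by exact_mod_cast hσ'⟩

theorem estimate_le {M J A : ℕ} {K : ℕ → ℕ → ℕ∞} {l σ L κ : ℕ} (hσ : σ ≤ J) (hK : K σ l ≤ κ)
    (hκ : κ / A ≤ L) : ∃ x : ℕ, estimate M J A K l = x ∧ x ≤ unscaled M σ L := by
  have hne : K σ l ≠ ⊤ := (hK.trans_lt (ENat.natCast_lt_top κ)).ne
  have hle : estimate M J A K l ≤ (unscaled M σ L : ℕ) := by
    refine (iInf₂_le σ hσ).trans ?_
    rw [if_neg hne]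
    have : (K σ l).toNat ≤ κ := ENat.toNat_le_of_le_natCast hK
    exact_mod_cast unscaled_mono M σ ((Nat.div_le_div_right this).trans hκ)
  obtain ⟨x, hx⟩ := ENat.ne_top_iff_exists.1 (hle.trans_lt (ENat.natCast_lt_top _)).ne
  exact ⟨x, hx.symm, by rw [← hx] at hle; exact_mod_cast hle⟩

end Scaling

/-! ### Flooding from the sampled nodes through the network -/

section Sources

/-- Keep the label and add `ℓ` to the key. -/
noncomputable def keepRule (ℓ : ℕ∞) (κ l l' : ℕ) : ℕ∞ := if l = l' then κ + ℓ else ⊤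

variable {V : Type u} {G : SimpleGraph V}

theorem regular_keepRule {ℓ : V → V → ℕ∞} (hℓ : ∀ u v, 1 ≤ ℓ u v) :
    Regular fun v u => keepRule (ℓ u v) where
  mono v u κ κ' l l' h := by
    unfold keepRule; split_ifs
    · gcongr
    · exact le_rfl
  lt v u κ l l' := by
    unfold keepRule; split_ifs
    · exact (ENat.lt_add_one_iff (ENat.natCast_ne_top κ)).2 le_rfl |>.trans_le
        (by gcongr; exact hℓ u v)
    · exact ENat.natCast_lt_top κ
  relay v u κ l l' κ' k m h hkm := by
    unfold keepRule at h ⊢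
    split_ifs at h with hl
    · subst hl
      cases hw : ℓ u v with
      | top => rw [hw] at h; simp at h
      | coe a =>
        rw [hw] at h
        have h : κ + a = κ' := by exact_mod_cast h
        rw [if_pos rfl]
        norm_cast
        omega
    · simp at h

variable {w : V → V → ℕ∞} {S : Finset V} {tag : V → ℕ} {M : ℕ}

open Classical in
/-- Initial keys: every member of `S` is at distance `0` from itself. -/
noncomputable def sourceKeys (S : Finset V) (tag : V → ℕ) (v : V) (l : ℕ) : ℕ∞ :=
  if v ∈ S ∧ l = tag v then 0 else ⊤

theorem derivable_sources_iff {ℓ : V → V → ℕ∞} (hadj : ∀ u v, ℓ u v ≠ ⊤ → G.Adj u v)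
    {v : V} {l κ : ℕ} :
    Derivable G (sourceKeys S tag) (fun v u => keepRule (ℓ u v)) v l κ ↔
      ∃ x ∈ S, tag x = l ∧ ∃ k, HopWalk ℓ k x v κ := by
  constructor
  · intro h
    induction h with
    | @base v l κ h =>
      unfold sourceKeys at h
      split_ifs at h with hv
      · obtain rfl : 0 = κ := by exact_mod_cast h
        exact ⟨v, hv.1, hv.2.symm, 0, .nil v⟩
      · simp at h
    | @step v u l l' κ κ' ha _ hR ih =>
      unfold keepRule at hR
      split_ifs at hR with hl
      · obtain ⟨x, hx, hxl, k, hk⟩ := ih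
        cases hw : ℓ u v with
        | top => rw [hw] at hR; simp at hR
        | coe a =>
          rw [hw] at hR
          obtain rfl : κ + a = κ' := by exact_mod_cast hR
          exact ⟨x, hx, hxl.trans hl, k + 1, hk.snoc hw⟩
      · simp at hR
  · rintro ⟨x, hx, rfl, k, hk⟩
    induction hk with
    | nil u => exact .base (by simp [sourceKeys, hx])
    | @snoc _ d a u y v _ h ih =>
      exact .step (hadj y v (by simp [h])).symm (ih hx) (by simp [keepRule, h])

/-- Flooding in all scales from all members of `S` yields upper bounds on distances from `S`. -/
theorem sources_sound (hadj : ∀ u v, w u v ≠ ⊤ → G.Adj u v) (hM : 0 < M) {J T : ℕ}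
    {K : ℕ → ℕ → ℕ∞} {v : V} (hK : ∀ σ ≤ J, K σ = flood G (sourceKeys S tag)
      (fun v u => keepRule (scaledLength M σ (w u v))) T v) {l x : ℕ}
    (h : estimate M J 1 K l = x) :
    ∃ y ∈ S, tag y = l ∧ ∃ k d, HopWalk w k y v d ∧ d ≤ x := by
  obtain ⟨σ, hσ, κ, hκ, rfl⟩ := estimate_eq_coe h
  rw [hK σ hσ] at hκ
  obtain ⟨y, hy, hyl, k, hk⟩ := (derivable_sources_iff
    (fun u v h => hadj u v (scaledLength_ne_top h))).1 (flood_derivable hκ)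
  obtain ⟨d, hd, hle⟩ := hk.of_scaled hM
  exact ⟨y, hy, hyl, k, d, hd, by rwa [Nat.div_one]⟩

/-- Flooding in all scales approximates the weights of walks of at most `h` edges. -/
theorem sources_complete (hadj : ∀ u v, w u v ≠ ⊤ → G.Adj u v) {q h J T : ℕ} (hq : 0 < q)
    (hh : 0 < h) (hT : (2 * q + 1) * h + S.card ≤ T) {K : ℕ → ℕ → ℕ∞} {y v : V}
    (hK : ∀ σ ≤ J, K σ = flood G (sourceKeys S tag)
      (fun v u => keepRule (scaledLength (q * h) σ (w u v))) T v)
    (hy : y ∈ S) {k d : ℕ} (p : HopWalk w k y v d) (hk : k ≤ h) (hd : d < 2 ^ J) :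
    ∃ x : ℕ, estimate (q * h) J 1 K (tag y) = x ∧ q * x ≤ (q + 1) * d := by
  classical
  obtain ⟨σ, hσ, L, hL, pL, hle⟩ := p.scaled hq hh hk hd
  have hadj' : ∀ u v, scaledLength (q * h) σ (w u v) ≠ ⊤ → G.Adj u v :=
    fun u v h => hadj u v (scaledLength_ne_top h)
  have hf := flood_le (regular_keepRule fun u v => one_le_scaledLength (q * h) σ (w u v))
    (Λ := S.image tag) (fun v l κ hder => by
      obtain ⟨x, hx, rfl, -⟩ := (derivable_sources_iff hadj').1 hder
      exact Finset.mem_image_of_mem _ hx)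
    ((derivable_sources_iff hadj').2 ⟨y, hy, rfl, k, pL⟩) (t := T)
    (by have : (S.image tag).card ≤ S.card := Finset.card_image_le
        omega)
  obtain ⟨x, hx, hxle⟩ := estimate_le (M := q * h) (A := 1) hσ ((congrFun (hK σ hσ) _).trans_le hf)
    (Nat.div_one L).le
  exact ⟨x, hx, (Nat.mul_le_mul_left q hxle).trans hle⟩

end Sources

/-! ### Simulating the overlay graph by flooding in the network -/

section Overlay

/-- Labels are pairs. Either keep the label and add `1` to the key, or replace the second
component `y` of the label by `own` and increase the key, rounded down to a multiple of `A`, by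
`A * ℓ y`. -/
noncomputable def overlayRule (A : ℕ) (ℓ : ℕ → ℕ∞) (own κ l l' : ℕ) : ℕ∞ :=
  if l = l' then κ + 1
  else if l' = Nat.pair l.unpair.1 own then A * (((κ + 1) / A : ℕ) + ℓ l.unpair.2)
  else ⊤

variable {V : Type u} {G : SimpleGraph V}

/-- Rounding down to a multiple of `A` loses less than `A`, and a length of at least 1 restores it.
So an overlay step costs strictly more than a relay, which yields `lt` and `relay` of `Regular`. -/
theorem succ_lt_overlay {A κ : ℕ} (hA : 0 < A) {x : ℕ∞} (hx : 1 ≤ x) :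
    ((κ + 1 : ℕ) : ℕ∞) < A * (((κ + 1) / A : ℕ) + x) := by
  have h1 : κ + 1 < A * ((κ + 1) / A + 1) := Nat.lt_mul_div_succ _ hA
  calc ((κ + 1 : ℕ) : ℕ∞) < ((A * ((κ + 1) / A + 1) : ℕ) : ℕ∞) := by exact_mod_cast h1
    _ ≤ A * (((κ + 1) / A : ℕ) + x) := by push_cast; gcongr

theorem regular_overlayRule {A : ℕ} (hA : 0 < A) {ℓ : V → ℕ → ℕ∞} (hℓ : ∀ v y, 1 ≤ ℓ v y)
    (tag : V → ℕ) : Regular fun v (_ : V) => overlayRule A (ℓ v) (tag v) where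
  mono v u κ κ' l l' h := by
    unfold overlayRule; split_ifs
    · gcongr
    · gcongr
    · exact le_rfl
  lt v u κ l l' := by
    have h1 : (κ : ℕ∞) < (κ + 1 : ℕ) := by exact_mod_cast Nat.lt_succ_self κ
    unfold overlayRule; split_ifs
    · exact_mod_cast h1
    · exact h1.trans (succ_lt_overlay hA (hℓ v _))
    · exact ENat.natCast_lt_top κ
  relay v u κ l l' κ' k m h hkm := by
    unfold overlayRule at h
    rw [overlayRule, if_pos rfl]
    split_ifs at h with hl hg
    · have h : κ + 1 = κ' := by exact_mod_cast h
      norm_cast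
      omega
    · left
      rw [← h]
      refine lt_of_le_of_lt ?_ (succ_lt_overlay hA (hℓ v _))
      norm_cast
      omega
    · simp at h

variable {S S' : Finset V} {tag : V → ℕ} {o : V → ℕ → ℕ∞} {M A : ℕ}

open Classical in
/-- The weights of the overlay graph on `S`, when `v` has the estimate `o v (tag x)` of its distance
from `x`. -/
noncomputable def overlayWeight (S : Finset V) (tag : V → ℕ) (o : V → ℕ → ℕ∞) (x v : V) : ℕ∞ :=
  if x ∈ S ∧ v ∈ S then o v (tag x) else ⊤

open Classical in
/-- The overlay edge lengths known to `v`. -/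
noncomputable def overlayLength (M σ : ℕ) (S : Finset V) (o : V → ℕ → ℕ∞) (v : V) (y : ℕ) : ℕ∞ :=
  if v ∈ S then scaledLength M σ (o v y) else ⊤

theorem one_le_overlayLength (M σ : ℕ) (S : Finset V) (o : V → ℕ → ℕ∞) (v : V) (y : ℕ) :
    1 ≤ overlayLength M σ S o v y := by
  unfold overlayLength
  split_ifs
  · exact one_le_scaledLength _ _ _
  · exact le_top

theorem overlayLength_eq {σ : ℕ} {x v : V} (hx : x ∈ S) :
    overlayLength M σ S o v (tag x) = scaledLength M σ (overlayWeight S tag o x v) := by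
  unfold overlayLength overlayWeight
  by_cases hv : v ∈ S
  · simp [hx, hv]
  · cases σ <;> simp [hv, scaledLength]

/-- The invariant is A · L ≤ κ. Relaying only raises κ, and rounding down at an overlay step cannot
go below the multiple A · L. -/
theorem exists_walk_of_derivable_overlay (hA : 0 < A) (hS : S' ⊆ S) {σ : ℕ} {v : V} {l κ : ℕ}
    (h : Derivable G (sourceKeys S' fun v => Nat.pair (tag v) (tag v))
      (fun v _ => overlayRule A (overlayLength M σ S o v) (tag v)) v l κ) :
    ∃ z ∈ S', ∃ x ∈ S, l = Nat.pair (tag z) (tag x) ∧ ∃ k L,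
      HopWalk (fun x y => scaledLength M σ (overlayWeight S tag o x y)) k z x L ∧ A * L ≤ κ := by
  induction h with
  | @base v l κ h =>
    unfold sourceKeys at h
    split_ifs at h with hv
    · exact ⟨v, hv.1, v, hS hv.1, hv.2, 0, 0, .nil v, by simp⟩
    · simp at h
  | @step v u l l' κ κ' _ _ hR ih =>
    obtain ⟨z, hz, x, hx, rfl, k, L, hk, hle⟩ := ih
    unfold overlayRule at hR
    split_ifs at hR with hl hg
    · have : κ + 1 = κ' := by exact_mod_cast hR
      exact ⟨z, hz, x, hx, hl.symm, k, L, hk, by omega⟩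
    · rw [Nat.unpair_pair] at hg hR
      rw [overlayLength_eq hx] at hR
      have hne : scaledLength M σ (overlayWeight S tag o x v) ≠ ⊤ := by
        intro h; rw [h, add_top, ENat.mul_top (by exact_mod_cast hA.ne')] at hR; simp at hR
      obtain ⟨a, ha⟩ := ENat.ne_top_iff_exists.1 hne
      have hvS : v ∈ S := by
        by_contra hv
        exact scaledLength_ne_top hne (by simp [overlayWeight, hv])
      rw [← ha] at hR
      have hκ : A * ((κ + 1) / A + a) = κ' := by exact_mod_cast hR
      refine ⟨z, hz, v, hvS, hg, k + 1, L + a, hk.snoc ha.symm, ?_⟩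
      rw [← hκ]
      refine Nat.mul_le_mul_left A (Nat.add_le_add_right ?_ a)
      rw [Nat.le_div_iff_mul_le hA, mul_comm]
      omega
    · simp at hR

/-- Relaying is open to every node, not just to members of the sample; this is how the whole network
learns the overlay estimates. -/
theorem derivable_relay (hG : G.Connected) {ini : V → ℕ → ℕ∞} {ℓ : V → ℕ → ℕ∞} {x : V} {l κ : ℕ}
    (h : Derivable G ini (fun v _ => overlayRule A (ℓ v) (tag v)) x l κ) (v : V) :
    Derivable G ini (fun v _ => overlayRule A (ℓ v) (tag v)) v l (κ + G.dist x v) := by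
  induction hd : G.dist x v generalizing v with
  | zero => obtain rfl := hG.dist_eq_zero_iff.1 hd; exact h
  | succ d ih =>
    obtain ⟨u, hu, hud⟩ := exists_adj_dist_add_one hG (s := x) (v := v)
      (by rintro rfl; simp at hd)
    exact .step hu (ih u (by omega)) (by simp [overlayRule, add_assoc])

/-- Relaying from `y` to `x` adds less than `A` to a multiple of `A`, and rounding down removes it
again. Members of the overlay thus keep exact keys A · L', independent of their distance in the
network. -/
theorem derivable_overlay_of_walk (hG : G.Connected) (htag : tag.Injective) (hA : ∀ u v, G.dist u v < A) {σ k L : ℕ}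
    {z x : V} (hz : z ∈ S')
    (p : HopWalk (fun x y => scaledLength M σ (overlayWeight S tag o x y)) k z x L) :
    ∃ L' ≤ L, Derivable G (sourceKeys S' fun v => Nat.pair (tag v) (tag v))
      (fun v _ => overlayRule A (overlayLength M σ S o v) (tag v)) x
      (Nat.pair (tag z) (tag x)) (A * L') := by
  induction p with
  | nil z => exact ⟨0, le_rfl, .base (by simp [sourceKeys, hz])⟩
  | @snoc k d a z y x p h ih =>
    obtain ⟨L', hL', hder⟩ := ih hz
    -- A loop would leave the label unchanged, where `overlayRule` merely relays. Dropping it only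
    -- shortens the walk, hence `L' ≤ L` instead of equality.
    by_cases hyx : x = y
    · subst hyx
      exact ⟨L', by omega, hder⟩
    have hyS : y ∈ S := by
      by_contra hy
      exact scaledLength_ne_top (h.trans_ne (ENat.natCast_ne_top a)) (by simp [overlayWeight, hy])
    -- `u` is the last node before `x` on a shortest route from `y`; the final link is the `+ 1`
    -- inside the rule.
    obtain ⟨u, hu, hud⟩ := exists_adj_dist_add_one hG hyx
    have hApos : 0 < A := (Nat.zero_le _).trans_lt (hA x x)
    have hdiv : (A * L' + G.dist y u + 1) / A = L' := by
      rw [add_assoc, hud, Nat.mul_add_div hApos, Nat.div_eq_of_lt (hA y x), Nat.add_zero]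
    have hne : Nat.pair (tag z) (tag y) ≠ Nat.pair (tag z) (tag x) := fun h =>
      hyx (htag (Nat.pair_eq_pair.1 h).2).symm
    refine ⟨L' + a, by omega, .step hu (derivable_relay hG hder u) ?_⟩
    rw [overlayRule, if_neg hne, Nat.unpair_pair, if_pos rfl, hdiv, overlayLength_eq hyS, h]
    push_cast
    rfl

/-- Flooding in the overlay graph in all scales yields upper bounds on its distances. -/
theorem overlay_sound (hA : 0 < A) (hS : S' ⊆ S) (hM : 0 < M) {J T : ℕ} {K : ℕ → ℕ → ℕ∞} {v : V}
    (hK : ∀ σ ≤ J, K σ = flood G (sourceKeys S' fun v => Nat.pair (tag v) (tag v))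
      (fun v _ => overlayRule A (overlayLength M σ S o v) (tag v)) T v) {l e : ℕ}
    (h : estimate M J A K l = e) :
    ∃ z ∈ S', ∃ x ∈ S, l = Nat.pair (tag z) (tag x) ∧ ∃ k d,
      HopWalk (overlayWeight S tag o) k z x d ∧ d ≤ e := by
  obtain ⟨σ, hσ, κ, hκ, rfl⟩ := estimate_eq_coe h
  rw [hK σ hσ] at hκ
  obtain ⟨z, hz, x, hx, hl, k, L, hk, hL⟩ :=
    exists_walk_of_derivable_overlay hA hS (flood_derivable hκ)
  obtain ⟨d, hd, hle⟩ := hk.of_scaled hM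
  exact ⟨z, hz, x, hx, hl, k, d, hd, hle.trans
    (unscaled_mono M σ ((Nat.le_div_iff_mul_le hA).2 (by rwa [mul_comm])))⟩

/-- Flooding in the overlay graph in all scales approximates the weights of walks of at most `h`
edges. -/
theorem overlay_complete (hG : G.Connected) (htag : tag.Injective) (hA : ∀ u v, G.dist u v < A)
    (hS : S' ⊆ S) {q h J T : ℕ} (hq : 0 < q) (hh : 0 < h)
    (hT : A * ((2 * q + 1) * h + 1) + S'.card * S.card ≤ T) {K : ℕ → ℕ → ℕ∞} {v : V}
    (hK : ∀ σ ≤ J, K σ = flood G (sourceKeys S' fun v => Nat.pair (tag v) (tag v))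
      (fun v _ => overlayRule A (overlayLength (q * h) σ S o v) (tag v)) T v)
    {z x : V} (hz : z ∈ S') {k d : ℕ} (p : HopWalk (overlayWeight S tag o) k z x d) (hk : k ≤ h)
    (hd : d < 2 ^ J) :
    ∃ e : ℕ, estimate (q * h) J A K (Nat.pair (tag z) (tag x)) = e ∧ q * e ≤ (q + 1) * d := by
  classical
  obtain ⟨σ, hσ, L, hL, pL, hle⟩ := p.scaled hq hh hk hd
  obtain ⟨L', hL', hder⟩ := derivable_overlay_of_walk hG htag hA hz pL
  have hApos : 0 < A := (Nat.zero_le _).trans_lt (hA x x)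
  have hlt := hA x v
  have hAL : A * L' ≤ A * ((2 * q + 1) * h) := Nat.mul_le_mul_left A (hL'.trans hL)
  have hf := flood_le (regular_overlayRule hApos (one_le_overlayLength (q * h) σ S o) tag)
    (Λ := (S' ×ˢ S).image fun p => Nat.pair (tag p.1) (tag p.2)) (fun v l κ hder => by
      obtain ⟨z, hz, x, hx, rfl, -⟩ := exists_walk_of_derivable_overlay hApos hS hder
      exact Finset.mem_image_of_mem (fun p : V × V => Nat.pair (tag p.1) (tag p.2))
        (Finset.mk_mem_product hz hx))
    (derivable_relay hG hder v) (t := T)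
    -- The additional `A` in the number of rounds pays for the relay from `x` to `v`.
    (by have : ((S' ×ˢ S).image fun p => Nat.pair (tag p.1) (tag p.2)).card ≤ S'.card * S.card :=
          Finset.card_image_le.trans (Finset.card_product _ _).le
        rw [mul_add] at hT
        omega)
  obtain ⟨e, he, hele⟩ := estimate_le (M := q * h) (A := A) hσ
    ((congrFun (hK σ hσ) _).trans_le hf)
    (show (A * L' + G.dist x v) / A ≤ L by
      rw [Nat.mul_add_div hApos, Nat.div_eq_of_lt hlt]; exact hL')
  exact ⟨e, he, (Nat.mul_le_mul_left q hele).trans hle⟩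

end Overlay

/-! ### Shortest-path trees, hitting sets and recombination of estimates -/

section PathTree

variable {V : Type u} {w : V → V → ℕ∞} {s : V}

/-- There is a walk from `s` to `v`. -/
def Reaches (w : V → V → ℕ∞) (s v : V) : Prop := ∃ k d, HopWalk w k s v d

/-- A tree of shortest paths from `s`, whose paths have the least number of edges: `pred v` is the
predecessor, `δ v` the distance and `hop v` the number of edges of the tree path to `v`. -/
structure PathTree (w : V → V → ℕ∞) (s : V) where
  pred : V → V
  δ : V → ℕ
  hop : V → ℕ
  root : ∀ {v}, Reaches w s v → hop v = 0 → v = s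
  δ_root : δ s = 0
  step : ∀ {v}, Reaches w s v → hop v ≠ 0 → Reaches w s (pred v) ∧ hop (pred v) + 1 = hop v ∧
    ∃ a : ℕ, w (pred v) v = a ∧ δ v = δ (pred v) + a
  δ_le : ∀ {v k d}, HopWalk w k s v d → δ v ≤ d

/-- Minimize the weight, then the number of edges. The second minimization makes `hop` drop by
exactly one at each predecessor, so edges of weight 0 cannot create cycles. -/
theorem exists_pathTree (w : V → V → ℕ∞) (s : V) : Nonempty (PathTree w s) := by
  classical
  set δ : V → ℕ := fun v => sInf {d | ∃ k, HopWalk w k s v d} with hδ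
  set hop : V → ℕ := fun v => sInf {k | HopWalk w k s v (δ v)} with hhop
  have hδle : ∀ {v k d}, HopWalk w k s v d → δ v ≤ d := fun h => Nat.sInf_le ⟨_, h⟩
  have hhople : ∀ {v k}, HopWalk w k s v (δ v) → hop v ≤ k := fun h => Nat.sInf_le h
  have hwalk : ∀ {v}, Reaches w s v → HopWalk w (hop v) s v (δ v) := by
    rintro v ⟨k, d, h⟩
    obtain ⟨k', h'⟩ : ∃ k, HopWalk w k s v (δ v) :=
      Nat.sInf_mem (s := {d | ∃ k, HopWalk w k s v d}) ⟨d, k, h⟩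
    exact Nat.sInf_mem (s := {k | HopWalk w k s v (δ v)}) ⟨k', h'⟩
  have hstep : ∀ v, ∃ x, Reaches w s v → hop v ≠ 0 → Reaches w s x ∧ hop x + 1 = hop v ∧
      ∃ a : ℕ, w x v = a ∧ δ v = δ x + a := by
    intro v
    by_cases hv : Reaches w s v ∧ hop v ≠ 0
    · obtain ⟨n, hn⟩ := Nat.exists_eq_succ_of_ne_zero hv.2
      have hw := hwalk hv.1
      rw [hn] at hw
      generalize hd : δ v = d at hw
      cases hw with
      | @snoc _ d a _ x _ p h =>
        have hx : Reaches w s x := ⟨_, _, p⟩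
        have h1 : δ x ≤ d := hδle p
        have h2 := hδle ((hwalk hx).snoc h)
        have hdx : δ x = d := by omega
        have h3 : hop x ≤ n := hhople (hdx ▸ p)
        have h4 : hop v ≤ hop x + 1 := hhople (by
          have := (hwalk hx).snoc h; rwa [show δ x + a = δ v by omega] at this)
        exact ⟨x, fun _ _ => ⟨hx, by omega, a, h, by omega⟩⟩
    · exact ⟨v, fun h1 h2 => absurd ⟨h1, h2⟩ hv⟩
  choose pred hpred using hstep
  refine ⟨⟨pred, δ, hop, fun {v} hv h0 => ?_, Nat.le_zero.1 (hδle (.nil s)),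
    fun {v} => hpred v, hδle⟩⟩
  have hw := hwalk hv
  rw [h0] at hw
  generalize δ v = d at hw
  cases hw
  rfl

namespace PathTree

variable (T : PathTree w s)

theorem iterate {v : V} (hv : Reaches w s v) {i : ℕ} (hi : i ≤ T.hop v) :
    Reaches w s (T.pred^[i] v) ∧ T.hop (T.pred^[i] v) + i = T.hop v ∧
      ∃ d, HopWalk w i (T.pred^[i] v) v d ∧ T.δ v = T.δ (T.pred^[i] v) + d := by
  induction i generalizing v with
  | zero => exact ⟨hv, rfl, 0, .nil v, rfl⟩
  | succ i ih =>
    obtain ⟨hr, hh, a, ha, hδ⟩ := T.step hv (by omega)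
    obtain ⟨hr', hh', d, hd, hδ'⟩ := ih hr (by omega)
    rw [Function.iterate_succ_apply]
    exact ⟨hr', by omega, d + a, hd.snoc ha, by omega⟩

/-- The ancestors of `v` have distinct values of `hop`, hence are distinct nodes. -/
theorem hop_lt_card [Fintype V] {v : V} (hv : Reaches w s v) : T.hop v < Fintype.card V := by
  have : Function.Injective fun i : Fin (T.hop v + 1) => T.pred^[(i : ℕ)] v := by
    intro i j hij
    have hi := (T.iterate hv (Nat.lt_succ_iff.1 i.2)).2.1
    have hj := (T.iterate hv (Nat.lt_succ_iff.1 j.2)).2.1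
    simp only at hij
    rw [hij] at hi
    exact Fin.ext (by omega)
  simpa using Fintype.card_le_of_injective _ this

theorem δ_le_mul {W : ℕ} (hW : ∀ u v a, w u v = (a : ℕ) → a ≤ W) {v : V} (hv : Reaches w s v) :
    T.δ v ≤ T.hop v * W := by
  induction hn : T.hop v generalizing v with
  | zero => rw [T.root hv hn, T.δ_root]; exact Nat.zero_le _
  | succ n ih =>
    obtain ⟨hr, hh, a, ha, hδ⟩ := T.step hv (by omega)
    have := ih hr (by omega)
    have := hW _ _ _ ha
    rw [hδ, Nat.succ_mul]
    omega

/-- Every tree path with `b` edges contains an element of `S`, and so does every shorter tree path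
from the root. -/
def Hits (S : Finset V) (b : ℕ) : Prop :=
  ∀ v, Reaches w s v → ∃ i ≤ b, i ≤ T.hop v ∧ T.pred^[i] v ∈ S

/-- Since the root belongs to `S`, only tree paths with at least `b` edges have to be hit. -/
theorem hits_of_forall {S : Finset V} {b : ℕ} (hs : s ∈ S)
    (h : ∀ v, Reaches w s v → b ≤ T.hop v → ∃ i < b, T.pred^[i] v ∈ S) : T.Hits S b := by
  intro v hv
  rcases le_total (T.hop v) b with hb | hb
  · refine ⟨T.hop v, hb, le_rfl, ?_⟩
    obtain ⟨hr, hh, -⟩ := T.iterate hv le_rfl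
    rwa [T.root hr (by omega)]
  · obtain ⟨i, hi, hiS⟩ := h v hv hb
    exact ⟨i, hi.le, hi.le.trans hb, hiS⟩

end PathTree

/-- The least weight of a walk. -/
noncomputable def hopDist {X : Type*} (w : X → X → ℕ∞) (u v : X) : ℕ∞ :=
  ⨅ d : ℕ, ⨅ _ : ∃ k, HopWalk w k u v d, (d : ℕ∞)

theorem hopDist_le {X : Type*} {w : X → X → ℕ∞} {u v : X} {k d : ℕ} (h : HopWalk w k u v d) :
    hopDist w u v ≤ d := iInf₂_le d ⟨k, h⟩

/-- The graph on tags that the node with tag `own` knows in the end: `o` estimates distances to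
`own`, and `o'` distances in the overlay graph. -/
noncomputable def finalWeight (own : ℕ) (o o' : ℕ → ℕ∞) (a b : ℕ) : ℕ∞ :=
  o' (Nat.pair a b) ⊓ if b = own then o a else ⊤

variable {S S' : Finset V} {tag : V → ℕ} {o o' : V → ℕ → ℕ∞}

theorem exists_hopWalk_of_overlay
    (ho : ∀ v l (x : ℕ), o v l = x → ∃ y ∈ S, tag y = l ∧ ∃ k d, HopWalk w k y v d ∧ d ≤ x)
    (htag : tag.Injective) {k d : ℕ} {z x : V} (p : HopWalk (overlayWeight S tag o) k z x d) :
    ∃ k' d', HopWalk w k' z x d' ∧ d' ≤ d := by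
  induction p with
  | nil u => exact ⟨0, 0, .nil u, le_rfl⟩
  | @snoc _ _ a _ x v _ h ih =>
    obtain ⟨k₁, d₁, p₁, h₁⟩ := ih
    unfold overlayWeight at h
    split_ifs at h with hxv
    · obtain ⟨y, hy, hyx, k₂, d₂, p₂, h₂⟩ := ho _ _ _ h
      obtain rfl := htag hyx
      exact ⟨_, _, p₁.trans p₂, by omega⟩
    · simp at h

/-- The estimates of all nodes are upper bounds on the distance from `s`. -/
theorem exists_hopWalk_of_final
    (ho : ∀ v l (x : ℕ), o v l = x → ∃ y ∈ S, tag y = l ∧ ∃ k d, HopWalk w k y v d ∧ d ≤ x)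
    (ho' : ∀ v l (e : ℕ), o' v l = e → ∃ z ∈ S', ∃ x ∈ S, l = Nat.pair (tag z) (tag x) ∧
      ∃ k d, HopWalk (overlayWeight S tag o) k z x d ∧ d ≤ e)
    (htag : tag.Injective) {v : V} {k d : ℕ}
    (p : HopWalk (finalWeight (tag v) (o v) (o' v)) k (tag s) (tag v) d) :
    ∃ k' d', HopWalk w k' s v d' ∧ d' ≤ d := by
  -- The walk lives on arbitrary numbers, so the induction must also show that each number it visits
  -- is the tag of a node.
  suffices h : ∀ {k a b d}, HopWalk (finalWeight (tag v) (o v) (o' v)) k a b d → a = tag s →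
      ∃ y, b = tag y ∧ ∃ k' d', HopWalk w k' s y d' ∧ d' ≤ d by
    obtain ⟨y, hy, h⟩ := h p rfl
    obtain rfl := htag hy
    exact h
  intro k a b d p
  induction p with
  | nil a => rintro rfl; exact ⟨s, rfl, 0, 0, .nil s, le_rfl⟩
  | @snoc _ _ e _ x b _ h ih =>
    intro ha
    obtain ⟨y, hxy, k₁, d₁, p₁, h₁⟩ := ih ha
    unfold finalWeight at h
    rcases min_choice (o' v (Nat.pair x b)) (if b = tag v then o v x else ⊤) with hc | hc
    · obtain ⟨z, hz, x', hx', hl, k₂, d₂, p₂, h₂⟩ := ho' _ _ _ (hc.symm.trans h)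
      obtain ⟨hxz, hb⟩ := Nat.pair_eq_pair.1 hl
      obtain rfl : y = z := htag (hxy.symm.trans hxz)
      obtain ⟨k₃, d₃, p₃, h₃⟩ := exists_hopWalk_of_overlay ho htag p₂
      exact ⟨x', hb, _, _, p₁.trans p₃, by omega⟩
    · have h := hc.symm.trans h
      split_ifs at h with hb
      · obtain ⟨y', hy', hyx, k₂, d₂, p₂, h₂⟩ := ho _ _ _ h
        obtain rfl : y = y' := htag (hxy.symm.trans hyx.symm)
        exact ⟨v, hb, _, _, p₁.trans p₂, by omega⟩
      · simp at h

variable {q b H J : ℕ} (T : PathTree w s)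

/-- From `x` climb `b` edges and then at most `b` more to reach `S`. Such a stretch has at most 2b
edges, the hop bound of the network floodings, but at least `b`, so `m * b` tree edges need at most
`m` overlay edges. The relative error of the pieces does not accumulate. -/
theorem exists_overlay_walk (hb : 0 < b) (hJ : ∀ v, Reaches w s v → 2 * T.δ v < 2 ^ J)
    (hS : T.Hits S b)
    (ho : ∀ y ∈ S, ∀ v k d, HopWalk w k y v d → k ≤ 2 * b → d < 2 ^ J →
      ∃ x : ℕ, o v (tag y) = x ∧ q * x ≤ (q + 1) * d)
    {m j : ℕ} {x : V} (hx : Reaches w s x) (hxS : x ∈ S) (hj : j ≤ T.hop x)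
    (hz : T.pred^[j] x ∈ S) (hjm : j ≤ m * b) :
    ∃ k ≤ m, ∃ d, HopWalk (overlayWeight S tag o) k (T.pred^[j] x) x d ∧
      q * d + (q + 1) * T.δ (T.pred^[j] x) ≤ (q + 1) * T.δ x := by
  have hedge : ∀ {x i}, Reaches w s x → x ∈ S → i ≤ T.hop x → T.pred^[i] x ∈ S → i ≤ 2 * b →
      ∃ e : ℕ, overlayWeight S tag o (T.pred^[i] x) x = e ∧
        q * e + (q + 1) * T.δ (T.pred^[i] x) ≤ (q + 1) * T.δ x := by
    intro x i hx hxS hi hiS hib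
    obtain ⟨-, -, d, hd, hδ⟩ := T.iterate hx hi
    have := hJ x hx
    obtain ⟨e, he, hle⟩ := ho _ hiS _ _ _ hd hib (by omega)
    refine ⟨e, by rw [overlayWeight, if_pos ⟨hiS, hxS⟩, he], ?_⟩
    rw [hδ, mul_add]
    omega
  induction m generalizing x j with
  | zero =>
    obtain rfl : j = 0 := by omega
    exact ⟨0, le_rfl, 0, .nil x, by simp⟩
  | succ m ih =>
    by_cases hjb : j ≤ 2 * b
    · obtain ⟨e, he, hle⟩ := hedge hx hxS hj hz hjb
      exact ⟨1, by omega, e, by simpa using (HopWalk.nil _).snoc he, hle⟩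
    · obtain ⟨hy, hyh, -⟩ := T.iterate hx (i := b) (by omega)
      obtain ⟨i, hib, hih, hiS⟩ := hS _ hy
      rw [← Function.iterate_add_apply] at hiS
      obtain ⟨hx', hxh', -⟩ := T.iterate hx (i := i + b) (by omega)
      have hcomp : T.pred^[j] x = T.pred^[j - (i + b)] (T.pred^[i + b] x) := by
        rw [← Function.iterate_add_apply]; congr 1; omega
      rw [Nat.succ_mul] at hjm
      obtain ⟨k, hk, d, hd, hle⟩ := ih hx' hiS (j := j - (i + b)) (by omega)
        (by rwa [← hcomp]) (by omega)
      obtain ⟨e, he, hle'⟩ := hedge hx hxS (i := i + b) (by omega) hiS (by omega)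
      rw [← hcomp] at hd hle
      exact ⟨k + 1, by omega, d + e, hd.snoc he, by rw [mul_add]; omega⟩

/-- The estimates of all nodes approximate the distance from `s`. -/
theorem exists_final_walk (hb : 0 < b) (hJ : ∀ v, Reaches w s v → 2 * T.δ v < 2 ^ J)
    (hq : 0 < q) (hS : T.Hits S b) (hS' : T.Hits S' H) (hSS : S' ⊆ S)
    (ho : ∀ y ∈ S, ∀ v k d, HopWalk w k y v d → k ≤ 2 * b → d < 2 ^ J →
      ∃ x : ℕ, o v (tag y) = x ∧ q * x ≤ (q + 1) * d)
    (ho' : ∀ z ∈ S', ∀ x v k d, HopWalk (overlayWeight S tag o) k z x d → k ≤ H / b + 1 →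
      d < 2 ^ J → ∃ e : ℕ, o' v (Nat.pair (tag z) (tag x)) = e ∧ q * e ≤ (q + 1) * d)
    {v : V} (hv : Reaches w s v) :
    ∃ k d, HopWalk (finalWeight (tag v) (o v) (o' v)) k (tag s) (tag v) d ∧
      q ^ 2 * d ≤ (q + 1) ^ 2 * T.δ v := by
  -- From a member of `S'` one first moves to its predecessor and then at most `H` edges to the next
  -- member, which explains `H + 1` and the overlay hop bound.
  have hm : H + 1 ≤ (H / b + 1) * b := Nat.lt_div_mul_add hb |>.trans_eq (by ring)
  have hedge : ∀ {x j}, Reaches w s x → x ∈ S → j ≤ T.hop x → T.pred^[j] x ∈ S' → j ≤ H + 1 →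
      ∃ e : ℕ, o' v (Nat.pair (tag (T.pred^[j] x)) (tag x)) = e ∧
        q ^ 2 * e + (q + 1) ^ 2 * T.δ (T.pred^[j] x) ≤ (q + 1) ^ 2 * T.δ x := by
    intro x j hx hxS hj hz hjH
    obtain ⟨k, hk, d, hd, hle⟩ := exists_overlay_walk T hb hJ hS ho hx hxS hj (hSS hz)
      (hjH.trans hm)
    have hδ := hJ x hx
    -- The first rounding can at most double a weight, hence the factor 2 in `hJ`.
    obtain ⟨e, he, hle'⟩ := ho' _ hz x v k d hd hk (by
      have : q * d ≤ q * (2 * T.δ x) := by nlinarith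
      exact (Nat.le_of_mul_le_mul_left this hq).trans_lt hδ)
    refine ⟨e, he, ?_⟩
    nlinarith
  have hwalk : ∀ {a c e d : ℕ} {k : ℕ}, HopWalk (finalWeight (tag v) (o v) (o' v)) k (tag s) a d →
      finalWeight (tag v) (o v) (o' v) a c ≤ e →
      ∃ k d', HopWalk (finalWeight (tag v) (o v) (o' v)) k (tag s) c d' ∧ d' ≤ d + e := by
    intro a c e d k p hle
    obtain ⟨e', he'⟩ := ENat.ne_top_iff_exists.1 (hle.trans_lt (ENat.natCast_lt_top e)).ne
    refine ⟨_, _, p.snoc he'.symm, ?_⟩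
    rw [← he'] at hle
    have : e' ≤ e := by exact_mod_cast hle
    omega
  -- Induction on depth: each member of `S'` is joined to one closer to the root by an edge whose
  -- error is proportional to that stretch, so these errors sum to the same factor.
  have hmem : ∀ n, ∀ z ∈ S', Reaches w s z → T.hop z = n →
      ∃ k d, HopWalk (finalWeight (tag v) (o v) (o' v)) k (tag s) (tag z) d ∧
        q ^ 2 * d ≤ (q + 1) ^ 2 * T.δ z := by
    intro n
    induction n using Nat.strong_induction_on with
    | _ n ih =>
      intro z hzS hz hn
      rcases Nat.eq_zero_or_pos n with rfl | hpos
      · obtain rfl := T.root hz hn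
        exact ⟨0, 0, .nil _, by simp⟩
      · obtain ⟨hy, hyh, -⟩ := T.step hz (by omega)
        obtain ⟨i, hiH, hih, hiS⟩ := hS' _ hy
        change T.pred^[i + 1] z ∈ S' at hiS
        obtain ⟨hz', hzh', -⟩ := T.iterate hz (i := i + 1) (by omega)
        obtain ⟨e, he, hle⟩ := hedge hz (hSS hzS) (j := i + 1) (by omega) hiS (by omega)
        obtain ⟨k, d, hd, hle'⟩ := ih _ (by omega) _ hiS hz' rfl
        obtain ⟨k', d', hd', hle''⟩ := hwalk (c := tag z) (e := e) hd
          (inf_le_left.trans_eq he)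
        refine ⟨k', d', hd', (Nat.mul_le_mul_left (q ^ 2) hle'').trans ?_⟩
        rw [mul_add]
        omega
  obtain ⟨i, hib, hih, hiS⟩ := hS v hv
  obtain ⟨hx, hxh, c, hc, hδ⟩ := T.iterate hv hih
  obtain ⟨j, hjH, hjh, hjS⟩ := hS' _ hx
  obtain ⟨hz, -⟩ := T.iterate hx hjh
  obtain ⟨k, d, hd, hle⟩ := hmem _ _ hjS hz rfl
  obtain ⟨e, he, hle'⟩ := hedge hx hiS hjh hjS (by omega)
  obtain ⟨k', d', hd', hle''⟩ := hwalk (c := tag (T.pred^[i] v)) (e := e) hd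
    (inf_le_left.trans_eq he)
  have := hJ v hv
  obtain ⟨f, hf, hfle⟩ := ho _ hiS v i c hc (by omega) (by omega)
  obtain ⟨k'', d'', hd'', hle'''⟩ := hwalk (c := tag v) (e := f) hd'
    (inf_le_right.trans_eq (by rw [if_pos rfl, hf]))
  refine ⟨k'', d'', hd'', (Nat.mul_le_mul_left (q ^ 2) (hle'''.trans
    (Nat.add_le_add_right hle'' f))).trans ?_⟩
  have h1 : q ^ 2 * f ≤ (q + 1) ^ 2 * c := by nlinarith
  rw [hδ, mul_add, mul_add, mul_add]
  omega

end PathTree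

namespace Protocol

variable {V : Type u} {X Y Z : Type}

/-- Apply a function to the output. -/
def map (P : Protocol X Y) (g : Y → Z) : Protocol X Z where
  State := P.State
  init := P.init
  send := P.send
  step := P.step
  output σ := (P.output σ).map g

theorem run_map (P : Protocol X Y) (g : Y → Z) (N : Network V) (x : V → X) (ω : ℕ → V → Bool)
    (t : ℕ) : (P.map g).run N x ω t = P.run N x ω t := by
  induction t with
  | zero => rfl
  | succ t ih => funext v; rw [run, run, ih]; rfl

theorem Computes.map {P : Protocol X Y} {N : Network V} {x : V → X} {ω : ℕ → V → Bool} {B T : ℕ}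
    {y : V → Y} (h : P.Computes N x ω B T y) (g : Y → Z) :
    (P.map g).Computes N x ω B T fun v => g (y v) where
  output_eq v := by rw [run_map]; exact congrArg (Option.map g) (h.output_eq v)
  output_none t ht v := by rw [run_map]; exact congrArg (Option.map g) (h.output_none t ht v)
  size_send_le t ht v := by rw [run_map]; exact h.size_send_le t ht v

end Protocol

/-! ### Assembly of the algorithm -/

/-- The parameters of the algorithm: `1 / q` is the precision of the rounding, weights below
`2 ^ scales` matter, every `b` (`H`) edges of a shortest path there is a node that is sampled at
the first (second) level, nodes are sampled with probability `2⁻¹ ^ j₁` and `2⁻¹ ^ j₂`, at most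
`k₁` and `k₂` nodes are sampled, and `A` exceeds the diameter. -/
structure Params where
  q : ℕ
  scales : ℕ
  b : ℕ
  H : ℕ
  j₁ : ℕ
  j₂ : ℕ
  k₁ : ℕ
  k₂ : ℕ
  A : ℕ

namespace Params

variable (p : Params)

/-- The hop bound of the flooding in the network. -/
def h₁ : ℕ := 2 * p.b
/-- The hop bound of the flooding in the overlay graph. -/
def h₂ : ℕ := p.H / p.b + 1
/-- The number of rounds of each flooding in the network. -/
def T₁ : ℕ := (2 * p.q + 1) * p.h₁ + p.k₁
/-- The number of rounds of each flooding in the overlay graph. -/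
def T₂ : ℕ := p.A * ((2 * p.q + 1) * p.h₂ + 1) + p.k₂ * p.k₁

end Params

/-- The weight of an edge or non-edge. -/
def edgeWeight (x : Option ℕ) : ℕ∞ := x.elim ⊤ (↑)

theorem edgeWeight_eq_coe {x : Option ℕ} {a : ℕ} : edgeWeight x = a ↔ x = some a := by
  cases x with
  | none => simp [edgeWeight]
  | some b => simp only [edgeWeight, Option.elim_some, Option.some.injEq]; norm_cast

open Classical in
/-- The tag of a node: `0` for the source, and otherwise one more than the identifier. -/
noncomputable def LocalInput.tag (x : LocalInput) : ℕ := if x.isSource then 0 else x.ident + 1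

/-- The knowledge of a node after the survey and its coin flips. -/
abbrev SampleKnowledge : Type := (LocalInput × ℕ × ℕ) × (ℕ → Bool)

/-- Whether a node is sampled at a level with parameter `j`. -/
def SampleKnowledge.Sampled (y : SampleKnowledge) (j : ℕ) : Prop :=
  y.1.1.isSource ∨ ∀ i < j, y.2 i = true

section Algorithm

variable (par : ℕ → ℕ → Params)

/-- The parameters, as known to a node. -/
def SampleKnowledge.params (y : SampleKnowledge) : Params := par y.1.2.1 y.1.2.2

open Classical in
/-- The first series of floodings: from the sampled nodes in the network. -/
noncomputable def networkFlood (y : SampleKnowledge) : FloodInput where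
  rounds := (y.params par).T₁
  instances := (y.params par).scales + 1
  init _ l := if y.Sampled (y.params par).j₁ ∧ l = y.1.1.tag then 0 else ⊤
  rule σ i := keepRule (scaledLength ((y.params par).q * (y.params par).h₁) σ
    (edgeWeight (y.1.1.inWeight i)))

/-- The estimates of a node after the first series of floodings. -/
noncomputable def networkEstimate (y : SampleKnowledge × (ℕ → ℕ → ℕ∞)) : ℕ → ℕ∞ :=
  estimate ((y.1.params par).q * (y.1.params par).h₁) (y.1.params par).scales 1 y.2

open Classical in
/-- The second series of floodings: in the overlay graph. -/
noncomputable def overlayFlood (y : SampleKnowledge × (ℕ → ℕ → ℕ∞)) : FloodInput where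
  rounds := (y.1.params par).T₂
  instances := (y.1.params par).scales + 1
  init _ l := if y.1.Sampled (y.1.params par).j₂ ∧ l = Nat.pair y.1.1.1.tag y.1.1.1.tag then 0
    else ⊤
  rule σ _ := overlayRule (y.1.params par).A (fun l =>
    if y.1.Sampled (y.1.params par).j₁ then
      scaledLength ((y.1.params par).q * (y.1.params par).h₂) σ (networkEstimate par y l)
    else ⊤) y.1.1.1.tag

/-- The output of a node after both series of floodings. -/
noncomputable def finalOutput (y : (SampleKnowledge × (ℕ → ℕ → ℕ∞)) × (ℕ → ℕ → ℕ∞)) : ℕ∞ :=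
  hopDist (finalWeight y.1.1.1.1.tag (networkEstimate par y.1)
    (estimate ((y.1.1.params par).q * (y.1.1.params par).h₂) (y.1.1.params par).scales
      (y.1.1.params par).A y.2)) 0 y.1.1.1.1.tag

/-- The complete algorithm. -/
noncomputable def ssspProtocol : Protocol LocalInput ℕ∞ :=
  (((survey.seq (Protocol.flipCoins fun y => (par y.2.1 y.2.2).j₂)).seq
    (Protocol.floods (networkFlood par))).seq (Protocol.floods (overlayFlood par))).map
      (finalOutput par)

end Algorithm

/-! ### Guarantees of the algorithm for a fixed outcome of the coins -/

section Correctness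

variable {V : Type u} {N : Network V} (I : SSSPInstance N)

/-- The weights of the instance. -/
def inputWeight (u v : V) : ℕ∞ := edgeWeight (I.weight u v)

/-- The tag of a node. -/
noncomputable def nodeTag (v : V) : ℕ := (localInput I v).tag

theorem nodeTag_source : nodeTag I I.source = 0 := if_pos rfl

theorem nodeTag_injective : Function.Injective (nodeTag I) := by
  intro u v h
  by_cases hu : u = I.source <;> by_cases hv : v = I.source <;>
    simp [nodeTag, LocalInput.tag, localInput, hu, hv] at h
  · rw [hu, hv]
  · exact N.ident_injective h

theorem nodeTag_le (v : V) : nodeTag I v ≤ N.ident v + 1 := by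
  unfold nodeTag LocalInput.tag
  split_ifs
  · exact Nat.zero_le _
  · exact le_rfl

theorem adj_of_inputWeight (u v : V) (h : inputWeight I u v ≠ ⊤) : N.links.Adj u v := by
  obtain ⟨a, ha⟩ := ENat.ne_top_iff_exists.1 h
  exact I.link_of_edge u v a (edgeWeight_eq_coe.1 ha.symm)

open Classical in
/-- The nodes that are sampled at the level with parameter `j` when the coins of `v` start in
round `t`. -/
noncomputable def sample [Fintype V] (ω : Coins V) (t j : ℕ) : Finset V :=
  Finset.univ.filter fun v => v = I.source ∨ ∀ i < j, ω (v, t + i, 0) = true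

/-- The round in which the coins are flipped. -/
noncomputable def surveyTime [Fintype V] : ℕ := 4 * Survey.ecc I + 4

theorem source_mem_sample [Fintype V] (ω : Coins V) (t j : ℕ) : I.source ∈ sample I ω t j := by
  simp [sample]

theorem sample_subset [Fintype V] (ω : Coins V) (t : ℕ) {j j' : ℕ} (h : j ≤ j') :
    sample I ω t j' ⊆ sample I ω t j := by
  intro v
  simp only [sample, Finset.mem_filter, Finset.mem_univ, true_and]
  exact Or.imp_right fun hv i hi => hv i (hi.trans_le h)

/-- The message pairs a key, at most the round number, with a label; the 1 accounts for the reserved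
empty message. -/
theorem announce_lt {G : SimpleGraph V} {ini : V → ℕ → ℕ∞} {R : V → V → ℕ → ℕ → ℕ → ℕ∞} {X t : ℕ}
    (hl : ∀ v l κ, Derivable G ini R v l κ → l < X) (ht : t < X) (v : V) :
    announce (flood G ini R t v) t < X ^ 2 + 1 := by
  by_cases h0 : announce (flood G ini R t v) t = 0
  · rw [h0]; positivity
  · obtain ⟨κ, l, h, hκ, hd⟩ := announce_flood_spec h0
    rw [h]
    exact Nat.add_lt_add_right (pair_lt_sq (hκ.trans_lt ht) (hl _ _ _ hd)) 1

/-- What the run of the algorithm guarantees; `X` bounds the numbers that occur in messages. -/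
theorem ssspProtocol_computes [Fintype V] (par : ℕ → ℕ → Params) (ω : Coins V) {p : Params}
    (hp : par (Survey.ecc I) (Fintype.card V) = p) {B X Y : ℕ} (he : 1 ≤ Survey.ecc I)
    (hid : ∀ v, N.ident v + 2 < X) (hX : Fintype.card V < X) (hXY : X ^ 2 ≤ Y)
    (hT₁ : p.T₁ ≤ Y) (hT₂ : p.T₂ ≤ Y) (hB : ∀ m < Y ^ 2 + 1, m.size ≤ B)
    (hq : 0 < p.q) (hb : 0 < p.b) (hj : p.j₁ ≤ p.j₂)
    (hA : ∀ u v, N.links.dist u v < p.A) :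
    ∃ y : V → ℕ∞, (ssspProtocol par).Computes N (localInput I) (fun t v => ω (v, t, 0)) B
        (surveyTime I + p.j₂ + (p.scales + 1) * p.T₁ + (p.scales + 1) * p.T₂) y ∧
      (∀ v (d : ℕ), y v = d → ∃ k d', HopWalk (inputWeight I) k I.source v d' ∧ d' ≤ d) ∧
      ∀ T : PathTree (inputWeight I) I.source,
        (∀ v, Reaches (inputWeight I) I.source v → 2 * T.δ v < 2 ^ p.scales) →
        T.Hits (sample I ω (surveyTime I) p.j₁) p.b → T.Hits (sample I ω (surveyTime I) p.j₂) p.H →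
        (sample I ω (surveyTime I) p.j₁).card ≤ p.k₁ →
        (sample I ω (surveyTime I) p.j₂).card ≤ p.k₂ →
        ∀ v, Reaches (inputWeight I) I.source v →
          ∃ d : ℕ, y v = d ∧ p.q ^ 2 * d ≤ (p.q + 1) ^ 2 * T.δ v := by
  classical
  set S := sample I ω (surveyTime I) p.j₁ with hS
  set S' := sample I ω (surveyTime I) p.j₂ with hS'
  have hSS : S' ⊆ S := sample_subset I ω _ hj
  set x : V → LocalInput × ℕ × ℕ := fun v => (localInput I v, Survey.ecc I, Fintype.card V) with hx
  have hApos : 0 < p.A := (Nat.zero_le _).trans_lt (hA I.source I.source)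
  have hh₁ : 0 < p.h₁ := Nat.mul_pos two_pos hb
  have hh₂ : 0 < p.h₂ := Nat.succ_pos _
  have hXpos : 0 < X := (Nat.zero_le _).trans_lt hX
  have hT₁pos : 0 < p.T₁ := Nat.add_pos_left (Nat.mul_pos (by omega) hh₁) _
  have hT₂pos : 0 < p.T₂ := Nat.add_pos_left (Nat.mul_pos hApos (by omega)) _
  have htag : ∀ v, nodeTag I v < X := fun v => by
    have := nodeTag_le I v; have := hid v; omega
  -- the survey
  have hXB : ∀ m < X ^ 4, m.size ≤ B := fun m hm => hB m (hm.trans_le (by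
    calc X ^ 4 = (X ^ 2) ^ 2 := by ring
      _ ≤ Y ^ 2 := Nat.pow_le_pow_left hXY 2
      _ ≤ _ := Nat.le_succ _))
  have c₁ := survey_computes I (fun t v => ω (v, t, 0)) he hid hX hXB
  -- the coins
  have c₂ := c₁.seq (Protocol.flipCoins_computes (fun y => (par y.2.1 y.2.2).j₂) N x
    (fun t v => ω (v, surveyTime I + t, 0)) B p.j₂ fun v => by rw [← hp])
  set x₂ : V → SampleKnowledge := fun v =>
    (x v, fun i => if i < p.j₂ then ω (v, surveyTime I + i, 0) else false) with hx₂
  have hpar : ∀ v, (x₂ v).params par = p := fun v => hp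
  have hsam : ∀ j ≤ p.j₂, ∀ v, (x₂ v).Sampled j ↔ v ∈ sample I ω (surveyTime I) j := by
    intro j hj v
    simp only [sample, Finset.mem_filter, Finset.mem_univ, true_and]
    refine or_congr Iff.rfl (forall₂_congr fun i hi => ?_)
    simp only [hx₂, if_pos (hi.trans_le hj)]
  have hxtag : ∀ v, (x₂ v).1.1.tag = nodeTag I v := fun v => rfl
  -- the floodings in the network
  have hini₁ : ∀ σ, (fun v => (networkFlood par (x₂ v)).init σ) = sourceKeys S (nodeTag I) := by
    intro σ; funext v l
    simp only [networkFlood, hpar, sourceKeys, hxtag, hsam p.j₁ hj]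
    rfl
  have hrule₁ : ∀ σ, (fun v u => (networkFlood par (x₂ v)).rule σ (N.ident u)) =
      fun v u => keepRule (scaledLength (p.q * p.h₁) σ (inputWeight I u v)) := by
    intro σ; funext v u
    simp only [networkFlood, hpar]
    congr 2
    exact congrArg edgeWeight (N.ident_injective.extend_apply (fun u => I.weight u v)
      (fun _ => none) u)
  obtain ⟨K, c₃, hK⟩ := Protocol.floods_computes (networkFlood par) N x₂
    (fun t v => ω (v, surveyTime I + p.j₂ + t, 0)) (B := B) (T := p.T₁) (k := p.scales + 1) hT₁pos
    (fun v => by simp only [networkFlood, hpar]) (fun v => by simp only [networkFlood, hpar])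
    (fun σ _ t ht v => hB _ (by
      rw [hini₁, hrule₁]
      refine announce_lt (fun v l κ hd => ?_) (ht.trans_le hT₁) v
      obtain ⟨z, -, rfl, -⟩ := (derivable_sources_iff fun u v h =>
        adj_of_inputWeight I u v (scaledLength_ne_top h)).1 hd
      exact (htag z).trans_le ((Nat.le_self_pow two_ne_zero X).trans hXY)))
  simp only [hini₁, hrule₁] at hK
  set x₃ : V → SampleKnowledge × (ℕ → ℕ → ℕ∞) := fun v => (x₂ v, K v) with hx₃
  set o : V → ℕ → ℕ∞ := fun v => networkEstimate par (x₃ v) with ho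
  have ho_eq : ∀ v, o v = estimate (p.q * p.h₁) p.scales 1 (K v) := fun v => by
    simp only [ho, networkEstimate, hx₃, hpar]
  -- the floodings in the overlay graph
  have hini₂ : ∀ σ, (fun v => (overlayFlood par (x₃ v)).init σ) =
      sourceKeys S' fun v => Nat.pair (nodeTag I v) (nodeTag I v) := by
    intro σ; funext v l
    simp only [overlayFlood, hx₃, hpar, sourceKeys, hxtag, hsam p.j₂ le_rfl]
    rfl
  have hrule₂ : ∀ σ, (fun v (u : V) => (overlayFlood par (x₃ v)).rule σ (N.ident u)) =
      fun v _ => overlayRule p.A (overlayLength (p.q * p.h₂) σ S o v) (nodeTag I v) := by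
    intro σ; funext v u
    simp only [overlayFlood, hpar, hxtag, hsam p.j₁ hj, hx₃]
    rfl
  obtain ⟨K', c₄, hK'⟩ := Protocol.floods_computes (overlayFlood par) N x₃
    (fun t v => ω (v, surveyTime I + p.j₂ + (p.scales + 1) * p.T₁ + t, 0)) (B := B) (T := p.T₂)
    (k := p.scales + 1) hT₂pos
    (fun v => by simp only [overlayFlood, hx₃, hpar])
    (fun v => by simp only [overlayFlood, hx₃, hpar])
    (fun σ _ t ht v => hB _ (by
      rw [hini₂, hrule₂]
      refine announce_lt (fun v l κ hd => ?_) (ht.trans_le hT₂) v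
      obtain ⟨z, -, y, -, rfl, -⟩ := exists_walk_of_derivable_overlay hApos hSS hd
      exact (pair_lt_sq (htag z) (htag y)).trans_le hXY))
  simp only [hini₂, hrule₂] at hK'
  set o' : V → ℕ → ℕ∞ := fun v => estimate (p.q * p.h₂) p.scales p.A (K' v) with ho'
  have hc := ((c₂.seq c₃).seq c₄).map (finalOutput par)
  have hy : ∀ v, finalOutput par (x₃ v, K' v) =
      hopDist (finalWeight (nodeTag I v) (o v) (o' v)) 0 (nodeTag I v) := by
    intro v
    simp only [finalOutput, hx₃, hpar, ho, ho', hxtag]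
  have hadj := adj_of_inputWeight I
  have hos : ∀ v l (x : ℕ), o v l = x → ∃ y ∈ S, nodeTag I y = l ∧
      ∃ k d, HopWalk (inputWeight I) k y v d ∧ d ≤ x := fun v l x h =>
    sources_sound hadj (Nat.mul_pos hq hh₁)
      (fun σ hσ => hK σ (Nat.lt_succ_of_le hσ) v) ((congrFun (ho_eq v) l).symm.trans h)
  have hos' : ∀ v l (e : ℕ), o' v l = e → ∃ z ∈ S', ∃ x ∈ S,
      l = Nat.pair (nodeTag I z) (nodeTag I x) ∧
      ∃ k d, HopWalk (overlayWeight S (nodeTag I) o) k z x d ∧ d ≤ e := fun v l e h =>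
    overlay_sound hApos hSS (Nat.mul_pos hq hh₂) (fun σ hσ => hK' σ (Nat.lt_succ_of_le hσ) v) h
  refine ⟨_, hc, fun v d hd => ?_, fun T hδ hit hit' hk hk' v hv => ?_⟩
  · rw [hy] at hd
    obtain ⟨d', hd'⟩ := exists_lt_top_of_iInf_lt_top (hd.trans_ne (ENat.natCast_ne_top d))
    have hd'' := hd'.trans hd
    obtain ⟨⟨k, p⟩, hkd⟩ := exists_lt_top_of_iInf_lt_top (hd''.trans_ne (ENat.natCast_ne_top d))
    obtain rfl : d' = d := by exact_mod_cast hkd.trans hd''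
    rw [← nodeTag_source I] at p
    exact exists_hopWalk_of_final hos hos' (nodeTag_injective I) p
  · obtain ⟨k, d, hd, hle⟩ := exists_final_walk (q := p.q) (J := p.scales) (tag := nodeTag I)
      (o := o) (o' := o') T hb hδ hq hit hit' hSS
      (fun y hyS v k d pw hk₁ hd => by
        rw [ho_eq]
        refine sources_complete hadj hq hh₁ (T := p.T₁) ?_
          (fun σ hσ => hK σ (Nat.lt_succ_of_le hσ) v) hyS pw hk₁ hd
        exact Nat.add_le_add_left hk _)
      (fun z hz x v k d pw hk₁ hd =>
        overlay_complete N.connected (nodeTag_injective I) hA hSS hq hh₂ (T := p.T₂)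
          (Nat.add_le_add_left (Nat.mul_le_mul hk' hk) _)
          (fun σ hσ => hK' σ (Nat.lt_succ_of_le hσ) v) hz pw hk₁ hd) hv
    have hle' : finalOutput par (x₃ v, K' v) ≤ d := by
      rw [hy, ← nodeTag_source I]; exact hopDist_le hd
    -- The output may be smaller than the walk just constructed; it is nevertheless finite and
    -- inherits the bound.
    obtain ⟨d', hd'⟩ := ENat.ne_top_iff_exists.1 (hle'.trans_lt (ENat.natCast_lt_top d)).ne
    refine ⟨d', hd'.symm, (Nat.mul_le_mul_left _ ?_).trans hle⟩
    rw [← hd'] at hle'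
    exact_mod_cast hle'

end Correctness

/-! ### Hitting probability and size of the random samples -/

section Probability

open MeasureTheory ProbabilityTheory

variable {V : Type u}

instance : IsProbabilityMeasure (coinMeasure V) := by unfold coinMeasure; infer_instance

/-- The event that `j` successive coins of `v`, beginning in round `t`, all show `true`. -/
def allTrue (t j : ℕ) (v : V) : Set (Coins V) := {ω | ∀ i < j, ω (v, t + i, 0) = true}

/-- This displays the event as a cylinder over pairwise distinct coins, so that the product measure
can be evaluated. -/
theorem biInter_allTrue (t j : ℕ) (A : Finset V) : ⋂ v ∈ A, allTrue t j v =
    Set.pi ((A ×ˢ Finset.range j).map ⟨fun p => (p.1, t + p.2, 0), fun p p' h => by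
      simp only [Prod.mk.injEq] at h; exact Prod.ext h.1 (by omega)⟩ : Finset (V × ℕ × ℕ))
      fun _ => {true} := by
  ext ω
  simp only [allTrue, Set.mem_iInter, Set.mem_ofPred_eq, Set.mem_pi, Finset.coe_map,
    Set.mem_image, Finset.coe_product, Set.mem_prod, Finset.mem_coe, Finset.mem_range,
    Set.mem_singleton_iff]
  constructor
  · rintro h _ ⟨p, ⟨hp, hi⟩, rfl⟩
    exact h _ hp _ hi
  · intro h v hv i hi
    exact h _ ⟨(v, i), ⟨hv, hi⟩, rfl⟩

theorem coinMeasure_biInter_allTrue (t j : ℕ) (A : Finset V) :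
    coinMeasure V (⋂ v ∈ A, allTrue t j v) = ((2 : ℝ≥0∞)⁻¹ ^ j) ^ A.card := by
  have h : (PMF.uniformOfFintype Bool).toMeasure {true} = (2 : ℝ≥0∞)⁻¹ := by
    rw [PMF.toMeasure_apply_singleton _ _ (MeasurableSet.singleton _)]
    simp
  rw [biInter_allTrue, coinMeasure, Measure.infinitePi_pi _ fun _ _ => MeasurableSet.singleton _,
    Finset.prod_congr rfl fun _ _ => h, Finset.prod_const, Finset.card_map, Finset.card_product,
    Finset.card_range, mul_comm, pow_mul]

theorem coinMeasure_allTrue (t j : ℕ) (v : V) :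
    coinMeasure V (allTrue t j v) = (2 : ℝ≥0∞)⁻¹ ^ j := by
  simpa using coinMeasure_biInter_allTrue t j {v}

theorem measurableSet_allTrue (t j : ℕ) (v : V) : MeasurableSet (allTrue t j v) := by
  have := biInter_allTrue t j {v}
  simp only [Finset.mem_singleton, Set.iInter_iInter_eq_left] at this
  rw [this]
  exact MeasurableSet.pi (Finset.countable_toSet _) fun _ _ => MeasurableSet.singleton _

theorem iIndepSet_allTrue (t j : ℕ) : iIndepSet (allTrue t j) (coinMeasure V) := by
  rw [iIndepSet_iff_meas_biInter (measurableSet_allTrue t j)]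
  intro A
  rw [coinMeasure_biInter_allTrue, Finset.prod_congr rfl fun v _ => coinMeasure_allTrue t j v,
    Finset.prod_const]

theorem real_biInter_compl_allTrue (t j : ℕ) (A : Finset V) :
    (coinMeasure V).real (⋂ v ∈ A, (allTrue t j v)ᶜ) = (1 - (2 : ℝ)⁻¹ ^ j) ^ A.card := by
  have h := (iIndepSet_iff _ _).1 (iIndepSet_allTrue (V := V) t j) A (f := fun v => (allTrue t j v)ᶜ)
    fun v _ => (MeasurableSpace.measurableSet_generateFrom (Set.mem_singleton _)).compl
  rw [measureReal_def, h, ENNReal.toReal_prod,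
    Finset.prod_congr rfl fun v _ => ?_, Finset.prod_const]
  change (coinMeasure V).real _ = _
  rw [probReal_compl_eq_one_sub (measurableSet_allTrue t j v), measureReal_def,
    coinMeasure_allTrue]
  simp

/-- With p = 2⁻ʲ, (1 − p)^(k/p) ≤ e⁻ᵏ ≤ 2⁻ᵏ. -/
theorem real_biInter_compl_allTrue_le (t j k : ℕ) {A : Finset V} (h : k * 2 ^ j ≤ A.card) :
    (coinMeasure V).real (⋂ v ∈ A, (allTrue t j v)ᶜ) ≤ (2 : ℝ)⁻¹ ^ k := by
  have h0 : (0 : ℝ) < (2 : ℝ)⁻¹ ^ j := by positivity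
  have h1 : (2 : ℝ)⁻¹ ^ j ≤ 1 := pow_le_one₀ (by norm_num) (by norm_num)
  have h2 : 1 - (2 : ℝ)⁻¹ ^ j ≤ Real.exp (-(2 : ℝ)⁻¹ ^ j) := by
    have := Real.add_one_le_exp (-(2 : ℝ)⁻¹ ^ j); linarith
  have h3 : Real.exp (-1) ≤ 2⁻¹ := by
    rw [Real.exp_neg]
    exact inv_anti₀ (by norm_num) (by have := Real.add_one_le_exp (1 : ℝ); linarith)
  rw [real_biInter_compl_allTrue]
  calc (1 - (2 : ℝ)⁻¹ ^ j) ^ A.card ≤ (1 - (2 : ℝ)⁻¹ ^ j) ^ (k * 2 ^ j) :=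
        pow_le_pow_of_le_one (by linarith) (by linarith) h
    _ ≤ Real.exp (-(2 : ℝ)⁻¹ ^ j) ^ (k * 2 ^ j) := pow_le_pow_left₀ (by linarith) h2 _
    _ = Real.exp (-1) ^ k := by
        rw [← Real.exp_nat_mul, ← Real.exp_nat_mul]
        congr 1
        push_cast
        have : (2 : ℝ) ^ j * (2 : ℝ)⁻¹ ^ j = 1 := by rw [← mul_pow]; norm_num
        linear_combination (-(k : ℝ)) * this
    _ ≤ (2 : ℝ)⁻¹ ^ k := pow_le_pow_left₀ (Real.exp_pos _).le h3 _

variable [Fintype V] {N : Network V} (I : SSSPInstance N)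

/-- The bound on the number of nodes sampled at a level with parameter `j`. -/
def sampleBound (n lam j : ℕ) : ℕ := min n (6 * (n / 2 ^ j + 1) + lam) + 1

/-- The binomial coefficient is at most nᵏ/k!, and n · 2⁻ʲ ≤ k/6. Since kᵏ/k! ≤ eᵏ ≤ 3ᵏ, the product
is at most (3/6)ᵏ. -/
theorem choose_mul_le {n j lam k : ℕ} (hk : k = 6 * (n / 2 ^ j + 1) + lam) :
    (n.choose k : ℝ) * ((2 : ℝ)⁻¹ ^ j) ^ k ≤ (2 : ℝ)⁻¹ ^ lam := by
  have hy : (n : ℝ) * (2 : ℝ)⁻¹ ^ j ≤ k / 6 := by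
    have h1 : n < 2 ^ j * (n / 2 ^ j + 1) := Nat.lt_mul_div_succ n (by positivity)
    have h2 : (n : ℝ) ≤ 2 ^ j * ((n / 2 ^ j : ℕ) + 1) := by exact_mod_cast h1.le
    have h3 : (n : ℝ) * (2 : ℝ)⁻¹ ^ j ≤ (n / 2 ^ j : ℕ) + 1 := by
      rw [inv_pow, ← div_eq_mul_inv, div_le_iff₀ (by positivity)]
      linarith
    have h4 : (k : ℝ) = 6 * ((n / 2 ^ j : ℕ) + 1) + lam := by rw [hk]; push_cast; ring
    have : (0 : ℝ) ≤ lam := by positivity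
    linarith
  have he : Real.exp 1 ≤ 3 := by have := Real.exp_one_lt_d9; linarith
  have hfac : (k : ℝ) ^ k / k.factorial ≤ 3 ^ k := by
    refine (Real.pow_div_factorial_le_exp (k : ℝ) (by positivity) k).trans ?_
    have : Real.exp k = Real.exp 1 ^ k := by rw [← Real.exp_nat_mul, mul_one]
    rw [this]
    exact pow_le_pow_left₀ (Real.exp_pos _).le he k
  calc (n.choose k : ℝ) * ((2 : ℝ)⁻¹ ^ j) ^ k
      ≤ (n : ℝ) ^ k / k.factorial * ((2 : ℝ)⁻¹ ^ j) ^ k := by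
        gcongr; exact Nat.choose_le_pow_div k n
    _ = (n * (2 : ℝ)⁻¹ ^ j) ^ k / k.factorial := by rw [mul_pow]; ring
    _ ≤ (k / 6 : ℝ) ^ k / k.factorial := by gcongr
    _ = (k : ℝ) ^ k / k.factorial / 6 ^ k := by rw [div_pow]; ring
    _ ≤ 3 ^ k / 6 ^ k := by gcongr
    _ = (2 : ℝ)⁻¹ ^ k := by rw [← div_pow]; norm_num
    _ ≤ (2 : ℝ)⁻¹ ^ lam := pow_le_pow_of_le_one (by norm_num) (by norm_num) (by omega)

theorem mem_sample_iff {ω : Coins V} {t j : ℕ} {v : V} :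
    v ∈ sample I ω t j ↔ v = I.source ∨ ω ∈ allTrue t j v := by
  simp only [sample, Finset.mem_filter, Finset.mem_univ, true_and]
  rfl

theorem sample_card_le (ω : Coins V) (t j : ℕ) [DecidablePred fun v => ω ∈ allTrue t j v] :
    (sample I ω t j).card ≤ (Finset.univ.filter fun v => ω ∈ allTrue t j v).card + 1 := by
  classical
  refine le_trans (Finset.card_le_card fun v hv => ?_) (Finset.card_insert_le I.source _)
  simpa only [Finset.mem_insert, Finset.mem_filter, Finset.mem_univ, true_and] using
    (mem_sample_iff I).1 hv

/-- Too large a sample contains `k` nodes, besides possibly the source, whose coins all succeeded;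
sum over all sets of `k` nodes. If `k` is at least the number of nodes, the event is empty. The
source accounts for the final `+ 1` in `sampleBound`. -/
theorem real_sampleBound_lt_le (t j lam : ℕ) :
    (coinMeasure V).real {ω | sampleBound (Fintype.card V) lam j < (sample I ω t j).card} ≤
      (2 : ℝ)⁻¹ ^ lam := by
  classical
  set k := 6 * (Fintype.card V / 2 ^ j + 1) + lam with hk
  rcases le_or_gt (Fintype.card V) k with h | h
  · have : {ω | sampleBound (Fintype.card V) lam j < (sample I ω t j).card} = ∅ := by
      ext ω
      have := (sample I ω t j).card_le_univ
      simp only [sampleBound, ← hk, min_eq_left h, Set.mem_ofPred_eq, Set.mem_empty_iff_false,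
        iff_false]
      omega
    rw [this]
    simp only [measureReal_empty]
    positivity
  · have hsub : {ω | sampleBound (Fintype.card V) lam j < (sample I ω t j).card} ⊆
        ⋃ A ∈ Finset.powersetCard k (Finset.univ : Finset V), ⋂ v ∈ A, allTrue t j v := by
      intro ω hω
      simp only [sampleBound, ← hk, min_eq_right h.le, Set.mem_ofPred_eq] at hω
      have := sample_card_le I ω t j
      obtain ⟨A, hA, hAk⟩ := Finset.exists_subset_card_eq
        (show k ≤ (Finset.univ.filter fun v => ω ∈ allTrue t j v).card by omega)
      simp only [Set.mem_iUnion, Set.mem_iInter]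
      exact ⟨A, Finset.mem_powersetCard.2 ⟨Finset.subset_univ A, hAk⟩,
        fun v hv => (Finset.mem_filter.1 (hA hv)).2⟩
    calc _ ≤ _ := measureReal_mono hsub (measure_ne_top _ _)
      _ ≤ ∑ A ∈ Finset.powersetCard k (Finset.univ : Finset V),
            (coinMeasure V).real (⋂ v ∈ A, allTrue t j v) := measureReal_biUnion_finset_le _ _
      _ = ∑ A ∈ Finset.powersetCard k (Finset.univ : Finset V), ((2 : ℝ)⁻¹ ^ j) ^ k := by
          refine Finset.sum_congr rfl fun A hA => ?_
          rw [measureReal_def, coinMeasure_biInter_allTrue, (Finset.mem_powersetCard.1 hA).2]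
          simp
      _ = ((Fintype.card V).choose k : ℝ) * ((2 : ℝ)⁻¹ ^ j) ^ k := by
          rw [Finset.sum_const, Finset.card_powersetCard, Finset.card_univ, nsmul_eq_mul]
      _ ≤ _ := choose_mul_le hk

/-- The tree is independent of the coins, so a union bound over the lower end of the stretch
suffices. A capped value of `b` is harmless: no tree path has as many edges as there are nodes. -/
theorem real_not_hits_le {w : V → V → ℕ∞} (T : PathTree w I.source) (t j lam : ℕ) :
    (coinMeasure V).real {ω | ¬ T.Hits (sample I ω t j) (min (Fintype.card V) (lam * 2 ^ j))} ≤
      Fintype.card V * (2 : ℝ)⁻¹ ^ lam := by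
  classical
  set b := min (Fintype.card V) (lam * 2 ^ j) with hb
  have hsub : {ω | ¬ T.Hits (sample I ω t j) b} ⊆
      ⋃ v ∈ Finset.univ.filter fun v => Reaches w I.source v ∧ b ≤ T.hop v,
        ⋂ u ∈ (Finset.range b).image fun i => T.pred^[i] v, (allTrue t j u)ᶜ := by
    intro ω hω
    by_contra hc
    refine hω (T.hits_of_forall (source_mem_sample I ω t j) fun v hv hbv => ?_)
    by_contra! hno
    refine hc ?_
    simp only [Set.mem_iUnion, Set.mem_iInter]
    refine ⟨v, by simp [hv, hbv], fun u hu hut => ?_⟩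
    obtain ⟨i, hi, rfl⟩ := Finset.mem_image.1 hu
    exact hno i (Finset.mem_range.1 hi) ((mem_sample_iff I).2 (.inr hut))
  calc _ ≤ _ := measureReal_mono hsub (measure_ne_top _ _)
    _ ≤ ∑ v with Reaches w I.source v ∧ b ≤ T.hop v, (coinMeasure V).real
        (⋂ u ∈ (Finset.range b).image fun i => T.pred^[i] v, (allTrue t j u)ᶜ) :=
        measureReal_biUnion_finset_le _ _
    _ ≤ ∑ v with Reaches w I.source v ∧ b ≤ T.hop v, (2 : ℝ)⁻¹ ^ lam := by
        refine Finset.sum_le_sum fun v hv => real_biInter_compl_allTrue_le t j lam ?_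
        obtain ⟨hr, hbv⟩ := (Finset.mem_filter.1 hv).2
        have hlt := T.hop_lt_card hr
        rw [Finset.card_image_of_injOn, Finset.card_range]
        · omega
        · intro i hi i' hi' h
          have hi : i < b := by simpa using hi
          have hi' : i' < b := by simpa using hi'
          have h1 := (T.iterate hr (i := i) (by omega)).2.1
          have h2 := (T.iterate hr (i := i') (by omega)).2.1
          simp only at h
          rw [h] at h1
          omega
    _ ≤ _ := by
        rw [Finset.sum_const, nsmul_eq_mul]
        gcongr
        exact Finset.card_le_univ _

end Probability

/-! ### Choice of parameters and the resulting numbers of rounds -/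

section ParameterChoice

/-- The factor by which expected numbers are exceeded to obtain high probability. -/
def slack (c n : ℕ) : ℕ := (c + 5) * (Nat.log 2 n + 1)

/-- The parameter of the sampling probability at the first level. -/
def level₁ (e n : ℕ) : ℕ := Nat.log 2 (Nat.sqrt (n * Nat.sqrt e))

/-- The parameter of the sampling probability at the second level. -/
def level₂ (e n : ℕ) : ℕ := max (level₁ e n) (Nat.log 2 (n / Nat.sqrt e))

/-- The parameters of the algorithm on a network of `n` nodes, in which the source has
eccentricity `e`. -/
noncomputable def chosenParams (a c : ℕ) (ε : ℝ) (e n : ℕ) : Params where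
  q := min ⌈3 / ε⌉₊ (3 * n ^ (a + 1))
  scales := Nat.log 2 (2 * n ^ (a + 1)) + 1
  b := min n (slack c n * 2 ^ level₁ e n)
  H := min n (slack c n * 2 ^ level₂ e n)
  j₁ := level₁ e n
  j₂ := level₂ e n
  k₁ := sampleBound n (slack c n) (level₁ e n)
  k₂ := sampleBound n (slack c n) (level₂ e n)
  A := 2 * e + 1

variable {e n : ℕ}

theorem one_le_slack (c n : ℕ) : 1 ≤ slack c n := Nat.mul_pos (by omega) (by omega)

theorem lt_two_pow_log (n : ℕ) : n < 2 ^ (Nat.log 2 n + 1) := Nat.lt_pow_succ_log_self (by norm_num) n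

/-- The left side bounds the total probability of two missed hitting sets and two oversized samples;
the 5 in `slack` absorbs the factor 4n. -/
theorem two_inv_pow_slack_le (hn : 2 ≤ n) (c : ℕ) :
    4 * n * (2 : ℝ)⁻¹ ^ slack c n ≤ 1 / (n : ℝ) ^ c := by
  have hn' : (2 : ℝ) ≤ n := by exact_mod_cast hn
  have h1 : (2 : ℝ)⁻¹ ^ slack c n ≤ (n : ℝ)⁻¹ ^ (c + 5) := by
    rw [slack, mul_comm, pow_mul, inv_pow 2]
    refine pow_le_pow_left₀ (by positivity) (inv_anti₀ (by linarith) ?_) _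
    exact_mod_cast (lt_two_pow_log n).le
  have h2 : 4 * (n : ℝ) ≤ (n : ℝ) ^ 5 := by
    have : (2 : ℝ) ^ 4 ≤ (n : ℝ) ^ 4 := pow_le_pow_left₀ (by norm_num) hn' 4
    nlinarith
  calc 4 * n * (2 : ℝ)⁻¹ ^ slack c n ≤ (n : ℝ) ^ 5 * (n : ℝ)⁻¹ ^ (c + 5) := by gcongr
    _ = 1 / (n : ℝ) ^ c := by
        rw [pow_add, inv_pow, inv_pow]
        field_simp

theorem log_le_three_mul (hn : 2 ≤ n) : ((Nat.log 2 n + 1 : ℕ) : ℝ) ≤ 3 * Real.log n := by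
  have hn' : (0 : ℝ) < n := by exact_mod_cast (by omega : 0 < n)
  have h1 : 1 ≤ Nat.log 2 n := Nat.log_pos (by norm_num) hn
  have h2 : (2 : ℝ) ^ Nat.log 2 n ≤ n := by exact_mod_cast Nat.pow_log_le_self 2 (by omega)
  have h3 : Nat.log 2 n * Real.log 2 ≤ Real.log n := by
    rw [← Real.log_pow]; exact Real.log_le_log (by positivity) h2
  have h4 := Real.log_two_gt_d9
  have h5 : (1 : ℝ) ≤ Nat.log 2 n := by exact_mod_cast h1
  push_cast
  nlinarith

theorem size_le_mul_log {k m : ℕ} (hn : 2 ≤ n) (h : m < n ^ k) : m.size ≤ 2 * k * Nat.log 2 n := by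
  have h1 : 1 ≤ Nat.log 2 n := Nat.log_pos (by norm_num) hn
  refine (Nat.size_le.2 ?_ : m.size ≤ (Nat.log 2 n + 1) * k).trans ?_
  · rw [pow_mul]
    exact h.trans_le (Nat.pow_le_pow_left (lt_two_pow_log n).le k)
  · calc (Nat.log 2 n + 1) * k ≤ (2 * Nat.log 2 n) * k := Nat.mul_le_mul_right k (by omega)
      _ = 2 * k * Nat.log 2 n := by ring

/-- The main term of the number of rounds. -/
noncomputable def mainTerm (e n : ℕ) : ℝ := √n * (e : ℝ) ^ (1 / 4 : ℝ)

/-- Squaring removes the fourth root and permits comparison with the integer square roots that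
define the levels. -/
theorem mainTerm_sq (e n : ℕ) : mainTerm e n ^ 2 = n * √e := by
  rw [mainTerm, mul_pow, Real.sq_sqrt (Nat.cast_nonneg n), ← Real.rpow_natCast, ← Real.rpow_mul
    (Nat.cast_nonneg e), Real.sqrt_eq_rpow]
  norm_num

theorem mainTerm_nonneg (e n : ℕ) : 0 ≤ mainTerm e n := by unfold mainTerm; positivity

theorem one_le_natSqrt (he : 1 ≤ e) : 1 ≤ Nat.sqrt e := Nat.sqrt_pos.2 he

theorem natSqrt_le_sqrt : (Nat.sqrt e : ℝ) ≤ √e := Real.nat_sqrt_le_real_sqrt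

theorem sqrt_le_two_mul_natSqrt (he : 1 ≤ e) : √e ≤ 2 * Nat.sqrt e := by
  have h1 : (1 : ℝ) ≤ Nat.sqrt e := by exact_mod_cast one_le_natSqrt he
  have := Real.real_sqrt_le_nat_sqrt_succ (a := e)
  linarith

theorem le_mainTerm_sq (he : 1 ≤ e) : (n : ℝ) ≤ mainTerm e n ^ 2 := by
  rw [mainTerm_sq]
  have : 1 ≤ √(e : ℝ) := Real.one_le_sqrt.2 (by exact_mod_cast he)
  nlinarith [(Nat.cast_nonneg n : (0 : ℝ) ≤ n)]

theorem one_le_mainTerm (he : 1 ≤ e) (hn : 2 ≤ n) : 1 ≤ mainTerm e n := by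
  have h1 := le_mainTerm_sq (n := n) he
  have h2 : (2 : ℝ) ≤ n := by exact_mod_cast hn
  have h3 := mainTerm_nonneg e n
  nlinarith

theorem sqrt_mul_pos (he : 1 ≤ e) (hn : 2 ≤ n) : 0 < Nat.sqrt (n * Nat.sqrt e) :=
  Nat.sqrt_pos.2 (Nat.mul_pos (by omega) (one_le_natSqrt he))

theorem two_pow_level₁_le (he : 1 ≤ e) (hn : 2 ≤ n) : (2 : ℝ) ^ level₁ e n ≤ mainTerm e n := by
  have h1 : 2 ^ level₁ e n ≤ Nat.sqrt (n * Nat.sqrt e) :=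
    Nat.pow_log_le_self 2 (sqrt_mul_pos he hn).ne'
  have h2 : (2 ^ level₁ e n) ^ 2 ≤ n * Nat.sqrt e :=
    (Nat.pow_le_pow_left h1 2).trans (Nat.sqrt_le' _)
  have h3 : ((2 : ℝ) ^ level₁ e n) ^ 2 ≤ n * Nat.sqrt e := by exact_mod_cast h2
  refine le_of_sq_le_sq ?_ (mainTerm_nonneg e n)
  rw [mainTerm_sq]
  exact h3.trans (mul_le_mul_of_nonneg_left (natSqrt_le_sqrt) (Nat.cast_nonneg n))

/-- The logarithm costs a factor 2, squared to 4, and the inner integer root costs another 2; √8 is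
at most 3. Together with `two_pow_level₁_le`, the first sampling rate is 1/G up to a constant. -/
theorem mainTerm_le (he : 1 ≤ e) : mainTerm e n ≤ 3 * 2 ^ level₁ e n := by
  have h1 : Nat.sqrt (n * Nat.sqrt e) < 2 ^ (level₁ e n + 1) := lt_two_pow_log _
  have h2 : n * Nat.sqrt e < (2 ^ (level₁ e n + 1)) ^ 2 :=
    (Nat.lt_succ_sqrt' _).trans_le (Nat.pow_le_pow_left h1 2)
  have h3 : (n : ℝ) * Nat.sqrt e ≤ (2 ^ (level₁ e n + 1)) ^ 2 := by exact_mod_cast h2.le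
  refine le_of_sq_le_sq ?_ (by positivity)
  rw [mainTerm_sq]
  have h4 := mul_le_mul_of_nonneg_left (sqrt_le_two_mul_natSqrt he) (Nat.cast_nonneg n : (0 : ℝ) ≤ n)
  rw [pow_succ (2 : ℝ), mul_pow] at h3
  nlinarith [sq_nonneg ((2 : ℝ) ^ level₁ e n)]

theorem div_two_pow_level₁_le (he : 1 ≤ e) : n / (2 : ℝ) ^ level₁ e n ≤ 3 * mainTerm e n := by
  rw [div_le_iff₀ (by positivity)]
  nlinarith [le_mainTerm_sq (n := n) he, mainTerm_le (n := n) he, mainTerm_nonneg e n]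

theorem sqrt_mul_div_le (he : 1 ≤ e) : √e * (n / (2 : ℝ) ^ level₁ e n) ≤ 3 * mainTerm e n := by
  rw [mul_div_assoc', div_le_iff₀ (by positivity), mul_comm, ← mainTerm_sq]
  nlinarith [mainTerm_le (n := n) he, mainTerm_nonneg e n]

theorem div_natSqrt_pos (he : 1 ≤ e) (hen : e ≤ n) : 0 < n / Nat.sqrt e :=
  Nat.div_pos ((Nat.sqrt_le_self e).trans hen) (one_le_natSqrt he)

/-- The second component of the maximum in `level₂` ensures an expected second sample of order √e.
-/
theorem div_two_pow_level₂_le (he : 1 ≤ e) : n / (2 : ℝ) ^ level₂ e n ≤ 2 * √e := by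
  have h0 := one_le_natSqrt he
  have h1 : n / Nat.sqrt e < 2 ^ (Nat.log 2 (n / Nat.sqrt e) + 1) := lt_two_pow_log _
  have h2 : 2 ^ (Nat.log 2 (n / Nat.sqrt e) + 1) ≤ 2 ^ (level₂ e n + 1) :=
    Nat.pow_le_pow_right (by norm_num) (Nat.succ_le_succ (le_max_right _ _))
  have h3 : n < 2 ^ (level₂ e n + 1) * Nat.sqrt e := by
    rw [← Nat.div_lt_iff_lt_mul h0]; exact h1.trans_le h2
  have h4 : (n : ℝ) ≤ 2 ^ (level₂ e n + 1) * Nat.sqrt e := by exact_mod_cast h3.le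
  rw [div_le_iff₀ (by positivity)]
  rw [pow_succ] at h4
  have := natSqrt_le_sqrt (e := e)
  have h5 : (0 : ℝ) < 2 ^ level₂ e n := by positivity
  nlinarith

/-- This is the latency of crossing the network once per overlay hop. If the levels coincide, the
ratio is 1 and the cost is e. Otherwise it is at most about e · (n/√e)/G, which is of order G. -/
theorem mul_two_pow_level₂_le (he : 1 ≤ e) (hen : e ≤ n) :
    e * ((2 : ℝ) ^ level₂ e n / 2 ^ level₁ e n) ≤ e + 6 * mainTerm e n := by
  have h0 : (1 : ℝ) ≤ Nat.sqrt e := by exact_mod_cast one_le_natSqrt he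
  have hP : (0 : ℝ) < 2 ^ level₁ e n := by positivity
  have hG := mainTerm_nonneg e n
  rcases max_choice (level₁ e n) (Nat.log 2 (n / Nat.sqrt e)) with h | h
  · rw [level₂, h, div_self hP.ne']; linarith
  · rw [level₂, h]
    have h1 : 2 ^ Nat.log 2 (n / Nat.sqrt e) * Nat.sqrt e ≤ n :=
      (Nat.mul_le_mul_right _ (Nat.pow_log_le_self 2 (div_natSqrt_pos he hen).ne')).trans
        (Nat.div_mul_le_self _ _)
    have h2 : (2 : ℝ) ^ Nat.log 2 (n / Nat.sqrt e) * Nat.sqrt e ≤ n := by exact_mod_cast h1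
    have h3 := sqrt_mul_div_le (n := n) he
    have h4 := sqrt_le_two_mul_natSqrt he
    have h5 : (e : ℝ) = √e * √e := (Real.mul_self_sqrt (Nat.cast_nonneg e)).symm
    have h6 : (e : ℝ) * 2 ^ Nat.log 2 (n / Nat.sqrt e) ≤ 2 * (√e * n) := by
      have hs := Real.sqrt_nonneg (e : ℝ)
      have hp : (0 : ℝ) < 2 ^ Nat.log 2 (n / Nat.sqrt e) := by positivity
      calc (e : ℝ) * 2 ^ Nat.log 2 (n / Nat.sqrt e)
          = √e * (√e * 2 ^ Nat.log 2 (n / Nat.sqrt e)) := by rw [← mul_assoc, ← h5]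
        _ ≤ √e * (2 * Nat.sqrt e * 2 ^ Nat.log 2 (n / Nat.sqrt e)) := by gcongr
        _ ≤ √e * (2 * n) := mul_le_mul_of_nonneg_left (by linarith) hs
        _ = 2 * (√e * n) := by ring
    rw [mul_div_assoc', div_le_iff₀ hP]
    rw [mul_div_assoc', div_le_iff₀ hP] at h3
    nlinarith [(Nat.cast_nonneg e : (0 : ℝ) ≤ e)]

theorem level₂_le (hen : e ≤ n) : level₂ e n ≤ Nat.log 2 n := by
  refine max_le (Nat.log_mono_right ?_) (Nat.log_mono_right (Nat.div_le_self _ _))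
  refine (Nat.sqrt_le_sqrt (Nat.mul_le_mul_left n ((Nat.sqrt_le_self e).trans hen))).trans ?_
  rw [Nat.sqrt_eq]

theorem sampleBound_le (lam j : ℕ) :
    (sampleBound n lam j : ℝ) ≤ 6 * (n / (2 : ℝ) ^ j) + lam + 7 := by
  have h1 : sampleBound n lam j ≤ 6 * (n / 2 ^ j + 1) + lam + 1 :=
    Nat.succ_le_succ (min_le_right _ _)
  have h2 : ((n / 2 ^ j : ℕ) : ℝ) ≤ n / (2 : ℝ) ^ j := by
    have := Nat.cast_div_le (α := ℝ) (m := n) (n := 2 ^ j)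
    push_cast at this
    exact this
  have h3 : (sampleBound n lam j : ℝ) ≤ 6 * ((n / 2 ^ j : ℕ) + 1) + lam + 1 := by exact_mod_cast h1
  linarith

/-! ### Lengths of the two kinds of flooding -/

section Rounds

variable (a c : ℕ) (ε : ℝ)

theorem chosenParams_T₁_le (he : 1 ≤ e) (hn : 2 ≤ n) (hq : 0 < (chosenParams a c ε e n).q) :
    ((chosenParams a c ε e n).T₁ : ℝ) ≤
      32 * (chosenParams a c ε e n).q * slack c n * mainTerm e n := by
  set q := (chosenParams a c ε e n).q with hqdef
  have h1 : (chosenParams a c ε e n).T₁ ≤ (2 * q + 1) * (2 * (slack c n * 2 ^ level₁ e n)) +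
      sampleBound n (slack c n) (level₁ e n) :=
    Nat.add_le_add_right (Nat.mul_le_mul_left _ (Nat.mul_le_mul_left _ (min_le_right _ _))) _
  have h2 : ((chosenParams a c ε e n).T₁ : ℝ) ≤
      (2 * q + 1) * (2 * (slack c n * 2 ^ level₁ e n)) +
      sampleBound n (slack c n) (level₁ e n) := by exact_mod_cast h1
  have h3 := sampleBound_le (n := n) (slack c n) (level₁ e n)
  have h4 := div_two_pow_level₁_le (n := n) he
  have h5 := one_le_mainTerm he hn
  have h6 : (1 : ℝ) ≤ slack c n := by exact_mod_cast one_le_slack c n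
  have h7 : (1 : ℝ) ≤ q := by exact_mod_cast hq
  have h8 := two_pow_level₁_le he hn
  set G := mainTerm e n
  set L : ℝ := ((slack c n : ℕ) : ℝ)
  have hLG : 1 ≤ L * G := one_le_mul_of_one_le_of_one_le h6 h5
  have hLGG : G ≤ L * G := le_mul_of_one_le_left (by linarith) h6
  have hLGL : L ≤ L * G := le_mul_of_one_le_right (by linarith) h5
  have hq' : L * G ≤ q * (L * G) := le_mul_of_one_le_left (by linarith) h7
  have h9 : (2 * (q : ℝ) + 1) * (2 * (L * 2 ^ level₁ e n)) ≤ (3 * q) * (2 * (L * G)) := by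
    gcongr; linarith
  have h10 : (32 : ℝ) * q * L * G = 32 * (q * (L * G)) := by ring
  rw [h10]
  linarith

/-- The slack cancels between `H` and `b`. If `b` is capped at `n`, then `H ≤ b` and the quotient is
at most 1. -/
theorem chosenParams_h₂_le (hn : 2 ≤ n) :
    ((chosenParams a c ε e n).h₂ : ℝ) ≤ 2 * ((2 : ℝ) ^ level₂ e n / 2 ^ level₁ e n) := by
  have hP₁ : (0 : ℝ) < 2 ^ level₁ e n := by positivity
  have h1 : (2 : ℝ) ^ level₁ e n ≤ 2 ^ level₂ e n :=
    pow_le_pow_right₀ (by norm_num) (le_max_left _ _)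
  have h2 : 1 ≤ (2 : ℝ) ^ level₂ e n / 2 ^ level₁ e n := (one_le_div hP₁).2 h1
  have hs : (0 : ℝ) < slack c n := by exact_mod_cast one_le_slack c n
  have hb : (0 : ℝ) < (chosenParams a c ε e n).b := by
    have : 0 < (chosenParams a c ε e n).b :=
      lt_min (by omega) (Nat.mul_pos (one_le_slack c n) (by positivity))
    exact_mod_cast this
  have h3 : (((chosenParams a c ε e n).H / (chosenParams a c ε e n).b : ℕ) : ℝ) ≤
      (2 : ℝ) ^ level₂ e n / 2 ^ level₁ e n := by
    refine Nat.cast_div_le.trans ?_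
    rw [div_le_iff₀ hb]
    have hH₁ : ((chosenParams a c ε e n).H : ℝ) ≤ n := by
      exact_mod_cast (min_le_left _ _ : (chosenParams a c ε e n).H ≤ n)
    have hH₂ : ((chosenParams a c ε e n).H : ℝ) ≤ slack c n * 2 ^ level₂ e n := by
      exact_mod_cast (min_le_right _ _ : (chosenParams a c ε e n).H ≤ slack c n * 2 ^ level₂ e n)
    rcases min_choice n (slack c n * 2 ^ level₁ e n) with h | h
    · have hbn : ((chosenParams a c ε e n).b : ℝ) = n := by exact_mod_cast h
      rw [hbn] at hb ⊢
      nlinarith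
    · have hbn : ((chosenParams a c ε e n).b : ℝ) = slack c n * 2 ^ level₁ e n := by
        exact_mod_cast h
      rw [hbn]
      refine hH₂.trans (le_of_eq ?_)
      field_simp
  rw [Params.h₂]
  push_cast
  linarith

theorem chosenParams_T₂_le (he : 1 ≤ e) (hn : 2 ≤ n) (hen : e ≤ n)
    (hq : 0 < (chosenParams a c ε e n).q) :
    ((chosenParams a c ε e n).T₂ : ℝ) ≤
      736 * (chosenParams a c ε e n).q * (slack c n) ^ 2 * (mainTerm e n + e) := by
  set q := (chosenParams a c ε e n).q with hqdef
  have hT : ((chosenParams a c ε e n).T₂ : ℝ) =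
      (2 * e + 1) * ((2 * q + 1) * (chosenParams a c ε e n).h₂ + 1) +
      sampleBound n (slack c n) (level₂ e n) * sampleBound n (slack c n) (level₁ e n) := by
    have hA : ((chosenParams a c ε e n).A : ℝ) = 2 * e + 1 := by
      exact_mod_cast (rfl : (chosenParams a c ε e n).A = 2 * e + 1)
    rw [hqdef, Params.T₂]
    push_cast
    rw [hA]
    rfl
  have hh := chosenParams_h₂_le (e := e) a c ε hn
  have hh1 : (1 : ℝ) ≤ (chosenParams a c ε e n).h₂ := by
    exact_mod_cast (Nat.succ_pos _ : 0 < (chosenParams a c ε e n).h₂)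
  have hk₁ := sampleBound_le (n := n) (slack c n) (level₁ e n)
  have hk₂ := sampleBound_le (n := n) (slack c n) (level₂ e n)
  have hy₁ := div_two_pow_level₁_le (n := n) he
  have hy₂ := div_two_pow_level₂_le (n := n) he
  have hyy := sqrt_mul_div_le (n := n) he
  have hPP := mul_two_pow_level₂_le he hen
  have hP : n / (2 : ℝ) ^ level₂ e n ≤ n / (2 : ℝ) ^ level₁ e n :=
    div_le_div_of_nonneg_left (Nat.cast_nonneg n) (by positivity)
      (pow_le_pow_right₀ (by norm_num) (le_max_left _ _))
  have hG := one_le_mainTerm he hn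
  have hL : (1 : ℝ) ≤ slack c n := by exact_mod_cast one_le_slack c n
  have hq1 : (1 : ℝ) ≤ q := by exact_mod_cast hq
  have he1 : (1 : ℝ) ≤ e := by exact_mod_cast he
  have hy₁0 : 0 ≤ n / (2 : ℝ) ^ level₁ e n := by positivity
  have hy₂0 : 0 ≤ n / (2 : ℝ) ^ level₂ e n := by positivity
  have hk₂0 : (0 : ℝ) ≤ sampleBound n (slack c n) (level₁ e n) := Nat.cast_nonneg _
  set G := mainTerm e n
  set L : ℝ := ((slack c n : ℕ) : ℝ)
  set y₁ := n / (2 : ℝ) ^ level₁ e n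
  set y₂ := n / (2 : ℝ) ^ level₂ e n
  set h : ℝ := (((chosenParams a c ε e n).h₂ : ℕ) : ℝ)
  have hLL : L ≤ L ^ 2 := by nlinarith
  have hLG : G ≤ L ^ 2 * G := le_mul_of_one_le_left (by linarith) (by nlinarith)
  -- the overlay hops
  have t₁ : (2 * e + 1 : ℝ) * ((2 * q + 1) * h + 1) ≤ 24 * q * (e + 6 * G) := by
    have s₁ : (2 * q + 1 : ℝ) * h + 1 ≤ 4 * q * h := by nlinarith
    have s₂ : (e : ℝ) * h ≤ 2 * (e + 6 * G) := by nlinarith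
    calc (2 * e + 1 : ℝ) * ((2 * q + 1) * h + 1) ≤ (3 * e) * (4 * q * h) := by
          gcongr; linarith
      _ = 12 * q * (e * h) := by ring
      _ ≤ 12 * q * (2 * (e + 6 * G)) := by gcongr
      _ = _ := by ring
  -- the pairs of sampled nodes
  have t₂ : (sampleBound n (slack c n) (level₂ e n) : ℝ) *
      sampleBound n (slack c n) (level₁ e n) ≤ 568 * (L ^ 2 * G) := by
    -- The two expected sample sizes are about √e and n/G, whose product is again of order G: this
    -- balances sending all pairs against the overlay latency.
    have s₀ : y₂ * y₁ ≤ 6 * G := by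
      calc y₂ * y₁ ≤ (2 * √e) * y₁ := by gcongr
        _ = 2 * (√e * y₁) := by ring
        _ ≤ 6 * G := by linarith
    have s₁ : y₁ ≤ 3 * G := hy₁
    have s₂ : y₂ ≤ 3 * G := hP.trans hy₁
    have s₃ : L + 7 ≤ 8 * L := by linarith
    have s₄ : L * G ≤ L ^ 2 * G := by gcongr
    calc (sampleBound n (slack c n) (level₂ e n) : ℝ) * sampleBound n (slack c n) (level₁ e n)
        ≤ (6 * y₂ + 8 * L) * (6 * y₁ + 8 * L) := by gcongr <;> linarith
      _ = 36 * (y₂ * y₁) + 48 * (L * y₁) + 48 * (L * y₂) + 64 * L ^ 2 := by ring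
      _ ≤ 36 * (6 * G) + 48 * (L * (3 * G)) + 48 * (L * (3 * G)) + 64 * (L ^ 2 * G) := by
          gcongr
          exact le_mul_of_one_le_right (by positivity) hG
      _ ≤ 568 * (L ^ 2 * G) := by nlinarith
  have hqG : L ^ 2 * G ≤ q * (L ^ 2 * G) := le_mul_of_one_le_left (by positivity) hq1
  have hGq : q * G ≤ q * (L ^ 2 * G) := by gcongr
  have heq : q * (e : ℝ) ≤ q * (L ^ 2 * e) := by
    gcongr
    exact le_mul_of_one_le_left (by linarith) (by nlinarith)
  rw [hT]
  have he0 : 0 ≤ q * (L ^ 2 * (e : ℝ)) := by positivity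
  calc _ ≤ 24 * q * (e + 6 * G) + 568 * (L ^ 2 * G) := add_le_add t₁ t₂
    _ = 24 * (q * (e : ℝ)) + 144 * (q * G) + 568 * (L ^ 2 * G) := by ring
    _ ≤ 736 * (q * (L ^ 2 * G)) + 736 * (q * (L ^ 2 * e)) := by linarith
    _ = _ := by ring

end Rounds

end ParameterChoice

/-! ### Total number of rounds and polynomial bounds -/

section Rounds

variable {e n : ℕ} (a c : ℕ) (ε : ℝ)

theorem chosenParams_q_pos (hε : 0 < ε) (hn : 2 ≤ n) : 0 < (chosenParams a c ε e n).q :=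
  lt_min (Nat.ceil_pos.2 (by positivity)) (by positivity)

theorem scales_le : (chosenParams a c ε e n).scales + 1 ≤ (a + 3) * (Nat.log 2 n + 1) := by
  have h1 : 2 * n ^ (a + 1) < 2 ^ ((Nat.log 2 n + 1) * (a + 1) + 1) := by
    rw [pow_succ 2, pow_mul, mul_comm]
    exact Nat.mul_lt_mul_of_pos_right (Nat.pow_lt_pow_left (lt_two_pow_log n) (by omega)) two_pos
  have h2 : Nat.log 2 (2 * n ^ (a + 1)) < (Nat.log 2 n + 1) * (a + 1) + 1 :=
    Nat.log_lt_of_lt_pow' (by omega) h1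
  show Nat.log 2 (2 * n ^ (a + 1)) + 1 + 1 ≤ _
  nlinarith

theorem rounds_le (hε : 0 < ε) (hε1 : ε ≤ 1) (he : 1 ≤ e) (hn : 2 ≤ n) (hen : e ≤ n) {D W : ℕ}
    (heD : e ≤ D) (hW : 2 ≤ W) :
    ((4 * e + 4 + (chosenParams a c ε e n).j₂ +
      ((chosenParams a c ε e n).scales + 1) * (chosenParams a c ε e n).T₁ +
      ((chosenParams a c ε e n).scales + 1) * (chosenParams a c ε e n).T₂ : ℕ) : ℝ) ≤
      (777 * 216 * (a + 3) * (c + 5) ^ 2) * Real.log n ^ 3 *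
        ((√n * (D : ℝ) ^ (1 / 4 : ℝ) + D) * Real.log W / ε) := by
  have hq := chosenParams_q_pos (e := e) a c ε hε hn
  have h₁ := chosenParams_T₁_le a c ε he hn hq
  have h₂ := chosenParams_T₂_le a c ε he hn hen hq
  have hs : (((chosenParams a c ε e n).scales + 1 : ℕ) : ℝ) ≤
      (a + 3) * ((Nat.log 2 n + 1 : ℕ) : ℝ) := by exact_mod_cast scales_le a c ε
  have hj : ((chosenParams a c ε e n).j₂ : ℝ) ≤ ((Nat.log 2 n + 1 : ℕ) : ℝ) := by
    exact_mod_cast (level₂_le hen).trans (Nat.le_succ _)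
  have hlog := log_le_three_mul hn
  have hqε : ((chosenParams a c ε e n).q : ℝ) ≤ 4 / ε := by
    have h1 : ((chosenParams a c ε e n).q : ℝ) ≤ ⌈3 / ε⌉₊ := by exact_mod_cast min_le_left _ _
    have h2 := Nat.ceil_lt_add_one (show 0 ≤ 3 / ε by positivity)
    have h3 : 1 ≤ 1 / ε := (one_le_div hε).2 hε1
    have h4 : 4 / ε = 3 / ε + 1 / ε := by ring
    linarith
  have hLs : (slack c n : ℝ) = (c + 5) * ((Nat.log 2 n + 1 : ℕ) : ℝ) := by
    exact_mod_cast (rfl : slack c n = (c + 5) * (Nat.log 2 n + 1))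
  have hL1 : (1 : ℝ) ≤ ((Nat.log 2 n + 1 : ℕ) : ℝ) := by exact_mod_cast Nat.succ_pos _
  have hS1 : (1 : ℝ) ≤ slack c n := by exact_mod_cast one_le_slack c n
  have hG := one_le_mainTerm he hn
  have he1 : (1 : ℝ) ≤ e := by exact_mod_cast he
  have hq1 : (1 : ℝ) ≤ (chosenParams a c ε e n).q := by exact_mod_cast hq
  have hGD : mainTerm e n + e ≤ √n * (D : ℝ) ^ (1 / 4 : ℝ) + D := by
    have : (e : ℝ) ≤ D := by exact_mod_cast heD
    unfold mainTerm
    gcongr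
  have hlogW : 1 ≤ 2 * Real.log W := by
    have h1 : Real.log 2 ≤ Real.log W := Real.log_le_log two_pos (by exact_mod_cast hW)
    have := Real.log_two_gt_d9
    linarith
  push_cast at hs ⊢
  set L : ℝ := ((Nat.log 2 n + 1 : ℕ) : ℝ) with hLdef
  have hLcast : (Nat.log 2 n : ℝ) + 1 = L := by rw [hLdef]; push_cast; rfl
  rw [hLcast] at hs
  set s : ℝ := ((slack c n : ℕ) : ℝ)
  set q : ℝ := (((chosenParams a c ε e n).q : ℕ) : ℝ)
  set M : ℝ := mainTerm e n + e with hM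
  set M' : ℝ := √n * (D : ℝ) ^ (1 / 4 : ℝ) + D
  set l : ℝ := Real.log n
  set lW : ℝ := Real.log W
  have hM2 : 2 ≤ M := by linarith
  have hsum : ((chosenParams a c ε e n).T₁ : ℝ) + (chosenParams a c ε e n).T₂ ≤
      768 * q * s ^ 2 * M := by
    have h3 : 32 * q * s * mainTerm e n ≤ 32 * q * s ^ 2 * M := by
      have : s ≤ s ^ 2 := by nlinarith
      gcongr
      linarith
    linarith
  have hX : (1 : ℝ) ≤ (a + 3) * L * (q * s ^ 2) := by
    have h3 : (1 : ℝ) ≤ (a + 3) := by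
      have : (0 : ℝ) ≤ a := Nat.cast_nonneg a
      linarith
    exact one_le_mul_of_one_le_of_one_le (one_le_mul_of_one_le_of_one_le h3 hL1)
      (one_le_mul_of_one_le_of_one_le hq1 (one_le_pow₀ hS1))
  have hLX : L ≤ (a + 3) * L * (q * s ^ 2) := by
    have h3 : (1 : ℝ) ≤ (a + 3) * (q * s ^ 2) := by
      have : (0 : ℝ) ≤ a := Nat.cast_nonneg a
      exact one_le_mul_of_one_le_of_one_le (by linarith)
        (one_le_mul_of_one_le_of_one_le hq1 (one_le_pow₀ hS1))
    calc L ≤ L * ((a + 3) * (q * s ^ 2)) := le_mul_of_one_le_right (by linarith) h3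
      _ = _ := by ring
  calc _ = (4 * e + 4) + ((chosenParams a c ε e n).j₂ : ℝ) +
        ((chosenParams a c ε e n).scales + 1) *
          (((chosenParams a c ε e n).T₁ : ℝ) + (chosenParams a c ε e n).T₂) := by ring
    _ ≤ 8 * M + L * M + ((a + 3) * L) * (768 * q * s ^ 2 * M) := by
        gcongr
        · linarith
        · exact hj.trans (le_mul_of_one_le_right (by linarith) (by linarith))
    _ ≤ 8 * ((a + 3) * L * (q * s ^ 2)) * M + (a + 3) * L * (q * s ^ 2) * M +
        ((a + 3) * L) * (768 * q * s ^ 2 * M) := by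
        gcongr
        linarith
    -- 777 = 8 + 1 + 768, from the survey, the coins and the floodings (32 + 736). Next, `L ≤ 3 * l`
    -- contributes 27, while `q ≤ 4 / ε` and `1 ≤ 2 * lW` contribute 8, whence 216 = 27 · 8.
    _ = 777 * (a + 3) * (c + 5) ^ 2 * L ^ 3 * (M * q * 1) := by rw [hLs]; ring
    _ ≤ 777 * (a + 3) * (c + 5) ^ 2 * (3 * l) ^ 3 * (M' * (4 / ε) * (2 * lW)) := by
        gcongr
    _ = _ := by ring

/-- The caps by `n` and by `3 * n ^ (a + 1)` in `chosenParams` make these bounds independent of `c`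
and `ε`, as the bandwidth constant requires. -/
theorem poly_bounds (hn : 2 ≤ n) (hen : e ≤ n) :
    (chosenParams a c ε e n).T₁ ≤ n ^ (2 * a + 12) ∧
      (chosenParams a c ε e n).T₂ ≤ n ^ (2 * a + 12) := by
  set p := chosenParams a c ε e n with hp
  have hq : p.q ≤ 3 * n ^ (a + 1) := min_le_right _ _
  have hb : p.b ≤ n := min_le_left _ _
  have hH : p.H / p.b ≤ n := (Nat.div_le_self _ _).trans (min_le_left _ _)
  have hk₁ : p.k₁ ≤ n + 1 := Nat.succ_le_succ (min_le_left _ _)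
  have hk₂ : p.k₂ ≤ n + 1 := Nat.succ_le_succ (min_le_left _ _)
  have hA : p.A = 2 * e + 1 := rfl
  have hpow : ∀ k, 1 ≤ n ^ k := fun k => Nat.one_le_pow _ _ (by omega)
  set Q := n ^ (a + 1) with hQ
  have hQ1 : 1 ≤ Q := hpow _
  have h2q : 2 * p.q + 1 ≤ 7 * Q := by omega
  have hbig : 64 * (n * n * Q) ≤ n ^ (2 * a + 12) := by
    calc 64 * (n * n * Q) ≤ n ^ 6 * (n * n * Q) :=
          Nat.mul_le_mul_right _ (by
            calc 64 = 2 ^ 6 := by norm_num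
              _ ≤ n ^ 6 := Nat.pow_le_pow_left hn 6)
      _ = n ^ (a + 9) := by rw [hQ]; ring
      _ ≤ n ^ (2 * a + 12) := Nat.pow_le_pow_right (by omega) (by omega)
  have hnQ : n ≤ n * n * Q := by nlinarith [Nat.mul_le_mul (Nat.mul_le_mul_left n (show 1 ≤ n by omega)) hQ1]
  constructor
  · refine le_trans ?_ hbig
    calc p.T₁ = (2 * p.q + 1) * (2 * p.b) + p.k₁ := rfl
      _ ≤ (7 * Q) * (2 * n) + (n + 1) := by gcongr
      _ ≤ 64 * (n * n * Q) := by
          have : 7 * Q * (2 * n) ≤ 14 * (n * n * Q) := by nlinarith [Nat.zero_le (Q * n)]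
          omega
  · refine le_trans ?_ hbig
    calc p.T₂ = p.A * ((2 * p.q + 1) * (p.H / p.b + 1) + 1) + p.k₂ * p.k₁ := rfl
      _ ≤ (3 * n) * ((7 * Q) * (n + 1) + 1) + (n + 1) * (n + 1) := by
          gcongr
          omega
      _ ≤ 64 * (n * n * Q) := by
          have h1 : n * Q ≤ n * n * Q := Nat.mul_le_mul_right Q (Nat.le_mul_of_pos_left n (by omega))
          have h2 : n * n ≤ n * n * Q := Nat.le_mul_of_pos_right _ hQ1
          nlinarith

end Rounds

/-! ### Comparison with exact distances and the main theorem -/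

section Main

variable {V : Type u} {N : Network V} (I : SSSPInstance N)

theorem HasWalk.snoc {w : V → V → Option ℕ} {u x v : V} {d a : ℕ} (p : HasWalk w u x d)
    (h : w x v = some a) : HasWalk w u v (d + a) := by
  induction p with
  | nil => simpa using HasWalk.cons h (.nil v)
  | cons h' _ ih => rw [add_assoc]; exact .cons h' (ih h)

theorem hasWalk_iff {u v : V} {d : ℕ} :
    HasWalk I.weight u v d ↔ ∃ k, HopWalk (inputWeight I) k u v d := by
  constructor
  · intro p
    induction p with
    | nil u => exact ⟨0, .nil u⟩
    | cons h _ ih =>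
      obtain ⟨k, hk⟩ := ih
      refine ⟨1 + k, HopWalk.trans ?_ hk⟩
      simpa using (HopWalk.nil _).snoc (edgeWeight_eq_coe.2 h)
  · rintro ⟨k, p⟩
    induction p with
    | nil u => exact .nil u
    | snoc _ h ih => exact ih.snoc (edgeWeight_eq_coe.1 h)

theorem dist_le_of_hopWalk {u v : V} {k d : ℕ} (p : HopWalk (inputWeight I) k u v d) :
    dist I.weight u v ≤ d := sInf_le ⟨d, (hasWalk_iff I).2 ⟨k, p⟩, rfl⟩

theorem dist_eq_δ (T : PathTree (inputWeight I) I.source) {v : V}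
    (hv : Reaches (inputWeight I) I.source v) : dist I.weight I.source v = T.δ v := by
  obtain ⟨hr, hh, d, hd, hδ⟩ := T.iterate hv le_rfl
  have hs := T.root hr (by omega)
  rw [hs, T.δ_root, zero_add] at hδ
  rw [hs] at hd
  refine le_antisymm (hδ ▸ dist_le_of_hopWalk I hd) (le_sInf ?_)
  rintro _ ⟨d, p, rfl⟩
  obtain ⟨k, p⟩ := (hasWalk_iff I).1 p
  exact_mod_cast T.δ_le p

theorem dist_eq_top {v : V} (hv : ¬ Reaches (inputWeight I) I.source v) :
    dist I.weight I.source v = ⊤ := by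
  refine sInf_eq_top.2 ?_
  rintro _ ⟨d, p, -⟩
  obtain ⟨k, p⟩ := (hasWalk_iff I).1 p
  exact absurd ⟨k, d, p⟩ hv

/-- If q ≥ 3/ε, then (q + 1)² ≤ q² + 3q ≤ q²(1 + ε). If q is capped at 3Q, the result is exact: d ≥
δ + 1 would give q² ≤ (2q + 1)δ ≤ 3qδ and so Q ≤ δ. -/
theorem le_of_approx {q Q d δ : ℕ} {ε : ℝ} (hε : 0 < ε) (hq : q = min ⌈3 / ε⌉₊ (3 * Q))
    (hqpos : 0 < q) (hδ : δ < Q) (h : q ^ 2 * d ≤ (q + 1) ^ 2 * δ) : (d : ℝ) ≤ (1 + ε) * δ := by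
  have hq1 : (1 : ℝ) ≤ q := by exact_mod_cast hqpos
  have h' : (q : ℝ) ^ 2 * d ≤ (q + 1) ^ 2 * δ := by exact_mod_cast h
  have hδ0 : (0 : ℝ) ≤ δ := Nat.cast_nonneg δ
  rcases min_choice ⌈3 / ε⌉₊ (3 * Q) with hc | hc
  · have h3 : 3 ≤ q * ε := by
      have := Nat.le_ceil (3 / ε)
      rw [← hc, ← hq, div_le_iff₀ hε] at this
      exact this
    have h4 : ((q : ℝ) + 1) ^ 2 ≤ q ^ 2 * (1 + ε) := by nlinarith
    have h5 : (q : ℝ) ^ 2 * d ≤ q ^ 2 * ((1 + ε) * δ) := by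
      calc (q : ℝ) ^ 2 * d ≤ (q + 1) ^ 2 * δ := h'
        _ ≤ q ^ 2 * (1 + ε) * δ := by gcongr
        _ = _ := by ring
    exact le_of_mul_le_mul_left h5 (by positivity)
  · have hle : d ≤ δ := by
      by_contra hlt
      have h1 : q ^ 2 * (δ + 1) ≤ (q + 1) ^ 2 * δ :=
        (Nat.mul_le_mul_left _ (by omega)).trans h
      have h2 : q * q ≤ q * (3 * δ) := by nlinarith
      have h3 := Nat.le_of_mul_le_mul_left h2 hqpos
      omega
    have : (d : ℝ) ≤ δ := by exact_mod_cast hle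
    nlinarith

theorem isApprox_coe {ε : ℝ} {d δ : ℕ} (hε : 0 < ε) (h₁ : δ ≤ d) (h₂ : (d : ℝ) ≤ (1 + ε) * δ) :
    IsApprox (1 + ε) δ d := by
  refine ⟨by exact_mod_cast h₁, ?_⟩
  have : ENNReal.ofReal d ≤ ENNReal.ofReal ((1 + ε) * δ) := ENNReal.ofReal_le_ofReal h₂
  rw [ENNReal.ofReal_mul (by linarith), ENNReal.ofReal_natCast, ENNReal.ofReal_natCast] at this
  simpa using this

theorem isApprox_top {ε : ℝ} (hε : 0 < ε) : IsApprox (1 + ε) ⊤ ⊤ := by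
  refine ⟨le_rfl, ?_⟩
  have : ENNReal.ofReal (1 + ε) ≠ 0 := by simp; linarith
  simp [ENNReal.mul_top this]

open MeasureTheory in
theorem one_sub_le_real_successEvent [Fintype V] {A : Algorithm} {α : ℝ} {δ : ℝ}
    {bad : Set (Coins V)} (hbad : (coinMeasure V).real bad ≤ δ)
    (h : ∀ ω, ω ∉ bad → ω ∈ successEvent A I α) :
    1 - δ ≤ (coinMeasure V).real (successEvent A I α) := by
  have h1 : (1 : ℝ) ≤ (coinMeasure V).real (successEvent A I α) + (coinMeasure V).real bad := by
    rw [← probReal_univ (μ := coinMeasure V)]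
    refine (measureReal_mono (fun ω _ => ?_) (measure_ne_top _ _)).trans (measureReal_union_le _ _)
    by_cases hω : ω ∈ bad
    · exact .inr hω
    · exact .inl (h ω hω)
  linarith

theorem approximate_sssp [Fintype V] (a c : ℕ) {ε : ℝ} (hε : 0 < ε) (hε1 : ε ≤ 1) (W : ℕ)
    (hid : ∀ v, N.ident v ≤ Fintype.card V ^ a) (hW : 2 ≤ W) (hWn : W ≤ Fintype.card V ^ a)
    (hw : ∀ u v x, I.weight u v = some x → x ≤ W) :
    RespectsBandwidth (ssspProtocol (chosenParams a c ε)).toAlgorithm I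
      (2 * (4 * a + 25) * Nat.log 2 (Fintype.card V)) ∧
    TerminatesWithin (ssspProtocol (chosenParams a c ε)).toAlgorithm I
      ((777 * 216 * (a + 3) * (c + 5) ^ 2) * Real.log (Fintype.card V) ^ 3 *
        ((√(Fintype.card V) * (N.links.diam : ℝ) ^ (1 / 4 : ℝ) + N.links.diam) *
          Real.log W / ε)) ∧
    1 - 1 / (Fintype.card V : ℝ) ^ c ≤ (coinMeasure V).real
      (successEvent (ssspProtocol (chosenParams a c ε)).toAlgorithm I (1 + ε)) := by
  have hne : Nonempty V := ⟨I.source⟩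
  set n := Fintype.card V with hn_def
  -- A single node is impossible, since then `2 ≤ W ≤ 1 ^ a`.
  have hn : 2 ≤ n := by
    by_contra hlt
    have h1 : n = 1 := by
      have : 0 < n := Fintype.card_pos
      omega
    rw [h1, one_pow] at hWn
    omega
  set e := Survey.ecc I with he_def
  have hnt : Nontrivial V := Fintype.one_lt_card_iff_nontrivial.1 (by omega)
  have he : 1 ≤ e := by
    obtain ⟨v, hv⟩ := exists_ne I.source
    have h1 := N.connected.pos_dist_of_ne hv.symm
    exact h1.trans_le (Survey.lv_le_ecc I v)
  have hen : e ≤ n := Finset.sup_le fun v _ => (dist_lt_card N.connected _ _).le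
  have heD : e ≤ N.links.diam := Finset.sup_le fun v _ =>
    SimpleGraph.dist_le_diam (SimpleGraph.connected_iff_ediam_ne_top.1 N.connected)
  have hA : ∀ u v, N.links.dist u v < 2 * e + 1 := by
    intro u v
    have h1 := N.connected.dist_triangle (u := u) (v := I.source) (w := v)
    have h2 := Survey.lv_le_ecc I u
    have h3 := Survey.lv_le_ecc I v
    rw [N.links.dist_comm (u := u) (v := I.source)] at h1
    unfold Survey.lv at h2 h3
    omega
  set p := chosenParams a c ε e n with hp
  obtain ⟨hT₁, hT₂⟩ := poly_bounds a c ε hn hen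
  have hX : n ^ a + 3 ≤ n ^ (a + 2) := by
    have h1 : 1 ≤ n ^ a := Nat.one_le_pow _ _ (by omega)
    have h2 : 4 ≤ n ^ 2 := Nat.pow_le_pow_left hn 2
    have h3 := Nat.mul_le_mul_left (n ^ a) h2
    rw [pow_add]
    omega
  have hnX : n < n ^ (a + 2) := by
    calc n = n ^ 1 := (pow_one n).symm
      _ < n ^ (a + 2) := Nat.pow_lt_pow_right (by omega) (by omega)
  have hXY : (n ^ (a + 2)) ^ 2 ≤ n ^ (2 * a + 12) := by
    rw [← pow_mul]; exact Nat.pow_le_pow_right (by omega) (by omega)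
  -- A message is at most n^(4a+24), hence below n^(4a+25); `size_le_mul_log` contributes the factor
  -- 2.
  have hB : ∀ m < (n ^ (2 * a + 12)) ^ 2 + 1, m.size ≤ 2 * (4 * a + 25) * Nat.log 2 n := by
    intro m hm
    refine size_le_mul_log hn ((Nat.lt_succ_iff.1 hm).trans_lt ?_)
    rw [← pow_mul]; exact Nat.pow_lt_pow_right (by omega) (by omega)
  have key := fun ω : Coins V => ssspProtocol_computes I (chosenParams a c ε) ω (p := p) rfl he
    (X := n ^ (a + 2)) (fun v => by have := hid v; omega) hnX hXY hT₁ hT₂ hB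
    (chosenParams_q_pos a c ε hε hn)
    (lt_min (by omega) (Nat.mul_pos (one_le_slack c n) (by positivity)))
    (le_max_left _ _) hA
  refine ⟨fun ω => ?_, fun ω => ?_, ?_⟩
  · obtain ⟨y, hy, -⟩ := key ω
    exact hy.size_message_le
  · obtain ⟨y, hy, -⟩ := key ω
    refine ⟨_, rounds_le a c ε hε hε1 he hn hen heD hW, fun v => ?_⟩
    have := hy.output_state v
    rw [surveyTime] at this
    rw [this]
    rfl
  · obtain ⟨T⟩ := exists_pathTree (inputWeight I) I.source
    have hδ : ∀ v, Reaches (inputWeight I) I.source v → T.δ v < n ^ (a + 1) := by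
      intro v hv
      calc T.δ v ≤ T.hop v * W := T.δ_le_mul (fun u v x h => hw u v x (edgeWeight_eq_coe.1 h)) hv
        _ ≤ T.hop v * n ^ a := Nat.mul_le_mul_left _ hWn
        _ < n * n ^ a := Nat.mul_lt_mul_of_pos_right (T.hop_lt_card hv) (by positivity)
        _ = n ^ (a + 1) := by ring
    -- Only these four events can spoil the approximation; their total probability is at most (2n +
    -- 2) · 2^(−slack).
    refine one_sub_le_real_successEvent I (bad :=
      ({ω | ¬ T.Hits (sample I ω (surveyTime I) p.j₁) p.b} ∪
        {ω | ¬ T.Hits (sample I ω (surveyTime I) p.j₂) p.H}) ∪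
      ({ω | p.k₁ < (sample I ω (surveyTime I) p.j₁).card} ∪
        {ω | p.k₂ < (sample I ω (surveyTime I) p.j₂).card})) ?_ fun ω hω => ?_
    · refine le_trans ?_ (two_inv_pow_slack_le hn c)
      have h1 := real_not_hits_le I T (surveyTime I) p.j₁ (slack c n)
      have h2 := real_not_hits_le I T (surveyTime I) p.j₂ (slack c n)
      have h3 := real_sampleBound_lt_le I (surveyTime I) p.j₁ (slack c n)
      have h4 := real_sampleBound_lt_le I (surveyTime I) p.j₂ (slack c n)
      refine (MeasureTheory.measureReal_union_le _ _).trans ((add_le_add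
        ((MeasureTheory.measureReal_union_le _ _).trans (add_le_add h1 h2))
        ((MeasureTheory.measureReal_union_le _ _).trans (add_le_add h3 h4))).trans ?_)
      have h5 : (2 : ℝ) ≤ n := by exact_mod_cast hn
      have h6 : (0 : ℝ) < (2 : ℝ)⁻¹ ^ slack c n := by positivity
      rw [← hn_def]
      nlinarith
    · simp only [Set.mem_union, Set.mem_ofPred_eq, not_or, not_not, not_lt] at hω
      obtain ⟨⟨hit₁, hit₂⟩, hk₁, hk₂⟩ := hω
      obtain ⟨y, hy, hsound, hcomplete⟩ := key ω
      intro v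
      refine ⟨_, y v, hy.output_state v, ?_⟩
      by_cases hv : Reaches (inputWeight I) I.source v
      · obtain ⟨d, hd, hle⟩ := hcomplete T (fun v hv => by
          have h1 := hδ v hv
          have h2 : 2 * n ^ (a + 1) < 2 ^ (Nat.log 2 (2 * n ^ (a + 1)) + 1) := lt_two_pow_log _
          exact lt_trans (by omega) h2) hit₁ hit₂ hk₁ hk₂ v hv
        obtain ⟨k, d', hd', hle'⟩ := hsound v d hd
        rw [hd, dist_eq_δ I T hv]
        exact isApprox_coe hε ((T.δ_le hd').trans hle')
          (le_of_approx hε rfl (chosenParams_q_pos (e := e) a c ε hε hn) (hδ v hv) hle)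
      · have hy' : y v = ⊤ := by
          by_contra hne
          obtain ⟨d, hd⟩ := ENat.ne_top_iff_exists.1 hne
          obtain ⟨k, d', hd', -⟩ := hsound v d hd.symm
          exact hv ⟨k, d', hd'⟩
        rw [hy', dist_eq_top I hv]
        exact isApprox_top hε

end Main

end BroadcastCongest

theorem mainTheorem4 :
    -- `a` bounds the size of identifiers and weights, `β` is the constant of the bandwidth,
    -- `c` is the exponent of "with high probability", `C` and `k` are the constants of `Õ`
    ∀ a : ℕ, ∃ β : ℕ, ∀ c : ℕ, ∃ (C : ℝ) (k : ℕ), ∀ ε : ℝ, 0 < ε → ε ≤ 1 →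
      ∃ A : BroadcastCongest.Algorithm,
        ∀ (V : Type u) [Fintype V] (N : BroadcastCongest.Network V)
          (I : BroadcastCongest.SSSPInstance N) (W : ℕ),
          (∀ v, N.ident v ≤ Fintype.card V ^ a) →
          2 ≤ W → W ≤ Fintype.card V ^ a →
          (∀ u v x, I.weight u v = some x → x ≤ W) →
          BroadcastCongest.RespectsBandwidth A I (β * Nat.log 2 (Fintype.card V)) ∧
          BroadcastCongest.TerminatesWithin A I
            (C * Real.log (Fintype.card V) ^ k *
              ((√(Fintype.card V) * (N.links.diam : ℝ) ^ (1 / 4 : ℝ) + N.links.diam) *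
                Real.log W / ε)) ∧
          1 - 1 / (Fintype.card V : ℝ) ^ c ≤
            (BroadcastCongest.coinMeasure V).real
              (BroadcastCongest.successEvent A I (1 + ε)) := by
  intro a
  refine ⟨2 * (4 * a + 25), fun c => ⟨777 * 216 * (a + 3) * (c + 5) ^ 2, 3, fun ε hε hε1 =>
    ⟨(BroadcastCongest.ssspProtocol (BroadcastCongest.chosenParams a c ε)).toAlgorithm, ?_⟩⟩⟩
  intro V _ N I W hid hW hWn hw
  exact BroadcastCongest.approximate_sssp I a c hε hε1 W hid hW hWn hw
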